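/- Let $M$ be a closed (compact, without boundary) smooth manifold of dimension $2n+1$. A presymplectic form on $M$ is a closed smooth $2$-form $\omega$ of rank $2n$ at every point; its Reeb foliation $\mathfrak F$ is the one-dimensional foliation with tangent bundle $\ker\omega=\{V\in TM : \iota_V\omega=0\}$. A form $\alpha$ is basic for a foliation $\mathfrak F$ if $\iota_X\alpha=\iota_Xd\alpha=0$ for all $X\in T\mathfrak F$; basic forms with the exterior derivative form a complex with cohomology $H^*_b(M;\mathfrak F)$. An isotopy of $M$ is a smooth path $\{\phi_t\}_{t\in[0,1]}$ of diffeomorphisms of $M$ with $\phi_0=\mathrm{id}$. A path $\{\eta_t\}_{t\in[0,1]}$ of closed $2$-forms that are basic for a fixed foliation $\mathfrak F$ is said to have constant basic cohomology class in $H^2_b(M;\mathfrak F)$ if $\eta_t-\eta_0=d\beta_t$ for all $t\in[0,1]$, where $\{\beta_t\}_{t\in[0,1]}$ is a smooth path of $1$-forms basic for $\mathfrak F$. Let $\{\omega_t\}_{t\in[0,1]}$ be a smooth path of presymplectic forms on $M$, and let $\mathfrak F_t$ be the Reeb foliation of $\omega_t$. (1) If $\mathfrak F_t=\mathfrak F_0$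 for all $t\in[0,1]$ and the basic cohomology class $[\omega_t]_b\in H^2_b(M;\mathfrak F_0)$ is constant (so that, in particular, the forms $\omega_t$ are cohomologous), then $\{\omega_t\}$ is an isotopy: there is an isotopy $\{\phi_t\}$ of $M$ such that $\omega_t=\phi_t^*\omega_0$ for all $t\in[0,1]$. (2) More generally, if $\{\phi_t\}_{t\in[0,1]}$ is an isotopy of $M$ that conjugates $\mathfrak F_0$ to $\mathfrak F_t$, i.e. $d\phi_t(T\mathfrak F_0)=T\mathfrak F_t$ for all $t\in[0,1]$, and the basic cohomology class of $\omega_t$ is constant after $H^2_b(M;\mathfrak F_t)$ is identified with $H^2_b(M;\mathfrak F_0)$ by $\phi_t^*$, i.e. the path $\{\phi_t^*\omega_t\}$ has constant basic cohomology class in $H^2_b(M;\mathfrak F_0)$, then $\{\omega_t\}$ is an isotopy: there is an isotopy $\{\psi_t\}$ of $M$ such that $\omega_t=\psi_t^*\omega_0$ for all $t\in[0,1]$. -/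

import Mathlib

open scoped Manifold ContDiff
open Set

noncomputable section

namespace Presymplectic

/-- A (not necessarily smooth) differential `k`-form on a `d`-dimensional manifold `M`. -/
abbrev Form (d : ℕ) (M : Type*) [TopologicalSpace M]
    [ChartedSpace (EuclideanSpace ℝ (Fin d)) M] (k : ℕ) : Type _ :=
  (x : M) → TangentSpace (𝓡 d) x [⋀^Fin k]→L[ℝ] ℝ

section Forms

variable {d : ℕ} {M : Type*} [TopologicalSpace M] [ChartedSpace (EuclideanSpace ℝ (Fin d)) M]
  {k : ℕ}

/-- The expression of a form in the preferred chart around `x₀`: the pullback of the form under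
the inverse chart. It is meaningful on the target of the chart, an open set. -/
def Form.inChart (α : Form d M k) (x₀ : M) (y : EuclideanSpace ℝ (Fin d)) :
    EuclideanSpace ℝ (Fin d) [⋀^Fin k]→L[ℝ] ℝ :=
  (α ((extChartAt (𝓡 d) x₀).symm y)).compContinuousLinearMap
    (mfderiv 𝓘(ℝ, EuclideanSpace ℝ (Fin d)) (𝓡 d) (extChartAt (𝓡 d) x₀).symm y :
      EuclideanSpace ℝ (Fin d) →L[ℝ] TangentSpace (𝓡 d) ((extChartAt (𝓡 d) x₀).symm y))

theorem Form.inChart_apply (α : Form d M k) (x₀ : M) (y : EuclideanSpace ℝ (Fin d))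
    (v : Fin k → EuclideanSpace ℝ (Fin d)) :
    α.inChart x₀ y v = α ((extChartAt (𝓡 d) x₀).symm y) (fun i ↦
      mfderiv 𝓘(ℝ, EuclideanSpace ℝ (Fin d)) (𝓡 d) (extChartAt (𝓡 d) x₀).symm y (v i)) :=
  rfl

/-- Smooth differential forms: the coefficients in charts are smooth. -/
def Form.IsSmooth (α : Form d M k) : Prop :=
  ∀ x₀ : M, ContDiffOn ℝ ∞ (α.inChart x₀) (extChartAt (𝓡 d) x₀).target

/-- A path `(α_t)`, `t ∈ [0,1]`, of forms is smooth if its coefficients in charts are smooth in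
`(t, y)` jointly, up to `t = 0` and `t = 1`. Values for `t` outside `[0,1]` play no role. -/
def IsSmoothPath (α : ℝ → Form d M k) : Prop :=
  ∀ x₀ : M, ContDiffOn ℝ ∞
    (fun p : ℝ × EuclideanSpace ℝ (Fin d) ↦ (α p.1).inChart x₀ p.2)
    (Icc 0 1 ×ˢ (extChartAt (𝓡 d) x₀).target)

/-- The exterior derivative of a form on a manifold, computed at `x` in the preferred chart
around `x` and transported back to the tangent space at `x`. -/
def Form.extD (α : Form d M k) : Form d M (k + 1) := fun x ↦
  (extDeriv (α.inChart x) (extChartAt (𝓡 d) x x)).compContinuousLinearMap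
    (mfderiv (𝓡 d) 𝓘(ℝ, EuclideanSpace ℝ (Fin d)) (extChartAt (𝓡 d) x) x :
      TangentSpace (𝓡 d) x →L[ℝ] EuclideanSpace ℝ (Fin d))

theorem Form.extD_apply (α : Form d M k) (x : M) (v : Fin (k + 1) → TangentSpace (𝓡 d) x) :
    α.extD x v = extDeriv (α.inChart x) (extChartAt (𝓡 d) x x) (fun i ↦
      mfderiv (𝓡 d) 𝓘(ℝ, EuclideanSpace ℝ (Fin d)) (extChartAt (𝓡 d) x) x (v i)) :=
  rfl

/-- The pullback `φ^* α`. -/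
def Form.pullback (φ : M → M) (α : Form d M k) : Form d M k := fun x ↦
  (α (φ x)).compContinuousLinearMap (mfderiv (𝓡 d) (𝓡 d) φ x)

theorem Form.pullback_apply (φ : M → M) (α : Form d M k) (x : M)
    (v : Fin k → TangentSpace (𝓡 d) x) :
    α.pullback φ x v = α (φ x) (fun i ↦ mfderiv (𝓡 d) (𝓡 d) φ x (v i)) :=
  rfl

/-- The kernel `{V ∈ T_x M | ι_V σ = 0}` of a 2-form. For a presymplectic form these kernels are
the fibres of the Reeb bundle, that is, the tangent bundle of the Reeb foliation. -/
def Form.ker (σ : Form d M 2) (x : M) : Submodule ℝ (TangentSpace (𝓡 d) x) where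
  carrier := {v | ∀ w : TangentSpace (𝓡 d) x, σ x ![v, w] = 0}
  zero_mem' := fun w ↦ (σ x).map_coord_zero (0 : Fin 2) rfl
  add_mem' := by
    intro a b ha hb w
    have h : σ x ![a + b, w] = σ x ![a, w] + σ x ![b, w] :=
      (σ x).toMultilinearMap.cons_add (m := ![w]) a b
    rw [h, ha w, hb w, add_zero]
  smul_mem' := by
    intro c a ha w
    have h : σ x ![c • a, w] = c • σ x ![a, w] :=
      (σ x).toMultilinearMap.cons_smul (m := ![w]) c a
    rw [h, ha w, smul_zero]

/-- The rank of a 2-form at `x`: the codimension of its kernel. -/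
def Form.rank (σ : Form d M 2) (x : M) : ℕ :=
  Module.finrank ℝ (TangentSpace (𝓡 d) x ⧸ σ.ker x)

/-- A form is basic for the foliation with tangent bundle `D` if it is smooth and
`ι_X α = ι_X dα = 0` for all `X` tangent to the foliation. -/
structure Form.IsBasic (D : (x : M) → Submodule ℝ (TangentSpace (𝓡 d) x)) (α : Form d M k) :
    Prop where
  smooth : α.IsSmooth
  contract : ∀ (x : M) (v : Fin k → TangentSpace (𝓡 d) x), (∃ i, v i ∈ D x) → α x v = 0
  contract_d : ∀ (x : M) (v : Fin (k + 1) → TangentSpace (𝓡 d) x),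
    (∃ i, v i ∈ D x) → α.extD x v = 0

/-- Constancy of the basic cohomology class along a path `(η_t)`, `t ∈ [0,1]`, of closed forms
that are basic for the foliation with tangent bundle `D`: the differences `η_t - η_0` are the
exterior derivatives of a smooth path of basic forms. -/
def HasConstantBasicClass (D : (x : M) → Submodule ℝ (TangentSpace (𝓡 d) x))
    (η : ℝ → Form d M (k + 1)) : Prop :=
  ∃ β : ℝ → Form d M k, IsSmoothPath β ∧
    ∀ t ∈ Icc (0 : ℝ) 1, (β t).IsBasic D ∧ η t - η 0 = (β t).extD

/-- An isotopy `(φ_t)`, `t ∈ [0,1]`, of `M`: a smooth path of diffeomorphisms starting at the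
identity. -/
structure IsIsotopy (d : ℕ) {M : Type*} [TopologicalSpace M]
    [ChartedSpace (EuclideanSpace ℝ (Fin d)) M] (φ : ℝ → M → M) : Prop where
  smooth : ContMDiffOn (𝓘(ℝ, ℝ).prod (𝓡 d)) (𝓡 d) ∞ (fun p : ℝ × M ↦ φ p.1 p.2)
    (Icc 0 1 ×ˢ univ)
  diffeo : ∀ t ∈ Icc (0 : ℝ) 1, ∃ Φ : M ≃ₘ^∞⟮𝓡 d, 𝓡 d⟯ M, ⇑Φ = φ t
  zero : φ 0 = id

end Forms

section Presymplectic

variable {n : ℕ} {M : Type*} [TopologicalSpace M]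
  [ChartedSpace (EuclideanSpace ℝ (Fin (2 * n + 1))) M]

/-- A presymplectic form on a manifold of dimension `2n + 1`: a smooth closed 2-form of maximal
rank `2n`. -/
structure IsPresymplectic (σ : Form (2 * n + 1) M 2) : Prop where
  smooth : σ.IsSmooth
  closed : σ.extD = 0
  rank_eq : ∀ x, σ.rank x = 2 * n

/-- A smooth path `(ω_t)`, `t ∈ [0,1]`, of presymplectic forms. -/
structure IsPresymplecticPath (σ : ℝ → Form (2 * n + 1) M 2) : Prop where
  smooth : IsSmoothPath σ
  presymplectic : ∀ t ∈ Icc (0 : ℝ) 1, IsPresymplectic (σ t)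

/-- A path of 2-forms is an isotopy if `ω_t = φ_t^* ω_0` for an isotopy `(φ_t)`. -/
def IsGivenByIsotopy (σ : ℝ → Form (2 * n + 1) M 2) : Prop :=
  ∃ φ : ℝ → M → M, IsIsotopy (2 * n + 1) φ ∧
    ∀ t ∈ Icc (0 : ℝ) 1, σ t = (σ 0).pullback (φ t)

end Presymplectic

end Presymplectic

end

-- This is Moser's argument for forms with a kernel. Let `η_t` have a kernel line field independent
-- of `t`, with `η_0` closed and `η_t - η_0 = dβ_t`, `β_t` basic. Each `β_t` vanishes on the kernel,
-- hence so does `∂_t β_t`, and therefore `ι_{X_t} η_t = -∂_t β_t` has a solution although `η_t` is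
-- degenerate. Along the flow `Ψ_t` of `X_t`, Cartan's formula gives `d/dt Ψ_t^* η_t = Ψ_t^* (d
-- ι_{X_t} η_t + d ∂_t β_t) = 0`. So `Ψ_t^* η_t = η_0`, and the inverses of the `Ψ_t` form the
-- required isotopy (`exists_isotopy_of_constantBasicClass`). If the foliations are only conjugate
-- by `φ_t`, this applies to `φ_t^* σ_t`, and the isotopy obtained is composed with `φ_t⁻¹`
-- (`isGivenByIsotopy_of_conjugate`).
--
-- The data are smooth only over the closed interval `[0,1]`, whereas flows and inverse function
-- theorems need an open time interval. Time is therefore folded by `t = sin² τ`, which turns paths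
-- into smooth families over the whole line without extending them. Under `τ ↦ -τ` and `τ ↦ π - τ`
-- the forms are unchanged and the `τ`-derivative of `β` changes sign; so does `X`, because it is
-- built from the values of the two forms alone. The flow is then invariant under both reflections
-- and depends only on `sin² τ`. A smooth even function of `u` is a smooth function of `u²` up to
-- the endpoint (`contDiffOn_comp_sqrt`), which brings smoothness back to `[0,1]`
-- (`contMDiffOn_of_comp_sin_sq`).
--
-- Three analytic ingredients support this. Smooth dependence of flows on initial values comes from
-- the inverse function theorem applied to the integral equation on a Banach space of curves
-- (`exists_smooth_localFlow`). Smoothness of `X` comes from adding to `η` a rank one term `ℓ ⊗ ℓ`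
-- with `ℓ` nonzero on the kernel, which makes the contraction invertible
-- (`exists_smooth_solution_contract`), and from a partition of unity. The derivative of the
-- pullback is read off from a closed 2-form on `ℝ × V` (`hasDerivAt_pullback_zero`), so that no Lie
-- derivative is needed.

universe u

noncomputable section

/-! ### Smoothness of superposition operators on spaces of continuous maps -/

section Superposition

open Filter Topology

variable {K : Type*} [TopologicalSpace K] [CompactSpace K]

section Bilinear

variable {E F : Type*} [NormedAddCommGroup E] [NormedSpace ℝ E]
  [NormedAddCommGroup F] [NormedSpace ℝ F]

/-- Pointwise application of a continuous family of operators to a continuous map. -/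
def ContinuousMap.pointwiseApplyL :
    C(K, E →L[ℝ] F) →L[ℝ] C(K, E) →L[ℝ] C(K, F) :=
  LinearMap.mkContinuous₂
    (LinearMap.mk₂ ℝ (fun (A : C(K, E →L[ℝ] F)) (h : C(K, E)) ↦
        (⟨fun r ↦ A r (h r), A.continuous.clm_apply h.continuous⟩ : C(K, F)))
      (fun _ _ _ ↦ by ext; simp) (fun _ _ _ ↦ by ext; simp)
      (fun _ _ _ ↦ by ext; simp) (fun _ _ _ ↦ by ext; simp)) 1
    (fun A h ↦ by
      rw [ContinuousMap.norm_le _ (by positivity)]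
      intro r
      simp only [LinearMap.mk₂_apply, ContinuousMap.coe_mk, one_mul]
      exact ((A r).le_opNorm _).trans
        (mul_le_mul (A.norm_coe_le_norm r) (h.norm_coe_le_norm r) (norm_nonneg _)
          (norm_nonneg (A : C(K, E →L[ℝ] F)))))

/-- The superposition operator `γ ↦ f ∘ γ` is differentiable when `f` is `C¹`. -/
theorem hasFDerivAt_continuousMap_comp {f : E → F} (hf : ContDiff ℝ 1 f) (γ : C(K, E)) :
    HasFDerivAt (fun γ : C(K, E) ↦ (⟨f, hf.continuous⟩ : C(E, F)).comp γ)
      (ContinuousMap.pointwiseApplyL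
        ((⟨fderiv ℝ f, hf.continuous_fderiv one_ne_zero⟩ : C(E, E →L[ℝ] F)).comp γ)) γ := by
  have hd : Differentiable ℝ f := hf.differentiable one_ne_zero
  have hc : Continuous (fderiv ℝ f) := hf.continuous_fderiv one_ne_zero
  rw [hasFDerivAt_iff_isLittleO, Asymptotics.isLittleO_iff]
  intro c hc0
  have hcomp : IsCompact (range γ) := isCompact_range γ.continuous
  -- A sup-norm estimate needs one modulus of continuity for all `r`; compactness of the range of
  -- `γ` supplies it for `fderiv ℝ f`, and the mean value inequality on balls of that radius
  -- finishes.
  have hev : ∀ᶠ δ in 𝓝 (0 : ℝ), ∀ z ∈ range γ, 0 < δ → ∀ w, ‖w - z‖ < δ →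
      ‖fderiv ℝ f w - fderiv ℝ f z‖ ≤ c := by
    have := hcomp.uniformContinuousAt_of_continuousAt (fderiv ℝ f)
      (fun a _ ↦ hc.continuousAt) (Metric.dist_mem_uniformity hc0)
    rw [Metric.mem_uniformity_dist] at this
    obtain ⟨δ, hδ, H⟩ := this
    filter_upwards [gt_mem_nhds hδ] with δ' h' z hz _ w hw
    have := H (a := z) (b := w) (by rw [dist_comm, dist_eq_norm]; linarith) hz
    rw [← dist_eq_norm, dist_comm]
    exact le_of_lt this
  obtain ⟨δ, hδ, H⟩ := Metric.eventually_nhds_iff.1 hev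
  have h2 : (0 : ℝ) < δ / 2 := by positivity
  have H' := H (y := δ / 2) (by rw [dist_zero_right, Real.norm_of_nonneg h2.le]; linarith)
  filter_upwards [Metric.ball_mem_nhds γ h2] with γ' hγ'
  rw [ContinuousMap.norm_le _ (by positivity)]
  intro r
  have hr : ‖γ' r - γ r‖ ≤ ‖γ' - γ‖ := (γ' - γ).norm_coe_le_norm r
  have hlt : ‖γ' - γ‖ < δ / 2 := by rwa [mem_ball_iff_norm] at hγ'
  have := Convex.norm_image_sub_le_of_norm_hasFDerivWithin_le' (f := f) (f' := fderiv ℝ f)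
    (φ := fderiv ℝ f (γ r)) (C := c) (s := Metric.ball (γ r) (δ / 2)) (x := γ r) (y := γ' r)
    (fun x _ ↦ (hd x).hasFDerivAt.hasFDerivWithinAt)
    (fun x hx ↦ H' _ ⟨r, rfl⟩ h2 x (by rwa [mem_ball_iff_norm] at hx))
    (convex_ball _ _) (Metric.mem_ball_self h2)
    (by rw [mem_ball_iff_norm]; exact hr.trans_lt hlt)
  exact this.trans (by gcongr)

end Bilinear

/-- The superposition operator of a smooth map is smooth. -/
theorem contDiff_continuousMap_comp_nat {E : Type u} [NormedAddCommGroup E] [NormedSpace ℝ E]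
    (n : ℕ) : ∀ {F : Type u} [NormedAddCommGroup F] [NormedSpace ℝ F] {f : E → F}
      (hf : ContDiff ℝ ∞ f),
      ContDiff ℝ n (fun γ : C(K, E) ↦ (⟨f, hf.continuous⟩ : C(E, F)).comp γ) := by
  induction n with
  | zero =>
    intro F _ _ f hf
    exact contDiff_zero.2 (ContinuousMap.continuous_postcomp _)
  | succ n ih =>
    intro F _ _ f hf
    have hf' : ContDiff ℝ ∞ (fderiv ℝ f) := hf.fderiv_right (m := ∞) (by simp)
    have h1 : ContDiff ℝ 1 f := hf.of_le (by exact_mod_cast le_top)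
    have := contDiff_succ_iff_hasFDerivAt (𝕜 := ℝ) (n := n)
      (f := fun γ : C(K, E) ↦ (⟨f, hf.continuous⟩ : C(E, F)).comp γ)
    push_cast
    rw [this]
    -- The derivative is the superposition operator of `fderiv ℝ f` followed by a bounded linear
    -- map. The induction hypothesis is thus needed for the target `E →L[ℝ] F`, which is why `F` is
    -- quantified inside and shares its universe with `E`.
    exact ⟨fun γ ↦ ContinuousMap.pointwiseApplyL ((⟨fderiv ℝ f, hf'.continuous⟩ :
      C(E, E →L[ℝ] F)).comp γ), ContDiff.continuousLinearMap_comp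
      (ContinuousMap.pointwiseApplyL (K := K) (E := E) (F := F)) (ih hf'),
      fun γ ↦ hasFDerivAt_continuousMap_comp h1 γ⟩

theorem contDiff_continuousMap_comp {E F : Type u} [NormedAddCommGroup E] [NormedSpace ℝ E]
    [NormedAddCommGroup F] [NormedSpace ℝ F] {f : E → F} (hf : ContDiff ℝ ∞ f) :
    ContDiff ℝ ∞ (fun γ : C(K, E) ↦ (⟨f, hf.continuous⟩ : C(E, F)).comp γ) :=
  contDiff_infty.2 fun n ↦ contDiff_continuousMap_comp_nat n hf

end Superposition

/-! ### Smooth local flows in a Banach space -/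

section LocalFlow

open Filter Topology

variable {E : Type u} [NormedAddCommGroup E] [NormedSpace ℝ E]

/-- The primitive vanishing at `0` of a continuous map on `[-1, 1]`. -/
def primitiveL [CompleteSpace E] : C(Icc (-1 : ℝ) 1, E) →L[ℝ] C(Icc (-1 : ℝ) 1, E) :=
  LinearMap.mkContinuous
    { toFun := fun g ↦ ⟨fun r ↦ ∫ s in (0 : ℝ)..r, g (projIcc (-1) 1 (neg_le_self zero_le_one) s),
        (intervalIntegral.continuous_primitive (fun a b ↦ (g.continuous.comp
          continuous_projIcc).intervalIntegrable a b) 0).comp continuous_subtype_val⟩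
      map_add' := fun g h ↦ by
        ext r
        exact intervalIntegral.integral_add
          ((g.continuous.comp continuous_projIcc).intervalIntegrable _ _)
          ((h.continuous.comp continuous_projIcc).intervalIntegrable _ _)
      map_smul' := fun c g ↦ by
        ext r
        exact intervalIntegral.integral_smul c _ } 1
    (fun g ↦ by
      rw [ContinuousMap.norm_le _ (by positivity)]
      intro r
      have := intervalIntegral.norm_integral_le_of_norm_le_const (a := 0) (b := (r : ℝ))
        (f := fun s ↦ g (projIcc (-1) 1 (neg_le_self zero_le_one) s)) (C := ‖g‖)
        (fun s _ ↦ g.norm_coe_le_norm _)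
      refine this.trans ?_
      have hr : |(r : ℝ) - 0| ≤ 1 := by rw [sub_zero, abs_le]; exact r.2
      nlinarith [norm_nonneg g])

theorem primitiveL_apply [CompleteSpace E] (g : C(Icc (-1 : ℝ) 1, E)) (r : Icc (-1 : ℝ) 1) :
    primitiveL g r = ∫ s in (0 : ℝ)..r, g (projIcc (-1) 1 (neg_le_self zero_le_one) s) := rfl

/-- The map whose fibres are the solutions of the integral equation `γ = x + τ ∫ f(γ)`. -/
def integralEquation [CompleteSpace E] (f : C(E, E)) (p : (ℝ × E) × C(Icc (-1 : ℝ) 1, E)) :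
    (ℝ × E) × C(Icc (-1 : ℝ) 1, E) :=
  (p.1, p.2 - ContinuousLinearMap.const (R := ℝ) (Icc (-1 : ℝ) 1) p.1.2
    - p.1.1 • primitiveL (f.comp p.2))

theorem contDiff_integralEquation [CompleteSpace E] {f : E → E} (hf : ContDiff ℝ ∞ f) :
    ContDiff ℝ ∞ (integralEquation ⟨f, hf.continuous⟩) := by
  refine contDiff_fst.prodMk ((contDiff_snd.sub ?_).sub ?_)
  · exact (ContinuousLinearMap.contDiff _).comp (contDiff_snd.comp contDiff_fst)
  · exact (contDiff_fst.comp contDiff_fst).smul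
      (primitiveL.contDiff.comp ((contDiff_continuousMap_comp hf).comp contDiff_snd))

/-- At `τ = 0` the nonlinear term carries the factor zero, so it contributes nothing to the
derivative in the direction of the curve. What remains is a shear: the identity on both factors plus
a map from `(τ, x)` to curves. -/
theorem exists_equiv_hasFDerivAt_integralEquation [CompleteSpace E] {f : E → E}
    (hf : ContDiff ℝ ∞ f) (x₀ : E) :
    ∃ e : ((ℝ × E) × C(Icc (-1 : ℝ) 1, E)) ≃L[ℝ] ((ℝ × E) × C(Icc (-1 : ℝ) 1, E)),
      HasFDerivAt (integralEquation ⟨f, hf.continuous⟩)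
        (e : ((ℝ × E) × C(Icc (-1 : ℝ) 1, E)) →L[ℝ] ((ℝ × E) × C(Icc (-1 : ℝ) 1, E)))
        ((0, x₀), ContinuousMap.const _ x₀) := by
  set g₀ : C(Icc (-1 : ℝ) 1, E) := ContinuousMap.const _ x₀
  set N := fun γ : C(Icc (-1 : ℝ) 1, E) ↦ (⟨f, hf.continuous⟩ : C(E, E)).comp γ
  have hN : HasFDerivAt N (fderiv ℝ N g₀) g₀ :=
    ((contDiff_continuousMap_comp hf).differentiable (by simp) g₀).hasFDerivAt
  have h1 : HasFDerivAt (fun p : (ℝ × E) × C(Icc (-1 : ℝ) 1, E) ↦ primitiveL (N p.2))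
      (primitiveL ∘L fderiv ℝ N g₀ ∘L ContinuousLinearMap.snd ℝ _ _) (((0 : ℝ), x₀), g₀) :=
    (primitiveL (E := E)).hasFDerivAt.comp ((0, x₀), g₀)
      (HasFDerivAt.comp (g := N) (𝕜 := ℝ) ((0, x₀), g₀) hN hasFDerivAt_snd)
  have h2 : HasFDerivAt (fun p : (ℝ × E) × C(Icc (-1 : ℝ) 1, E) ↦ p.1.1)
      (ContinuousLinearMap.fst ℝ ℝ E ∘L ContinuousLinearMap.fst ℝ _ _) (((0 : ℝ), x₀), g₀) :=
    hasFDerivAt_fst.comp (((0 : ℝ), x₀), g₀) hasFDerivAt_fst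
  have h3 : HasFDerivAt (fun p : (ℝ × E) × C(Icc (-1 : ℝ) 1, E) ↦
      ContinuousLinearMap.const (R := ℝ) (Icc (-1 : ℝ) 1) p.1.2)
      (ContinuousLinearMap.const (R := ℝ) (Icc (-1 : ℝ) 1) ∘L ContinuousLinearMap.snd ℝ ℝ E ∘L
        ContinuousLinearMap.fst ℝ _ _) (((0 : ℝ), x₀), g₀) :=
    (ContinuousLinearMap.const (R := ℝ) (M := E) (Icc (-1 : ℝ) 1)).hasFDerivAt.comp
      (((0 : ℝ), x₀), g₀) (hasFDerivAt_snd.comp (((0 : ℝ), x₀), g₀) hasFDerivAt_fst)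
  have h := (hasFDerivAt_fst (𝕜 := ℝ) (p := ((0, x₀), g₀))).prodMk
    (((hasFDerivAt_snd (𝕜 := ℝ) (p := ((0, x₀), g₀))).sub h3).sub (h2.smul h1))
  refine ⟨(ContinuousLinearEquiv.refl ℝ (ℝ × E)).skewProd (ContinuousLinearEquiv.refl ℝ _)
    (-(ContinuousLinearMap.const (R := ℝ) (Icc (-1 : ℝ) 1) ∘L ContinuousLinearMap.snd ℝ ℝ E)
      - (ContinuousLinearMap.fst ℝ ℝ E).smulRight (primitiveL (N g₀))), h.congr_fderiv ?_⟩
  ext p <;> simp [ContinuousLinearEquiv.skewProd_apply, sub_eq_add_neg]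

theorem isInvertible_nhds_fderiv {F : Type*} [NormedAddCommGroup F] [NormedSpace ℝ F]
    [CompleteSpace F] {H : F → F} (hH : ContDiff ℝ 1 H) {u : F} (e : F ≃L[ℝ] F)
    (he : HasFDerivAt H (e : F →L[ℝ] F) u) :
    ∀ᶠ a in 𝓝 u, ∃ e' : F ≃L[ℝ] F, HasFDerivAt H (e' : F →L[ℝ] F) a := by
  have hc : ContinuousAt (fderiv ℝ H) u := (hH.continuous_fderiv one_ne_zero).continuousAt
  have := hc.eventually (by rw [he.fderiv]; exact ContinuousLinearEquiv.nhds e)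
  filter_upwards [this] with a ha
  obtain ⟨e', he'⟩ := ha
  exact ⟨e', by rw [he']; exact (hH.differentiable one_ne_zero a).hasFDerivAt⟩

/-- A smooth family of solutions of the integral equation, unique near the constant curve. -/
theorem exists_contDiffOn_integralEquation [CompleteSpace E] {f : E → E} (hf : ContDiff ℝ ∞ f)
    (x₀ : E) : ∃ W : Set (ℝ × E), IsOpen W ∧ (0, x₀) ∈ W ∧
      ∃ ψ : ℝ × E → C(Icc (-1 : ℝ) 1, E), ContDiffOn ℝ ∞ ψ W ∧
        ψ (0, x₀) = ContinuousMap.const _ x₀ ∧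
        (∀ p ∈ W, integralEquation ⟨f, hf.continuous⟩ (p, ψ p) = (p, 0)) ∧
        ∀ᶠ q in 𝓝 ((0, x₀), ContinuousMap.const _ x₀),
          integralEquation ⟨f, hf.continuous⟩ q = (q.1, 0) → q.2 = ψ q.1 := by
  obtain ⟨e, he⟩ := exists_equiv_hasFDerivAt_integralEquation hf x₀
  set H := integralEquation ⟨f, hf.continuous⟩
  set u : (ℝ × E) × C(Icc (-1 : ℝ) 1, E) := ((0, x₀), ContinuousMap.const _ x₀)
  have hH : ContDiff ℝ ∞ H := contDiff_integralEquation hf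
  have hH1 : ContDiff ℝ 1 H := hH.of_le (by exact_mod_cast le_top)
  have hu : H u = ((0, x₀), 0) := by
    simp only [H, u, integralEquation, Prod.mk.injEq, true_and]
    ext r; simp
  set h := hH.contDiffAt.toOpenPartialHomeomorph H he (by simp)
  have hcoe : ∀ a, h a = H a := fun a ↦ rfl
  have hsrc : u ∈ h.source := ContDiffAt.mem_toOpenPartialHomeomorph_source _ he (by simp)
  have htgt : ((0, x₀), 0) ∈ h.target := by
    rw [← hu, ← hcoe]; exact h.map_source hsrc
  have hsymm : h.symm ((0, x₀), 0) = u := by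
    rw [← hu, ← hcoe]; exact h.left_inv hsrc
  have hct : ContinuousAt h.symm ((0, x₀), 0) := h.continuousAt_symm htgt
  -- The local inverse is smooth wherever the derivative of `H` is invertible. Invertibility is an
  -- open condition, so this covers a neighbourhood and not just the base point.
  have hT : ∀ᶠ b in 𝓝 ((0, x₀), (0 : C(Icc (-1 : ℝ) 1, E))), b ∈ h.target ∧
      ∃ e' : ((ℝ × E) × C(Icc (-1 : ℝ) 1, E)) ≃L[ℝ] ((ℝ × E) × C(Icc (-1 : ℝ) 1, E)),
        HasFDerivAt H (e' : ((ℝ × E) × C(Icc (-1 : ℝ) 1, E)) →L[ℝ]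
          ((ℝ × E) × C(Icc (-1 : ℝ) 1, E))) (h.symm b) :=
    Filter.Eventually.and (h.open_target.mem_nhds htgt)
      (hct.eventually (by rw [hsymm]; exact isInvertible_nhds_fderiv hH1 e he))
  have hcont : ContinuousAt (fun p : ℝ × E ↦ (p, (0 : C(Icc (-1 : ℝ) 1, E)))) (0, x₀) := by fun_prop
  obtain ⟨W, hW, hWo, hW0⟩ := eventually_nhds_iff.1 (hcont.eventually hT)
  refine ⟨W, hWo, hW0, fun p ↦ (h.symm (p, 0)).2, ?_, ?_, ?_, ?_⟩
  · intro p hp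
    obtain ⟨hp1, e', he'⟩ := hW p hp
    have : ContDiffAt ℝ ∞ h.symm (p, 0) := h.contDiffAt_symm hp1 he' hH.contDiffAt
    exact (contDiffAt_snd.comp p (this.comp p (contDiffAt_id.prodMk contDiffAt_const)))
      |>.contDiffWithinAt
  · simp only [hsymm]; rfl
  · intro p hp
    have h1 : H (h.symm (p, 0)) = (p, 0) := h.right_inv (hW p hp).1
    have h2 : (h.symm (p, 0)).1 = p := congrArg Prod.fst h1
    rw [show (p, (h.symm (p, 0)).2) = h.symm (p, 0) from Prod.ext h2.symm rfl]
    exact h1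
  · filter_upwards [h.open_source.mem_nhds hsrc] with q hq hHq
    have : h.symm (H q) = q := h.left_inv hq
    rw [hHq] at this
    simp only [this]

/-- The local flow of a smooth vector field on a Banach space is smooth. -/
theorem exists_smooth_localFlow [CompleteSpace E] {f : E → E} (hf : ContDiff ℝ ∞ f) (x₀ : E) :
    ∃ ε > 0, ∃ Φ : ℝ → E → E,
      ContDiffOn ℝ ∞ (fun p : ℝ × E ↦ Φ p.1 p.2) (Ioo (-ε) ε ×ˢ Metric.ball x₀ ε) ∧
      ∀ x ∈ Metric.ball x₀ ε, Φ 0 x = x ∧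
        ∀ t ∈ Ioo (-ε) ε, HasDerivAt (fun t ↦ Φ t x) (f (Φ t x)) t := by
  obtain ⟨W, hWo, hW0, ψ, hψ, hψ0, hψW, huniq⟩ := exists_contDiffOn_integralEquation hf x₀
  have hle : (-1 : ℝ) ≤ 1 := neg_le_self zero_le_one
  have heq : ∀ p ∈ W, ∀ r : Icc (-1 : ℝ) 1, ψ p r = p.2 + p.1 •
      ∫ s in (0 : ℝ)..r, f (ψ p (projIcc (-1) 1 hle s)) := by
    intro p hp r
    have := congrArg (fun q ↦ q.2 r) (hψW p hp)
    simp only [integralEquation, ContinuousMap.sub_apply, ContinuousMap.smul_apply,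
      primitiveL_apply, ContinuousMap.zero_apply, ContinuousMap.comp_apply,
      ContinuousMap.coe_mk] at this
    rw [sub_sub, sub_eq_zero] at this
    exact this
  have hcψ : ContinuousAt ψ (0, x₀) := hψ.continuousOn.continuousAt (hWo.mem_nhds hW0)
  obtain ⟨δ, hδ, hδu⟩ := Metric.eventually_nhds_iff_ball.1 huniq
  obtain ⟨ε₁, hε₁, H₁⟩ := Metric.eventually_nhds_iff_ball.1
    ((hcψ.eventually (Metric.ball_mem_nhds _ hδ)).and (hWo.mem_nhds hW0))
  set ε := min ε₁ δ / 2 with hε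
  have hmin : 0 < min ε₁ δ := lt_min hε₁ hδ
  have hεpos : 0 < ε := by positivity
  have hε1 : ε < ε₁ := by have := min_le_left ε₁ δ; linarith
  have hε2 : ε < δ := by have := min_le_right ε₁ δ; linarith
  have hball : ∀ t x, |t| ≤ ε → x ∈ Metric.ball x₀ ε → ((t, x) : ℝ × E) ∈ Metric.ball (0, x₀) ε₁ ∧
      ((t, x) : ℝ × E) ∈ Metric.ball (0, x₀) δ := by
    intro t x ht hx
    rw [Metric.mem_ball] at hx
    simp only [Metric.mem_ball, Prod.dist_eq, dist_zero_right, Real.norm_eq_abs, max_lt_iff]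
    exact ⟨⟨by linarith, by linarith⟩, by linarith, by linarith⟩
  have hmem : ∀ t x, |t| ≤ ε → x ∈ Metric.ball x₀ ε → (t, x) ∈ W := fun t x ht hx ↦
    (H₁ _ (hball t x ht hx).1).2
  -- the curve of the largest time, reparametrised, solves the equation for smaller times
  have hscale : ∀ x ∈ Metric.ball x₀ ε, ∀ t, |t| ≤ ε → ∀ hr : t / ε ∈ Icc (-1 : ℝ) 1,
      ψ (ε, x) ⟨t / ε, hr⟩ = ψ (t, x) ⟨1, by simp⟩ := by
    intro x hx t ht hr
    have hmemI : ∀ r : Icc (-1 : ℝ) 1, t / ε * r ∈ Icc (-1 : ℝ) 1 := fun r ↦ by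
      rw [mem_Icc, ← abs_le, abs_mul]
      exact mul_le_one₀ (abs_le.2 hr) (abs_nonneg _) (abs_le.2 r.2)
    set γ : C(Icc (-1 : ℝ) 1, E) := (ψ (ε, x)).comp
      ⟨fun r ↦ ⟨t / ε * r, hmemI r⟩, by fun_prop⟩ with hγ
    have hpε := hmem ε x (abs_of_pos hεpos).le hx
    have h1 : ((t, x), γ) ∈ Metric.ball (((0 : ℝ), x₀), ContinuousMap.const _ x₀) δ := by
      rw [Metric.mem_ball, Prod.dist_eq, max_lt_iff]
      refine ⟨(hball t x ht hx).2, ?_⟩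
      have h2 : dist (ψ (ε, x)) (ψ (0, x₀)) < δ :=
        (H₁ _ (hball ε x (abs_of_pos hεpos).le hx).1).1
      rw [hψ0, ContinuousMap.dist_lt_iff hδ] at h2
      refine (ContinuousMap.dist_lt_iff hδ).2 ?_
      exact fun r ↦ h2 _
    -- The rescaled curve `γ` solves the equation with parameter `t`, by the substitution `s ↦ (t /
    -- ε) s`. Its values are among those of `ψ (ε, x)`, so it is as close to the constant curve, and
    -- local uniqueness identifies it with `ψ (t, x)`.
    have h3 := hδu _ h1 (by
      simp only [integralEquation, Prod.mk.injEq, true_and]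
      ext r
      simp only [ContinuousMap.sub_apply, ContinuousMap.smul_apply, primitiveL_apply,
        ContinuousMap.zero_apply, ContinuousMap.comp_apply, ContinuousMap.coe_mk, hγ]
      rw [sub_sub, sub_eq_zero, heq _ hpε]
      congr 1
      have h4 := intervalIntegral.smul_integral_comp_mul_left (a := 0) (b := (r : ℝ))
        (fun s ↦ f (ψ (ε, x) (projIcc (-1) 1 hle s))) (t / ε)
      rw [mul_zero] at h4
      simp only
      rw [← h4, smul_smul, mul_div_cancel₀ _ hεpos.ne']
      congr 1
      refine intervalIntegral.integral_congr fun s hs ↦ ?_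
      have hs' : s ∈ Icc (-1 : ℝ) 1 := by
        have : uIcc (0 : ℝ) r ⊆ Icc (-1) 1 := uIcc_subset_Icc (by simp) r.2
        exact this hs
      rw [projIcc_of_mem hle hs', projIcc_of_mem hle (hmemI ⟨s, hs'⟩)])
    have h5 := congrArg (fun g : C(Icc (-1 : ℝ) 1, E) ↦ g ⟨1, by simp⟩) h3
    simpa [hγ] using h5
  have hproj : ∀ t, |t| ≤ ε → t / ε ∈ Icc (-1 : ℝ) 1 := fun t ht ↦ by
    rw [mem_Icc, ← abs_le, abs_div, abs_of_pos hεpos]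
    exact div_le_one_of_le₀ ht hεpos.le
  -- The flow has two descriptions, identified by `hscale`. As `ψ (ε, x)` at `t / ε` it is one fixed
  -- curve, differentiated in `t` by the fundamental theorem of calculus; as `ψ (t, x)` at `1` it is
  -- visibly smooth in `(t, x)` jointly.
  refine ⟨ε, hεpos, fun t x ↦ ψ (ε, x) (projIcc (-1) 1 hle (t / ε)), ?_, fun x hx ↦ ⟨?_, ?_⟩⟩
  · have h1 : ContDiffOn ℝ ∞ (fun p : ℝ × E ↦ ψ p ⟨1, by simp⟩)
        (Ioo (-ε) ε ×ˢ Metric.ball x₀ ε) :=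
      ContDiffOn.mono (ContDiffOn.continuousLinearMap_comp (f := ψ)
        (ContinuousMap.evalCLM ℝ (M := E) (⟨1, by simp⟩ : Icc (-1 : ℝ) 1)) hψ)
        fun p hp ↦ hmem _ _ (abs_lt.2 hp.1).le hp.2
    refine h1.congr fun p hp ↦ ?_
    have h2 := (abs_lt.2 hp.1).le
    beta_reduce
    rw [projIcc_of_mem hle (hproj _ h2)]
    exact hscale _ hp.2 _ h2 _
  · simp only [zero_div]
    rw [heq _ (hmem ε x (abs_of_pos hεpos).le hx), projIcc_of_mem hle (x := (0 : ℝ)) (by simp)]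
    simp
  · intro t ht
    have hpε := hmem ε x (abs_of_pos hεpos).le hx
    set k : ℝ → E := fun s ↦ f (ψ (ε, x) (projIcc (-1) 1 hle s))
    have hk : Continuous k := by fun_prop
    have h1 : HasDerivAt (fun t ↦ x + ε • ∫ s in (0 : ℝ)..t / ε, k s) (k (t / ε)) t := by
      have h2 := (intervalIntegral.integral_hasDerivAt_right (hk.intervalIntegrable 0 (t / ε))
        (hk.stronglyMeasurableAtFilter _ _) hk.continuousAt).scomp t ((hasDerivAt_id t).div_const ε)
      have h3 := (h2.const_smul ε).const_add x
      refine h3.congr_deriv ?_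
      rw [smul_smul, mul_one_div_cancel hεpos.ne', one_smul]
    refine h1.congr_of_eventuallyEq ?_
    filter_upwards [Ioo_mem_nhds ht.1 ht.2] with s hs
    have h4 := hproj s (abs_lt.2 hs).le
    rw [heq _ hpε, projIcc_of_mem hle h4]

end LocalFlow

/-! ### Smooth flows of vector fields on manifolds -/

section ManifoldFlow

open Filter Topology

variable {E : Type u} [NormedAddCommGroup E] [NormedSpace ℝ E]
  {H : Type*} [TopologicalSpace H] {I : ModelWithCorners ℝ E H} [I.Boundaryless]
  {M : Type*} [TopologicalSpace M] [ChartedSpace H M] [IsManifold I ∞ M]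
  {V : (x : M) → TangentSpace I x}

/-- The coordinate expression of a vector field in the preferred chart around `x₀`. -/
def vectorFieldInChart (V : (x : M) → TangentSpace I x) (x₀ : M) (y : E) : E :=
  mfderiv I 𝓘(ℝ, E) (extChartAt I x₀) ((extChartAt I x₀).symm y) (V ((extChartAt I x₀).symm y))

omit [I.Boundaryless] in
theorem trivializationAt_tangentSpace_snd {x₀ x : M} (hx : x ∈ (chartAt H x₀).source)
    (v : TangentSpace I x) :
    (trivializationAt E (TangentSpace I : M → Type _) x₀ ⟨x, v⟩).2 =
      mfderiv I 𝓘(ℝ, E) (extChartAt I x₀) x v := by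
  have : IsManifold I 1 M := IsManifold.of_le (n := ∞) (by exact_mod_cast le_top)
  have h1 := TangentBundle.continuousLinearMapAt_trivializationAt (𝕜 := ℝ) (I := I) hx
  have h2 : (trivializationAt E (TangentSpace I : M → Type _) x₀).continuousLinearMapAt ℝ x v =
      (trivializationAt E (TangentSpace I : M → Type _) x₀ ⟨x, v⟩).2 := by
    have h3 := congrFun ((trivializationAt E (TangentSpace I : M → Type _)
      x₀).coe_linearMapAt_of_mem (R := ℝ) (b := x) (by simpa using hx)) v
    exact h3
  exact h2.symm.trans (DFunLike.congr_fun h1 v)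

omit [I.Boundaryless] in
theorem contDiffOn_vectorField_extChartAt
    (hV : ContMDiff I I.tangent ∞ (fun x ↦ (⟨x, V x⟩ : TangentBundle I M))) (x₀ : M) :
    ContDiffOn ℝ ∞ (vectorFieldInChart V x₀) (extChartAt I x₀).target := by
  refine contMDiffOn_iff_contDiffOn.1 ?_
  set e := trivializationAt E (TangentSpace I : M → Type _) x₀
  have h1 := (e.contMDiffOn_section_baseSet_iff (IB := I) (n := ∞) (s := V)).1 hV.contMDiffOn
  have h2 := h1.comp (contMDiffOn_extChartAt_symm (I := I) (n := ∞) x₀) (fun y hy ↦ by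
    have := (extChartAt I x₀).map_target hy
    simpa [e] using this)
  refine h2.congr fun y hy ↦ ?_
  have h3 := (extChartAt I x₀).map_target hy
  rw [extChartAt_source] at h3
  exact (trivializationAt_tangentSpace_snd h3 _).symm

/-- In a chart, a bump function turns the coordinate expression of `V` into a smooth field on all of
`E`, to which the Banach space result applies. For small times the curves stay in the ball where the
bump function is `1`, so there they are integral curves of `V` itself. -/
theorem exists_smooth_localFlow_manifold [FiniteDimensional ℝ E]
    (hV : ContMDiff I I.tangent ∞ (fun x ↦ (⟨x, V x⟩ : TangentBundle I M))) (x₀ : M) :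
    ∃ ε > 0, ∃ U ∈ 𝓝 x₀, ∃ Φ : ℝ → M → M,
      ContMDiffOn (𝓘(ℝ, ℝ).prod I) I ∞ (fun p : ℝ × M ↦ Φ p.1 p.2) (Ioo (-ε) ε ×ˢ U) ∧
      ∀ x ∈ U, Φ 0 x = x ∧ IsMIntegralCurveOn (fun t ↦ Φ t x) V (Ioo (-ε) ε) := by
  have : CompleteSpace E := FiniteDimensional.complete ℝ E
  set e := extChartAt I x₀
  set y₀ := e x₀
  have hy₀ : y₀ ∈ e.target := mem_extChartAt_target x₀
  have hopen : IsOpen e.target := isOpen_extChartAt_target x₀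
  set u : E → E := vectorFieldInChart V x₀ with hudef
  have hu : ContDiffOn ℝ ∞ u e.target := contDiffOn_vectorField_extChartAt hV x₀
  obtain ⟨R, hR, hRt⟩ := Metric.isOpen_iff.1 hopen y₀ hy₀
  let χ : ContDiffBump y₀ := ⟨R / 3, R / 2, by positivity, by linarith⟩
  have hf : ContDiff ℝ ∞ (fun y ↦ χ y • u y) := by
    rw [contDiff_iff_contDiffAt]
    intro y
    by_cases hy : y ∈ Metric.ball y₀ R
    · exact χ.contDiffAt.smul ((hu.mono hRt).contDiffAt (Metric.isOpen_ball.mem_nhds hy))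
    · have : (fun y ↦ χ y • u y) =ᶠ[𝓝 y] fun _ ↦ 0 := by
        have : (tsupport χ)ᶜ ∈ 𝓝 y := by
          refine (isClosed_tsupport χ).isOpen_compl.mem_nhds fun h ↦ hy ?_
          rw [χ.tsupport_eq] at h
          exact Metric.closedBall_subset_ball (by simp only [χ]; linarith) h
        filter_upwards [this] with z hz
        rw [image_eq_zero_of_notMem_tsupport hz, zero_smul]
      exact contDiffAt_const.congr_of_eventuallyEq this
  obtain ⟨ε, hε, Φ, hΦ, hΦ'⟩ := exists_smooth_localFlow hf y₀
  have hc : ContinuousAt (fun p : ℝ × E ↦ Φ p.1 p.2) (0, y₀) :=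
    hΦ.continuousOn.continuousAt ((isOpen_Ioo.prod Metric.isOpen_ball).mem_nhds
      ⟨⟨by simpa using hε, hε⟩, Metric.mem_ball_self hε⟩)
  have hev : ∀ᶠ p in 𝓝 ((0 : ℝ), y₀), Φ p.1 p.2 ∈ Metric.ball y₀ (R / 3) :=
    hc.eventually (Metric.isOpen_ball.mem_nhds (by
      simp only [(hΦ' y₀ (Metric.mem_ball_self hε)).1]; exact Metric.mem_ball_self (by positivity)))
  obtain ⟨δ, hδ, hδ'⟩ := Metric.eventually_nhds_iff_ball.1 hev
  set r := min ε δ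
  have hr : 0 < r := lt_min hε hδ
  have hin : ∀ t ∈ Ioo (-r) r, ∀ y ∈ Metric.ball y₀ r, Φ t y ∈ Metric.ball y₀ (R / 3) := by
    intro t ht y hy
    refine hδ' (t, y) ?_
    rw [← ball_prod_same]
    refine ⟨?_, Metric.ball_subset_ball (min_le_right _ _) hy⟩
    rw [Real.ball_eq_Ioo]
    have := min_le_right ε δ
    exact ⟨by linarith [ht.1], by linarith [ht.2]⟩
  have hIoo : Ioo (-r) r ⊆ Ioo (-ε) ε :=
    Ioo_subset_Ioo (neg_le_neg (min_le_left _ _)) (min_le_left _ _)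
  have hball : Metric.ball y₀ r ⊆ Metric.ball y₀ ε := Metric.ball_subset_ball (min_le_left _ _)
  have hball3 : Metric.ball y₀ (R / 3) ⊆ e.target :=
    (Metric.ball_subset_ball (by linarith)).trans hRt
  refine ⟨r, hr, e.source ∩ e ⁻¹' Metric.ball y₀ r, ?_, fun t x ↦ e.symm (Φ t (e x)), ?_, ?_⟩
  · exact Filter.inter_mem (extChartAt_source_mem_nhds x₀)
      ((continuousAt_extChartAt x₀).preimage_mem_nhds (Metric.ball_mem_nhds _ hr))
  · have h1 : ContMDiffOn (𝓘(ℝ, ℝ).prod I) 𝓘(ℝ, ℝ × E) ∞ (fun p : ℝ × M ↦ (p.1, e p.2))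
        (Ioo (-r) r ×ˢ (e.source ∩ e ⁻¹' Metric.ball y₀ r)) := by
      refine contMDiffOn_fst.prodMk_space ?_
      exact (contMDiffOn_extChartAt (n := ∞) (I := I) (x := x₀)).comp contMDiffOn_snd
        fun p hp ↦ by simpa [e] using hp.2.1
    have h2 := (hΦ.mono (prod_mono hIoo hball)).contMDiffOn.comp h1
      fun p hp ↦ ⟨hp.1, hp.2.2⟩
    exact (contMDiffOn_extChartAt_symm (n := ∞) x₀).comp h2
      fun p hp ↦ hball3 (hin _ hp.1 _ hp.2.2)
  · rintro x ⟨hx, hxr⟩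
    refine ⟨by simp only [(hΦ' _ (hball hxr)).1, e.left_inv hx], fun t ht ↦ ?_⟩
    have hmem := hin t ht _ hxr
    have htgt := hball3 hmem
    have h1 := (hΦ' _ (hball hxr)).2 t (hIoo ht)
    rw [χ.one_of_mem_closedBall (Metric.ball_subset_closedBall hmem), one_smul] at h1
    have h2 : HasMFDerivAt 𝓘(ℝ, E) I e.symm (Φ t (e x))
        (mfderiv 𝓘(ℝ, E) I e.symm (Φ t (e x))) :=
      ((mdifferentiableOn_extChartAt_symm (I := I) _ htgt).mdifferentiableAt
        (hopen.mem_nhds htgt)).hasMFDerivAt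
    refine HasMFDerivAt.hasMFDerivWithinAt ?_
    refine (h2.comp t h1.hasFDerivAt.hasMFDerivAt).congr_mfderiv ?_
    refine ContinuousLinearMap.ext_ring ?_
    have h3 := mfderivWithin_extChartAt_symm_comp_mfderiv_extChartAt (I := I) htgt
    rw [I.range_eq_univ, mfderivWithin_univ] at h3
    have h4 := DFunLike.congr_fun h3 (V (e.symm (Φ t (e x))))
    exact (congrArg (mfderiv 𝓘(ℝ, E) I e.symm (Φ t (e x))) (one_smul ℝ (u (Φ t (e x))))).trans
      (h4.trans (one_smul ℝ (V (e.symm (Φ t (e x))))).symm)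

/-- If the local flows are smooth and defined for a uniform time, they fit together into a smooth
global flow. -/
theorem exists_smooth_flow_of_uniform_localFlow [T2Space M]
    (hV : ContMDiff I I.tangent ∞ (fun x ↦ (⟨x, V x⟩ : TangentBundle I M))) {ε : ℝ} (hε : 0 < ε)
    (h : ∀ x₀ : M, ∃ U ∈ 𝓝 x₀, ∃ Φ : ℝ → M → M,
      ContMDiffOn (𝓘(ℝ, ℝ).prod I) I ∞ (fun p : ℝ × M ↦ Φ p.1 p.2) (Ioo (-ε) ε ×ˢ U) ∧
      ∀ x ∈ U, Φ 0 x = x ∧ IsMIntegralCurveOn (fun t ↦ Φ t x) V (Ioo (-ε) ε)) :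
    ∃ φ : ℝ → M → M, ContMDiff (𝓘(ℝ, ℝ).prod I) I ∞ (fun p : ℝ × M ↦ φ p.1 p.2) ∧
      ∀ x, φ 0 x = x ∧ IsMIntegralCurve (fun t ↦ φ t x) V := by
  have : IsManifold I 1 M := IsManifold.of_le (n := ∞) (by exact_mod_cast le_top)
  have hV1 : ContMDiff I I.tangent 1 (fun x ↦ (⟨x, V x⟩ : TangentBundle I M)) :=
    hV.of_le (by exact_mod_cast le_top)
  have hex : ∀ x, ∃ γ : ℝ → M, γ 0 = x ∧ IsMIntegralCurve γ V := by
    refine exists_isMIntegralCurve_of_isMIntegralCurveOn hV1 hε fun x ↦ ?_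
    obtain ⟨U, hU, Φ, -, hΦ⟩ := h x
    exact ⟨fun t ↦ Φ t x, hΦ x (mem_of_mem_nhds hU)⟩
  choose γ hγ0 hγ using hex
  have hadd : ∀ s t x, γ x (s + t) = γ (γ x s) t := by
    intro s t x
    have h1 : IsMIntegralCurve (fun t ↦ γ x (t + s)) V := (hγ x).comp_add s
    have h2 := isMIntegralCurve_Ioo_eq_of_contMDiff_boundaryless (t₀ := 0) hV1 h1 (hγ (γ x s))
      (by simp [hγ0])
    rw [add_comm]
    exact congrFun h2 t
  have hloc : ContMDiffOn (𝓘(ℝ, ℝ).prod I) I ∞ (fun p : ℝ × M ↦ γ p.2 p.1)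
      (Ioo (-ε) ε ×ˢ univ) := by
    rintro ⟨t, x⟩ ⟨ht, -⟩
    obtain ⟨U, hU, Φ, hΦs, hΦ⟩ := h x
    have hnhds : Ioo (-ε) ε ×ˢ U ∈ 𝓝 (t, x) := prod_mem_nhds (Ioo_mem_nhds ht.1 ht.2) hU
    refine ((hΦs.contMDiffAt hnhds).congr_of_eventuallyEq ?_).contMDiffWithinAt
    filter_upwards [hnhds] with p hp
    exact isMIntegralCurveOn_Ioo_eqOn_of_contMDiff_boundaryless (t₀ := 0) (by simpa using hε) hV1
      ((hγ p.2).isMIntegralCurveOn _) (hΦ p.2 hp.2).2 (by simp [hγ0, (hΦ p.2 hp.2).1]) hp.1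
  have hn : ∀ n : ℕ, ContMDiffOn (𝓘(ℝ, ℝ).prod I) I ∞ (fun p : ℝ × M ↦ γ p.2 p.1)
      (Ioo (-((n + 1) * ε)) ((n + 1) * ε) ×ˢ univ) := by
    intro n
    induction n with
    | zero => simpa using hloc
    | succ n ih =>
      have hn1 : (0 : ℝ) < n + 1 + 1 := by positivity
      -- A time `t` with `|t| < (n + 2) ε` is split as `(1 - c) t + c t`: the first part is shorter
      -- than `(n + 1) ε` and falls under the induction hypothesis, the second is shorter than `ε`.
      -- The split is linear in `t`, hence smooth.
      set c : ℝ := 1 / (n + 1 + 1)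
      have hc : 0 < c := by positivity
      have hcn : c * (n + 1 + 1) = 1 := by simp only [c]; field_simp
      push_cast
      have h1 : ContMDiffOn (𝓘(ℝ, ℝ).prod I) I ∞ (fun p : ℝ × M ↦ γ p.2 ((1 - c) * p.1))
          (Ioo (-((n + 1 + 1) * ε)) ((n + 1 + 1) * ε) ×ˢ univ) := by
        refine ih.comp (g := fun p : ℝ × M ↦ γ p.2 p.1) (f := fun p : ℝ × M ↦ ((1 - c) * p.1, p.2))
          ?_ ?_
        · exact ((contMDiff_const.mul contMDiff_fst).prodMk contMDiff_snd).contMDiffOn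
        · rintro p ⟨hp, -⟩
          have h2 : 1 - c = c * (n + 1) := by linear_combination (-1 : ℝ) * hcn
          rw [mem_Ioo, ← abs_lt] at hp
          refine ⟨?_, mem_univ _⟩
          rw [mem_Ioo, ← abs_lt, h2, abs_mul, abs_of_pos (by positivity)]
          calc c * (n + 1) * |p.1| < c * (n + 1) * ((n + 1 + 1) * ε) := by gcongr
            _ = (n + 1) * ε := by linear_combination (n + 1) * ε * hcn
      have h2 := hloc.comp (g := fun p : ℝ × M ↦ γ p.2 p.1)
        (f := fun p : ℝ × M ↦ (c * p.1, γ p.2 ((1 - c) * p.1)))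
        (s := Ioo (-((n + 1 + 1) * ε)) ((n + 1 + 1) * ε) ×ˢ univ)
        ((contMDiff_const.mul contMDiff_fst).contMDiffOn.prodMk h1) (by
          rintro p ⟨hp, -⟩
          rw [mem_Ioo, ← abs_lt] at hp
          refine ⟨?_, mem_univ _⟩
          rw [mem_Ioo, ← abs_lt, abs_mul, abs_of_pos hc]
          calc c * |p.1| < c * ((n + 1 + 1) * ε) := by gcongr
            _ = ε := by linear_combination ε * hcn)
      refine h2.congr fun p _ ↦ ?_
      simp only [Function.comp_apply]
      rw [← hadd]
      ring_nf
  refine ⟨fun t x ↦ γ x t, fun p ↦ ?_, fun x ↦ ⟨hγ0 x, hγ x⟩⟩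
  obtain ⟨n, hn'⟩ := exists_nat_gt (|p.1| / ε)
  refine (hn n).contMDiffAt (prod_mem_nhds ?_ univ_mem)
  have : |p.1| < (n + 1) * ε := by
    rw [div_lt_iff₀ hε] at hn'
    nlinarith
  exact Ioo_mem_nhds (abs_lt.1 this).1 (abs_lt.1 this).2

/-- A smooth vector field with compact support has a smooth global flow. -/
theorem exists_smooth_flow_of_compact_support [FiniteDimensional ℝ E] [T2Space M]
    (hV : ContMDiff I I.tangent ∞ (fun x ↦ (⟨x, V x⟩ : TangentBundle I M)))
    {K : Set M} (hK : IsCompact K) (hVK : ∀ x ∉ K, V x = 0) :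
    ∃ φ : ℝ → M → M, ContMDiff (𝓘(ℝ, ℝ).prod I) I ∞ (fun p : ℝ × M ↦ φ p.1 p.2) ∧
      ∀ x, φ 0 x = x ∧ IsMIntegralCurve (fun t ↦ φ t x) V := by
  have hloc := exists_smooth_localFlow_manifold hV
  choose ε hε U hU Φ hΦ hΦ' using hloc
  obtain ⟨T, -, hT⟩ := hK.elim_nhds_subcover (fun x ↦ interior (U x))
    fun x _ ↦ interior_mem_nhds.2 (hU x)
  obtain ⟨δ, hδ, hδT⟩ : ∃ δ > 0, ∀ x ∈ T, δ ≤ ε x := by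
    classical
    clear hT
    induction T using Finset.induction_on with
    | empty => exact ⟨1, one_pos, by simp⟩
    | insert a T _ ih =>
      obtain ⟨δ, hδ, h⟩ := ih
      refine ⟨min δ (ε a), lt_min hδ (hε a), fun x hx ↦ ?_⟩
      rcases Finset.mem_insert.1 hx with rfl | hx
      · exact min_le_right _ _
      · exact (min_le_left _ _).trans (h x hx)
  refine exists_smooth_flow_of_uniform_localFlow hV hδ fun x ↦ ?_
  by_cases hx : x ∈ K
  · obtain ⟨a, ha, hxa⟩ := mem_iUnion₂.1 (hT hx)
    have hIoo : Ioo (-δ) δ ⊆ Ioo (-(ε a)) (ε a) :=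
      Ioo_subset_Ioo (neg_le_neg (hδT a ha)) (hδT a ha)
    exact ⟨U a, mem_interior_iff_mem_nhds.1 hxa, Φ a,
      (hΦ a).mono (prod_mono hIoo subset_rfl), fun y hy ↦
      ⟨(hΦ' a y hy).1, ((hΦ' a y hy).2).mono hIoo⟩⟩
  -- On the open complement of `K` the field vanishes and the points are at rest.
  · exact ⟨Kᶜ, hK.isClosed.isOpen_compl.mem_nhds hx, fun _ y ↦ y, contMDiffOn_snd,
      fun y hy ↦ ⟨rfl, (isMIntegralCurve_const (hVK y hy)).isMIntegralCurveOn _⟩⟩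

end ManifoldFlow

/-! ### Even functions as smooth functions of the square -/

section EvenFunctions

open Filter Topology

variable {E F : Type u} [NormedAddCommGroup E] [NormedSpace ℝ E]
  [NormedAddCommGroup F] [NormedSpace ℝ F]

/-- The integral is a bounded linear functional of the curve `s ↦ f (s, y)`, and this curve is the
superposition operator of `f` applied to `s ↦ (s, y)`, which is affine in `y`. This avoids
differentiating under the integral sign. -/
theorem contDiff_parametric_integral [CompleteSpace F] {f : ℝ × E → F} (hf : ContDiff ℝ ∞ f) :
    ContDiff ℝ ∞ (fun y : E ↦ ∫ s in (0 : ℝ)..1, f (s, y)) := by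
  let A : C(Icc (-1 : ℝ) 1, ℝ × E) := ⟨fun s ↦ ((s : ℝ), 0), by fun_prop⟩
  have h1 : ContDiff ℝ ∞ (fun y : E ↦ A + ContinuousLinearMap.const (R := ℝ) (Icc (-1 : ℝ) 1)
      (ContinuousLinearMap.inr ℝ ℝ E y)) :=
    contDiff_const.add (ContDiff.continuousLinearMap_comp
      (ContinuousLinearMap.const (R := ℝ) (M := ℝ × E) (Icc (-1 : ℝ) 1))
      (ContinuousLinearMap.inr ℝ ℝ E).contDiff)
  have h2 := (contDiff_continuousMap_comp (K := Icc (-1 : ℝ) 1) hf).comp h1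
  have h3 := ContDiff.continuousLinearMap_comp (ContinuousMap.evalCLM ℝ (M := F)
    (⟨1, by simp⟩ : Icc (-1 : ℝ) 1)) (ContDiff.continuousLinearMap_comp (primitiveL (E := F)) h2)
  convert h3 using 1
  funext y
  simp only [Function.comp_apply, ContinuousMap.evalCLM_apply, primitiveL_apply]
  refine intervalIntegral.integral_congr fun s hs ↦ ?_
  have hs' : s ∈ Icc (-1 : ℝ) 1 := by
    rw [uIcc_of_le zero_le_one] at hs
    exact ⟨by linarith [hs.1], hs.2⟩
  simp [projIcc_of_mem _ hs', A]

/-- Hadamard's lemma. -/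
theorem exists_contDiff_eq_smul_of_apply_zero [CompleteSpace F] {g : ℝ × E → F}
    (hg : ContDiff ℝ ∞ g) (h0 : ∀ y, g (0, y) = 0) :
    ∃ h : ℝ × E → F, ContDiff ℝ ∞ h ∧ ∀ u y, g (u, y) = u • h (u, y) := by
  have hd : ContDiff ℝ ∞ (fun q : ℝ × ℝ × E ↦ fderiv ℝ g (q.1 * q.2.1, q.2.2) (1, 0)) := by
    have := hg.fderiv_right (m := ∞) (by simp)
    exact (this.comp (by fun_prop : ContDiff ℝ ∞
      (fun q : ℝ × ℝ × E ↦ (q.1 * q.2.1, q.2.2)))).clm_apply contDiff_const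
  refine ⟨fun p ↦ ∫ s in (0 : ℝ)..1, fderiv ℝ g (s * p.1, p.2) (1, 0),
    contDiff_parametric_integral hd, fun u y ↦ ?_⟩
  have hder : ∀ s ∈ uIcc (0 : ℝ) 1, HasDerivAt (fun s : ℝ ↦ g (s * u, y))
      (u • fderiv ℝ g (s * u, y) (1, 0)) s := by
    intro s _
    have h1 : HasDerivAt (fun s : ℝ ↦ (s * u, y)) (u, (0 : E)) s := by
      simpa using ((hasDerivAt_id s).mul_const u).prodMk (hasDerivAt_const s y)
    have h2 := ((hg.differentiable (by simp)) (s * u, y)).hasFDerivAt.comp_hasDerivAt s h1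
    refine h2.congr_deriv ?_
    rw [← map_smul]; simp
  have hcont : Continuous (fun s : ℝ ↦ u • fderiv ℝ g (s * u, y) (1, 0)) := by
    have := hd.continuous.comp (by fun_prop : Continuous fun s : ℝ ↦ (s, u, y))
    exact this.const_smul u
  have h3 := intervalIntegral.integral_eq_sub_of_hasDerivAt hder (hcont.intervalIntegrable 0 1)
  rw [intervalIntegral.integral_smul] at h3
  simp only [h3, one_mul, zero_mul, h0, sub_zero]

/-- The partial derivative `∂_u g` of an even function is odd, so by Hadamard's lemma it equals `u
h` with `h` smooth and even. The chain rule then gives `∂_t g(√t, y) = h(√t, y) / 2`: the singular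
factor `1 / (2√t)` has cancelled. The full derivative is thus again a smooth even function evaluated
at `(√t, y)`, and one induction step gains one order of differentiability. -/
theorem contDiffOn_comp_sqrt_nat [CompleteSpace E] (n : ℕ) :
    ∀ {F : Type u} [NormedAddCommGroup F] [NormedSpace ℝ F] [CompleteSpace F] {g : ℝ × E → F},
      ContDiff ℝ ∞ g → (∀ u y, g (-u, y) = g (u, y)) →
      ContDiffOn ℝ n (fun p : ℝ × E ↦ g (√p.1, p.2)) (Ici 0 ×ˢ univ) := by
  induction n with
  | zero =>
    intro F _ _ _ g hg _
    exact contDiffOn_zero.2 (hg.continuous.comp (by fun_prop)).continuousOn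
  | succ n ih =>
    intro F _ _ _ g hg heven
    have hdiff : Differentiable ℝ g := hg.differentiable (by simp)
    have hfd : ContDiff ℝ ∞ (fderiv ℝ g) := hg.fderiv_right (m := ∞) (by simp)
    have hodd : ∀ u y v, fderiv ℝ g (-u, y) v = fderiv ℝ g (u, y) (-v.1, v.2) := by
      intro u y v
      let L : ℝ × E →L[ℝ] ℝ × E := (-ContinuousLinearMap.fst ℝ ℝ E).prod
        (ContinuousLinearMap.snd ℝ ℝ E)
      have h1 : g ∘ L = g := funext fun p ↦ heven p.1 p.2
      have h2 := (hdiff (L (-u, y))).hasFDerivAt.comp (-u, y) L.hasFDerivAt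
      rw [h1] at h2
      have h3 := DFunLike.congr_fun h2.fderiv v
      simpa [L] using h3
    obtain ⟨h, hh, hgh⟩ := exists_contDiff_eq_smul_of_apply_zero (E := E)
      (g := fun p ↦ fderiv ℝ g p (1, 0)) (hfd.clm_apply contDiff_const) (fun y ↦ by
        have h1 := hodd 0 y (1, 0)
        have h2 : ((-1 : ℝ), (0 : E)) = -(1, 0) := by simp
        simp only [neg_zero, h2, map_neg] at h1
        have h3 : (2 : ℝ) • fderiv ℝ g (0, y) (1, 0) = 0 := by
          rw [two_smul]; nth_rewrite 1 [h1]; exact neg_add_cancel _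
        exact (smul_eq_zero.1 h3).resolve_left two_ne_zero)
    have hheven : ∀ u y, h (-u, y) = h (u, y) := by
      intro u y
      by_cases hu : u = 0
      · simp [hu]
      have h1 := hodd u y (1, 0)
      have h2 : ((-1 : ℝ), (0 : E)) = -(1, 0) := by simp
      simp only [h2, map_neg] at h1
      rw [hgh, hgh, neg_smul, neg_inj] at h1
      exact smul_right_injective F hu h1
    set D : ℝ × E → (ℝ × E →L[ℝ] F) := fun p ↦
      (ContinuousLinearMap.fst ℝ ℝ E).smulRight ((1 / 2 : ℝ) • h p) +
        (fderiv ℝ g p ∘L ContinuousLinearMap.inr ℝ ℝ E) ∘L ContinuousLinearMap.snd ℝ ℝ E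
    have hD : ContDiff ℝ ∞ D := by
      refine ContDiff.add ?_ ((hfd.clm_comp contDiff_const).clm_comp contDiff_const)
      exact (ContinuousLinearMap.smulRightL ℝ (ℝ × E) F
        (ContinuousLinearMap.fst ℝ ℝ E)).contDiff.comp (hh.const_smul _)
    have hDeven : ∀ u y, D (-u, y) = D (u, y) := by
      intro u y
      refine ContinuousLinearMap.ext fun v ↦ ?_
      simp only [D, hheven, add_apply, ContinuousLinearMap.comp_apply, hodd]
      simp
    have hpos : ∀ p : ℝ × E, 0 < p.1 →
        HasFDerivAt (fun p : ℝ × E ↦ g (√p.1, p.2)) (D (√p.1, p.2)) p := by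
      intro p hp
      have h1 : HasFDerivAt (fun p : ℝ × E ↦ (√p.1, p.2))
          (((1 / (2 * √p.1)) • ContinuousLinearMap.fst ℝ ℝ E).prod
            (ContinuousLinearMap.snd ℝ ℝ E)) p :=
        (hasFDerivAt_fst.sqrt hp.ne').prodMk hasFDerivAt_snd
      refine ((hdiff (√p.1, p.2)).hasFDerivAt.comp p h1).congr_fderiv ?_
      refine ContinuousLinearMap.ext fun v ↦ ?_
      have hs : √p.1 ≠ 0 := (Real.sqrt_pos.2 hp).ne'
      have h2 : ((1 / (2 * √p.1)) * v.1, v.2) =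
          ((1 / (2 * √p.1)) * v.1) • ((1 : ℝ), (0 : E)) + (0, v.2) := by simp
      simp only [ContinuousLinearMap.comp_apply, ContinuousLinearMap.prod_apply,
        smul_apply, ContinuousLinearMap.coe_fst', ContinuousLinearMap.coe_snd',
        smul_eq_mul, D, add_apply, ContinuousLinearMap.smulRight_apply,
        ContinuousLinearMap.inr_apply]
      rw [h2, map_add, map_smul, hgh, smul_smul, smul_smul]
      congr 2
      field_simp
    have hcl : closure (Ioi (0 : ℝ) ×ˢ (univ : Set E)) = Ici 0 ×ˢ univ := by
      rw [closure_prod_eq, closure_Ioi, closure_univ]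
    have hcD : Continuous (fun p : ℝ × E ↦ D (√p.1, p.2)) := hD.continuous.comp (by fun_prop)
    have hall : ∀ p ∈ (Ici (0 : ℝ) ×ˢ (univ : Set E)),
        HasFDerivWithinAt (fun p : ℝ × E ↦ g (√p.1, p.2)) (D (√p.1, p.2)) (Ici 0 ×ˢ univ) p := by
      intro p hp
      rw [← hcl]
      -- The chain rule is available only for `t > 0`. At `t = 0` the one-sided derivative is the
      -- limit of the interior derivatives, which exists because `D (√t, y)` is continuous.
      refine hasFDerivWithinAt_closure_of_tendsto_fderiv
        (fun q hq ↦ (hpos q hq.1).differentiableAt.differentiableWithinAt)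
        ((convex_Ioi 0).prod convex_univ) (isOpen_Ioi.prod isOpen_univ)
        (fun q _ ↦ (hg.continuous.comp (by fun_prop)).continuousWithinAt) ?_
      refine (hcD.continuousWithinAt (s := Ioi (0 : ℝ) ×ˢ (univ : Set E))).tendsto.congr' ?_
      filter_upwards [self_mem_nhdsWithin] with q hq
      exact (hpos q hq.1).fderiv.symm
    push_cast
    rw [contDiffOn_succ_iff_hasFDerivWithinAt_of_uniqueDiffOn
      ((uniqueDiffOn_Ici 0).prod uniqueDiffOn_univ)]
    exact ⟨by simp, _, ih hD hDeven, hall⟩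

/-- A smooth function that is even in its first variable is a smooth function of the square of that
variable. -/
theorem contDiffOn_comp_sqrt [CompleteSpace E] [CompleteSpace F] {g : ℝ × E → F}
    (hg : ContDiff ℝ ∞ g) (heven : ∀ u y, g (-u, y) = g (u, y)) :
    ContDiffOn ℝ ∞ (fun p : ℝ × E ↦ g (√p.1, p.2)) (Ici 0 ×ˢ univ) :=
  contDiffOn_infty.2 fun n ↦ contDiffOn_comp_sqrt_nat n hg heven

end EvenFunctions

/-! ### Folded time, and inverses of smooth families -/

section FoldedTime

open Filter Topology

variable {E E' : Type u} [NormedAddCommGroup E] [NormedSpace ℝ E] [FiniteDimensional ℝ E]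
  [NormedAddCommGroup E'] [NormedSpace ℝ E'] [CompleteSpace E']
  {H : Type*} [TopologicalSpace H] {I : ModelWithCorners ℝ E H} [I.Boundaryless]
  {M : Type*} [TopologicalSpace M] [ChartedSpace H M] [IsManifold I ∞ M]
  {H' : Type*} [TopologicalSpace H'] {I' : ModelWithCorners ℝ E' H'} [I'.Boundaryless]
  {M' : Type*} [TopologicalSpace M'] [ChartedSpace H' M'] [IsManifold I' ∞ M']

omit [CompleteSpace E'] in
/-- Extension of the germ of a function that is even in its first variable to a globally defined
even function. -/
theorem exists_contDiff_even_extension {g : ℝ × E → E'} {O : Set (ℝ × E)} (hO : IsOpen O) {y₀ : E}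
    (h0 : (0, y₀) ∈ O) (hg : ContDiffOn ℝ ∞ g O)
    (heven : ∀ u y, (u, y) ∈ O → (-u, y) ∈ O → g (-u, y) = g (u, y)) :
    ∃ h : ℝ × E → E', ContDiff ℝ ∞ h ∧ (∀ u y, h (-u, y) = h (u, y)) ∧
      h =ᶠ[𝓝 (0, y₀)] g := by
  obtain ⟨R, hR, hRO⟩ := Metric.isOpen_iff.1 hO _ h0
  rw [← ball_prod_same] at hRO
  let χ₁ : ContDiffBump (0 : ℝ) := ⟨R / 3, R / 2, by positivity, by linarith⟩
  let χ₂ : ContDiffBump y₀ := ⟨R / 3, R / 2, by positivity, by linarith⟩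
  -- The bump function in `u` is centred at `0` and hence even, so the cut-off preserves the
  -- symmetry of `g`.
  refine ⟨fun p ↦ (χ₁ p.1 * χ₂ p.2) • g p, ?_, ?_, ?_⟩
  · rw [contDiff_iff_contDiffAt]
    rintro ⟨u, y⟩
    by_cases hu : u ∈ Metric.ball (0 : ℝ) R
    · by_cases hy : y ∈ Metric.ball y₀ R
      · exact ((χ₁.contDiffAt.comp (u, y) contDiffAt_fst).mul
          (χ₂.contDiffAt.comp (u, y) contDiffAt_snd)).smul
          (hg.contDiffAt (hO.mem_nhds (hRO ⟨hu, hy⟩)))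
      · have : (tsupport χ₂)ᶜ ∈ 𝓝 y := by
          refine (isClosed_tsupport χ₂).isOpen_compl.mem_nhds fun h ↦ hy ?_
          rw [χ₂.tsupport_eq] at h
          exact Metric.closedBall_subset_ball (by simp only [χ₂]; linarith) h
        refine (contDiffAt_const (c := (0 : E'))).congr_of_eventuallyEq ?_
        filter_upwards [continuousAt_snd.preimage_mem_nhds this] with z hz
        rw [image_eq_zero_of_notMem_tsupport hz, mul_zero, zero_smul]
    · have : (tsupport χ₁)ᶜ ∈ 𝓝 u := by
        refine (isClosed_tsupport χ₁).isOpen_compl.mem_nhds fun h ↦ hu ?_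
        rw [χ₁.tsupport_eq] at h
        exact Metric.closedBall_subset_ball (by simp only [χ₁]; linarith) h
      refine (contDiffAt_const (c := (0 : E'))).congr_of_eventuallyEq ?_
      filter_upwards [continuousAt_fst.preimage_mem_nhds this] with z hz
      rw [image_eq_zero_of_notMem_tsupport hz, zero_mul, zero_smul]
  · intro u y
    simp only [χ₁.neg]
    by_cases hu : u ∈ Metric.ball (0 : ℝ) R
    · by_cases hy : y ∈ Metric.ball y₀ R
      · rw [heven u y (hRO ⟨hu, hy⟩) (hRO ⟨by simpa using hu, hy⟩)]
      · have : χ₂ y = 0 := χ₂.zero_of_le_dist (by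
          rw [Metric.mem_ball, not_lt] at hy; simp only [χ₂]; linarith)
        simp [this]
    · have : χ₁ u = 0 := χ₁.zero_of_le_dist (by
          rw [Metric.mem_ball, not_lt] at hu; simp only [χ₁]; linarith)
      simp [this]
  · have h1 : Metric.ball (0 : ℝ) (R / 3) ×ˢ Metric.ball y₀ (R / 3) ∈ 𝓝 ((0 : ℝ), y₀) :=
      prod_mem_nhds (Metric.ball_mem_nhds _ (by positivity))
        (Metric.ball_mem_nhds _ (by positivity))
    filter_upwards [h1] with p hp
    rw [χ₁.one_of_mem_closedBall (Metric.ball_subset_closedBall hp.1),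
      χ₂.one_of_mem_closedBall (Metric.ball_subset_closedBall hp.2), one_mul, one_smul]

/-- If a family of maps is smooth as a function of the square root of the parameter, then it is
smooth up to the endpoint `0` of the parameter interval. -/
theorem contMDiffWithinAt_of_comp_sq {φ Ψ : ℝ → M → M'} {δ : ℝ} (hδ : 0 < δ)
    (hΨ : ContMDiffOn (𝓘(ℝ, ℝ).prod I) I' ∞ (fun p : ℝ × M ↦ Ψ p.1 p.2) (Ioo (-δ) δ ×ˢ univ))
    (hφ : ∀ u ∈ Ioo (-δ) δ, ∀ x, Ψ u x = φ (u ^ 2) x) (x₀ : M) :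
    ContMDiffWithinAt (𝓘(ℝ, ℝ).prod I) I' ∞ (fun p : ℝ × M ↦ φ p.1 p.2) (Ici 0 ×ˢ univ)
      (0, x₀) := by
  have : CompleteSpace E := FiniteDimensional.complete ℝ E
  set e := extChartAt I x₀
  set e' := extChartAt I' (Ψ 0 x₀)
  have hto : IsOpen e.target := isOpen_extChartAt_target x₀
  have hsym : ContMDiffOn 𝓘(ℝ, ℝ × E) I' ∞ (fun p : ℝ × E ↦ Ψ p.1 (e.symm p.2))
      (Ioo (-δ) δ ×ˢ e.target) := by
    have h1 : ContMDiffOn 𝓘(ℝ, ℝ × E) (𝓘(ℝ, ℝ).prod I) ∞ (fun p : ℝ × E ↦ (p.1, e.symm p.2))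
        (Ioo (-δ) δ ×ˢ e.target) :=
      contDiff_fst.contMDiff.contMDiffOn.prodMk
        ((contMDiffOn_extChartAt_symm (n := ∞) x₀).comp contDiff_snd.contMDiff.contMDiffOn
          fun p hp ↦ hp.2)
    exact hΨ.comp h1 fun p hp ↦ ⟨hp.1, mem_univ _⟩
  set O := (Ioo (-δ) δ ×ˢ e.target) ∩ (fun p : ℝ × E ↦ Ψ p.1 (e.symm p.2)) ⁻¹' e'.source
  have hO : IsOpen O := hsym.continuousOn.isOpen_inter_preimage (isOpen_Ioo.prod hto)
    (isOpen_extChartAt_source _)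
  have hx₀ : e.symm (e x₀) = x₀ := extChartAt_to_inv x₀
  have h0 : ((0 : ℝ), e x₀) ∈ O :=
    ⟨⟨⟨by simpa using hδ, hδ⟩, mem_extChartAt_target x₀⟩, by
      simp only [mem_preimage, hx₀]; exact mem_extChartAt_source _⟩
  have hg : ContDiffOn ℝ ∞ (fun p : ℝ × E ↦ e' (Ψ p.1 (e.symm p.2))) O := by
    rw [← contMDiffOn_iff_contDiffOn]
    exact (contMDiffOn_extChartAt (n := ∞) (I := I') (x := Ψ 0 x₀)).comp
      (hsym.mono inter_subset_left) fun p hp ↦ by simpa [e'] using hp.2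
  obtain ⟨h, hh, heven, hgh⟩ := exists_contDiff_even_extension hO h0 hg (by
    intro u y hu hu'
    simp only
    rw [hφ u hu.1.1, hφ (-u) hu'.1.1, neg_sq])
  have hs := contDiffOn_comp_sqrt hh heven
  -- near `(0, x₀)` the family is given by `h`
  have hcs : ContinuousWithinAt (fun p : ℝ × M ↦ (√p.1, e p.2)) (Ici 0 ×ˢ univ) (0, x₀) := by
    refine ContinuousAt.continuousWithinAt ?_
    exact (Real.continuous_sqrt.continuousAt.comp continuousAt_fst).prodMk
      ((continuousAt_extChartAt (I := I) x₀).comp (f := Prod.snd) (x := ((0 : ℝ), x₀))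
        continuousAt_snd)
  have hev : ∀ᶠ p in 𝓝[Ici (0 : ℝ) ×ˢ (univ : Set M)] (0, x₀),
      φ p.1 p.2 = e'.symm (h (√p.1, e p.2)) := by
    have h1 := hcs.tendsto.eventually
      (p := fun q ↦ h q = e' (Ψ q.1 (e.symm q.2)) ∧ q ∈ O)
      (by
        have : ((√((0 : ℝ), x₀).1, e ((0 : ℝ), x₀).2) : ℝ × E) = (0, e x₀) := by simp
        rw [this]
        exact hgh.and (hO.mem_nhds h0))
    have h2 : ∀ᶠ p in 𝓝[Ici (0 : ℝ) ×ˢ (univ : Set M)] (0, x₀), p.2 ∈ e.source :=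
      (continuousAt_snd.continuousWithinAt (s := Ici (0 : ℝ) ×ˢ (univ : Set M))).eventually
        (extChartAt_source_mem_nhds (I := I) x₀)
    filter_upwards [h1, h2, self_mem_nhdsWithin] with p hp hp2 hp3
    have h4 : 0 ≤ p.1 := hp3.1
    have h5 : Ψ (√p.1) (e.symm (e p.2)) ∈ e'.source := hp.2.2
    rw [hp.1]
    rw [e'.left_inv h5, e.left_inv hp2, hφ _ hp.2.1.1, Real.sq_sqrt h4]
  have hmain : ContMDiffWithinAt (𝓘(ℝ, ℝ).prod I) I' ∞
      (fun p : ℝ × M ↦ e'.symm (h (√p.1, e p.2))) (Ici 0 ×ˢ univ) (0, x₀) := by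
    have h1 : ContMDiffWithinAt (𝓘(ℝ, ℝ).prod I) 𝓘(ℝ, ℝ × E) ∞ (fun p : ℝ × M ↦ (p.1, e p.2))
        (Ici 0 ×ˢ univ) (0, x₀) :=
      contMDiffWithinAt_fst.prodMk_space
        (((contMDiffAt_extChartAt (n := ∞) (I := I) (x := x₀)).comp
          (f := Prod.snd) ((0 : ℝ), x₀) contMDiffAt_snd).contMDiffWithinAt)
    have h2 : ContMDiffWithinAt (𝓘(ℝ, ℝ).prod I) 𝓘(ℝ, E') ∞
        (fun p : ℝ × M ↦ h (√p.1, e p.2)) (Ici 0 ×ˢ univ) (0, x₀) :=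
      ((hs (0, e x₀) ⟨self_mem_Ici, mem_univ _⟩).contMDiffWithinAt).comp
        (f := fun p : ℝ × M ↦ (p.1, e p.2)) ((0 : ℝ), x₀) h1 fun p hp ↦ ⟨hp.1, mem_univ _⟩
    have h3 : h (√((0 : ℝ), x₀).1, e ((0 : ℝ), x₀).2) = e' (Ψ 0 x₀) := by
      have := hgh.self_of_nhds
      simp only [Real.sqrt_zero]
      rw [this]
      simp only [hx₀]
    have h4 : ContMDiffAt 𝓘(ℝ, E') I' ∞ e'.symm (h (√((0 : ℝ), x₀).1, e ((0 : ℝ), x₀).2)) := by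
      rw [h3]
      exact (contMDiffOn_extChartAt_symm (n := ∞) _).contMDiffAt
        ((isOpen_extChartAt_target _).mem_nhds (mem_extChartAt_target _))
    exact ContMDiffAt.comp_contMDiffWithinAt ((0 : ℝ), x₀) h4 h2
  exact hmain.congr_of_eventuallyEq hev (hev.self_of_nhdsWithin ⟨self_mem_Ici, mem_univ _⟩)

/-- A family of maps over `[0, 1]` is smooth as soon as it is smooth in the folded time `τ`, where
`t = sin² τ`. -/
theorem contMDiffOn_of_comp_sin_sq {φ Ψ : ℝ → M → M'}
    (hΨ : ContMDiffOn (𝓘(ℝ, ℝ).prod I) I' ∞ (fun p : ℝ × M ↦ Ψ p.1 p.2) (Ioo (-4) 4 ×ˢ univ))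
    (hφ : ∀ τ ∈ Ioo (-4 : ℝ) 4, ∀ x, Ψ τ x = φ (Real.sin τ ^ 2) x) :
    ContMDiffOn (𝓘(ℝ, ℝ).prod I) I' ∞ (fun p : ℝ × M ↦ φ p.1 p.2) (Icc 0 1 ×ˢ univ) := by
  have hpi := Real.pi_lt_four
  have hpi0 := Real.pi_pos
  -- The window `(-4, 4)` is chosen to contain `[-π/2, π]`, where the two time changes `arcsin u`
  -- and `π/2 - arcsin u` take their values.
  have harc : ∀ u : ℝ, Real.arcsin u ∈ Ioo (-4 : ℝ) 4 := fun u ↦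
    ⟨by linarith [Real.neg_pi_div_two_le_arcsin u], by linarith [Real.arcsin_le_pi_div_two u]⟩
  have harc' : ∀ u : ℝ, Real.pi / 2 - Real.arcsin u ∈ Ioo (-4 : ℝ) 4 := fun u ↦
    ⟨by linarith [Real.arcsin_le_pi_div_two u], by linarith [Real.neg_pi_div_two_le_arcsin u]⟩
  have harcs : ContDiffOn ℝ ∞ Real.arcsin (Ioo (-1) 1) := fun u hu ↦
    (Real.contDiffAt_arcsin (by linarith [hu.1]) (by linarith [hu.2])).contDiffWithinAt
  rintro ⟨t, x⟩ ⟨⟨ht0, ht1⟩, -⟩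
  -- The fold is undone in three ways. At `t = 0` one puts `t = u²` with `τ = arcsin u`; at `t = 1`
  -- one puts `1 - t = u²` with `τ = π/2 - arcsin u`; in between `τ = arcsin √t` is itself smooth.
  rcases ht0.eq_or_lt with rfl | ht0
  · refine ContMDiffWithinAt.mono ?_ (prod_mono Icc_subset_Ici_self subset_rfl)
    refine contMDiffWithinAt_of_comp_sq (Ψ := fun u x ↦ Ψ (Real.arcsin u) x) one_pos ?_ ?_ x
    · refine hΨ.comp (g := fun p : ℝ × M ↦ Ψ p.1 p.2)
        (f := fun p : ℝ × M ↦ (Real.arcsin p.1, p.2)) ?_ fun p _ ↦ ⟨harc _, mem_univ _⟩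
      exact (harcs.contMDiffOn.comp contMDiffOn_fst fun p hp ↦ hp.1).prodMk contMDiffOn_snd
    · intro u hu x
      rw [hφ _ (harc u), Real.sin_arcsin hu.1.le hu.2.le]
  rcases ht1.eq_or_lt with rfl | ht1
  · have h1 : ContMDiffWithinAt (𝓘(ℝ, ℝ).prod I) I' ∞ (fun p : ℝ × M ↦ φ (1 - p.1) p.2)
        (Ici 0 ×ˢ univ) (1 - 1, x) := by
      rw [sub_self]
      refine contMDiffWithinAt_of_comp_sq (φ := fun t x ↦ φ (1 - t) x)
        (Ψ := fun u x ↦ Ψ (Real.pi / 2 - Real.arcsin u) x) one_pos ?_ ?_ x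
      · refine hΨ.comp (g := fun p : ℝ × M ↦ Ψ p.1 p.2)
          (f := fun p : ℝ × M ↦ (Real.pi / 2 - Real.arcsin p.1, p.2)) ?_
          fun p _ ↦ ⟨harc' _, mem_univ _⟩
        exact ((contDiffOn_const.sub harcs).contMDiffOn.comp contMDiffOn_fst
          fun p hp ↦ hp.1).prodMk contMDiffOn_snd
      · intro u hu x
        rw [hφ _ (harc' u), Real.sin_pi_div_two_sub, Real.cos_sq',
          Real.sin_arcsin hu.1.le hu.2.le]
    have hsub : ContMDiff 𝓘(ℝ, ℝ) 𝓘(ℝ, ℝ) ∞ (fun s : ℝ ↦ 1 - s) :=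
      (contDiff_const.sub contDiff_id).contMDiff
    have hpair : ContMDiff (𝓘(ℝ, ℝ).prod I) (𝓘(ℝ, ℝ).prod I) ∞
        (fun p : ℝ × M ↦ (1 - p.1, p.2)) := (hsub.comp contMDiff_fst).prodMk contMDiff_snd
    have h2 := h1.comp (f := fun p : ℝ × M ↦ (1 - p.1, p.2)) (s := Icc 0 1 ×ˢ univ) ((1 : ℝ), x)
      hpair.contMDiffAt.contMDiffWithinAt
      fun p hp ↦ ⟨by simpa using hp.1.2, mem_univ _⟩
    refine h2.congr (fun p _ ↦ ?_) ?_ <;> simp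
  · have hs1 : √t < 1 := by rw [Real.sqrt_lt' one_pos]; simpa using ht1
    have hs0 : 0 < √t := Real.sqrt_pos.2 ht0
    have h1 : ContMDiffAt (𝓘(ℝ, ℝ).prod I) (𝓘(ℝ, ℝ).prod I) ∞
        (fun p : ℝ × M ↦ (Real.arcsin (√p.1), p.2)) (t, x) := by
      have h2 : ContDiffAt ℝ ∞ (fun t ↦ Real.arcsin (√t)) t :=
        (Real.contDiffAt_arcsin (by linarith) hs1.ne).comp t (Real.contDiffAt_sqrt ht0.ne')
      exact (ContMDiffAt.comp (f := (Prod.fst : ℝ × M → ℝ)) (I := 𝓘(ℝ, ℝ).prod I) (t, x)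
        h2.contMDiffAt contMDiffAt_fst).prodMk contMDiffAt_snd
    have h3 := (hΨ.contMDiffAt (prod_mem_nhds (Ioo_mem_nhds (harc (√t)).1 (harc (√t)).2)
      univ_mem)).comp (t, x) (g := fun p : ℝ × M ↦ Ψ p.1 p.2)
      (f := fun p : ℝ × M ↦ (Real.arcsin (√p.1), p.2)) h1
    refine (h3.congr_of_eventuallyEq ?_).contMDiffWithinAt
    filter_upwards [prod_mem_nhds (Ioo_mem_nhds ht0 ht1) univ_mem] with p hp
    have h4 : √p.1 ≤ 1 := by
      rw [Real.sqrt_le_left one_pos.le, one_pow]; exact hp.1.2.le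
    simp only [Function.comp_apply]
    rw [hφ _ (harc _), Real.sin_arcsin (by linarith [Real.sqrt_nonneg p.1]) h4,
      Real.sq_sqrt hp.1.1.le]

/-- The fibrewise inverse of a smooth family of diffeomorphisms is smooth. -/
theorem contMDiff_symm_of_family {Ψ : ℝ → M → M}
    (hΨ : ContMDiff (𝓘(ℝ, ℝ).prod I) I ∞ (fun p : ℝ × M ↦ Ψ p.1 p.2))
    {D : ℝ → (M ≃ₘ^∞⟮I, I⟯ M)} (hD : ∀ τ, ⇑(D τ) = Ψ τ) :
    ContMDiff (𝓘(ℝ, ℝ).prod I) I ∞ (fun p : ℝ × M ↦ (D p.1).symm p.2) := by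
  have : CompleteSpace E := FiniteDimensional.complete ℝ E
  rintro ⟨τ₀, z₀⟩
  set x₀ := (D τ₀).symm z₀ with hx₀
  have hz₀ : Ψ τ₀ x₀ = z₀ := by rw [← hD, hx₀, Diffeomorph.apply_symm_apply]
  set e := extChartAt I x₀
  set e' := extChartAt I z₀
  have hto : IsOpen e.target := isOpen_extChartAt_target x₀
  have hto' : IsOpen e'.target := isOpen_extChartAt_target z₀
  have hsym : ContMDiffOn 𝓘(ℝ, ℝ × E) I ∞ (fun p : ℝ × E ↦ Ψ p.1 (e.symm p.2))
      (univ ×ˢ e.target) := by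
    have h1 : ContMDiffOn 𝓘(ℝ, ℝ × E) (𝓘(ℝ, ℝ).prod I) ∞ (fun p : ℝ × E ↦ (p.1, e.symm p.2))
        (univ ×ˢ e.target) :=
      contDiff_fst.contMDiff.contMDiffOn.prodMk
        ((contMDiffOn_extChartAt_symm (n := ∞) x₀).comp contDiff_snd.contMDiff.contMDiffOn
          fun p hp ↦ hp.2)
    exact hΨ.comp_contMDiffOn h1
  set O := (univ ×ˢ e.target) ∩ (fun p : ℝ × E ↦ Ψ p.1 (e.symm p.2)) ⁻¹' e'.source
  have hO : IsOpen O := hsym.continuousOn.isOpen_inter_preimage (isOpen_univ.prod hto)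
    (isOpen_extChartAt_source _)
  have hxx : e.symm (e x₀) = x₀ := extChartAt_to_inv x₀
  have hzz : e'.symm (e' z₀) = z₀ := extChartAt_to_inv z₀
  have h0 : (τ₀, e x₀) ∈ O :=
    ⟨⟨mem_univ _, mem_extChartAt_target x₀⟩, by
      simp only [mem_preimage, hxx, hz₀]; exact mem_extChartAt_source _⟩
  set g : ℝ × E → E := fun p ↦ e' (Ψ p.1 (e.symm p.2)) with hgdef
  have hg : ContDiffOn ℝ ∞ g O := by
    rw [← contMDiffOn_iff_contDiffOn]
    exact (contMDiffOn_extChartAt (n := ∞) (I := I) (x := z₀)).comp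
      (hsym.mono inter_subset_left) fun p hp ↦ by simpa [e'] using hp.2
  have hgat : ContDiffAt ℝ ∞ g (τ₀, e x₀) := hg.contDiffAt (hO.mem_nhds h0)
  have hgd := (hgat.differentiableAt (by simp)).hasFDerivAt
  -- the partial derivative in the direction of the manifold is invertible
  have hb : HasFDerivAt (fun y ↦ g (τ₀, y))
      (fderiv ℝ g (τ₀, e x₀) ∘L ContinuousLinearMap.inr ℝ ℝ E) (e x₀) :=
    hgd.comp (e x₀) (hasFDerivAt_prodMk_right τ₀ (e x₀))
  set c : E → E := fun w ↦ e ((D τ₀).symm (e'.symm w)) with hcdef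
  have hcc : ContDiffAt ℝ ∞ c (e' z₀) := by
    rw [← contMDiffAt_iff_contDiffAt]
    have h1 : ContMDiffAt 𝓘(ℝ, E) I ∞ e'.symm (e' z₀) :=
      (contMDiffOn_extChartAt_symm (n := ∞) _).contMDiffAt
        (hto'.mem_nhds (mem_extChartAt_target _))
    have h2 := ((D τ₀).symm.contMDiff.contMDiffAt (x := e'.symm (e' z₀))).comp (e' z₀) h1
    refine ContMDiffAt.comp (e' z₀) (g := e) (f := fun w ↦ (D τ₀).symm (e'.symm w)) ?_ h2
    simp only [hzz]
    exact contMDiffAt_extChartAt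
  have hcd := (hcc.differentiableAt (by simp)).hasFDerivAt
  have hcb : (fun y ↦ c (g (τ₀, y))) =ᶠ[𝓝 (e x₀)] id := by
    have : ∀ᶠ y in 𝓝 (e x₀), (τ₀, y) ∈ O :=
      (Continuous.prodMk_right τ₀).continuousAt.preimage_mem_nhds (hO.mem_nhds h0)
    filter_upwards [this] with y hy
    have h1 : Ψ τ₀ (e.symm y) ∈ e'.source := hy.2
    simp only [hcdef, hgdef, id]
    rw [e'.left_inv h1, ← hD, Diffeomorph.symm_apply_apply, e.right_inv hy.1.2]
  have hbc : (fun w ↦ g (τ₀, c w)) =ᶠ[𝓝 (e' z₀)] id := by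
    have h1 : ContinuousAt (fun w ↦ (D τ₀).symm (e'.symm w)) (e' z₀) :=
      (D τ₀).symm.continuous.continuousAt.comp (continuousAt_extChartAt_symm z₀)
    have h2 : ∀ᶠ w in 𝓝 (e' z₀), (D τ₀).symm (e'.symm w) ∈ e.source :=
      h1.preimage_mem_nhds (by simp only [hzz]; exact extChartAt_source_mem_nhds x₀)
    filter_upwards [h2, hto'.mem_nhds (mem_extChartAt_target z₀)] with w hw hw'
    simp only [hcdef, hgdef, id]
    rw [e.left_inv hw, ← hD, Diffeomorph.apply_symm_apply, e'.right_inv hw']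
  have hg0 : g (τ₀, e x₀) = e' z₀ := by simp only [hgdef, hxx, hz₀]
  have hc0 : c (e' z₀) = e x₀ := by simp only [hcdef, hzz]; rfl
  set B := fderiv ℝ g (τ₀, e x₀) ∘L ContinuousLinearMap.inr ℝ ℝ E with hB
  have hcd' : HasFDerivAt c (fderiv ℝ c (e' z₀)) (g (τ₀, e x₀)) := by rw [hg0]; exact hcd
  have hb' : HasFDerivAt (fun y ↦ g (τ₀, y)) B (c (e' z₀)) := by rw [hc0]; exact hb
  have hi1 := (HasFDerivAt.comp (g := c) (e x₀) hcd' hb).unique ((hasFDerivAt_id _).congr_of_eventuallyEq hcb)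
  have hi2 := (HasFDerivAt.comp (g := fun y ↦ g (τ₀, y)) (e' z₀) hb' hcd).unique
    ((hasFDerivAt_id _).congr_of_eventuallyEq hbc)
  let Be : E ≃L[ℝ] E := ContinuousLinearEquiv.equivOfInverse B (fderiv ℝ c (e' z₀))
    (fun v ↦ DFunLike.congr_fun hi1 v) (fun v ↦ DFunLike.congr_fun hi2 v)
  -- The map `(τ, y) ↦ (τ, g (τ, y))` has block triangular derivative with diagonal blocks `1` and
  -- the invertible `Be`. Its local inverse is therefore smooth, and the second component of that
  -- inverse is the chart expression of the family of inverses.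
  have hGd : HasFDerivAt (fun p : ℝ × E ↦ (p.1, g p))
      (((ContinuousLinearEquiv.refl ℝ ℝ).skewProd Be
        (fderiv ℝ g (τ₀, e x₀) ∘L ContinuousLinearMap.inl ℝ ℝ E) : (ℝ × E) ≃L[ℝ] (ℝ × E)) :
        (ℝ × E) →L[ℝ] (ℝ × E)) (τ₀, e x₀) := by
    refine (hasFDerivAt_fst.prodMk hgd).congr_fderiv (ContinuousLinearMap.ext fun v ↦ ?_)
    refine Prod.ext rfl ?_
    have h1 : v = (0, v.2) + (v.1, 0) := by simp
    calc fderiv ℝ g (τ₀, e x₀) v = fderiv ℝ g (τ₀, e x₀) ((0, v.2) + (v.1, 0)) := by rw [← h1]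
      _ = _ := map_add _ _ _
  have hGc : ContDiffAt ℝ ∞ (fun p : ℝ × E ↦ (p.1, g p)) (τ₀, e x₀) := contDiffAt_fst.prodMk hgat
  set h := hGc.toOpenPartialHomeomorph _ hGd (by simp)
  have hcoe : ∀ a, h a = (a.1, g a) := fun a ↦ rfl
  have hsrc : (τ₀, e x₀) ∈ h.source := ContDiffAt.mem_toOpenPartialHomeomorph_source _ hGd (by simp)
  have hh0 : h (τ₀, e x₀) = (τ₀, e' z₀) := by rw [hcoe, hg0]
  have htgt : (τ₀, e' z₀) ∈ h.target := by rw [← hh0]; exact h.map_source hsrc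
  have hsy : h.symm (τ₀, e' z₀) = (τ₀, e x₀) := by rw [← hh0]; exact h.left_inv hsrc
  have hsmooth : ContDiffAt ℝ ∞ h.symm (τ₀, e' z₀) :=
    h.contDiffAt_symm htgt (by rw [hsy]; exact hGd) (by rw [hsy]; exact hGc)
  have hce : ContMDiffAt (𝓘(ℝ, ℝ).prod I) 𝓘(ℝ, ℝ × E) ∞ (fun p : ℝ × M ↦ (p.1, e' p.2))
      (τ₀, z₀) :=
    contMDiffAt_fst.prodMk_space ((contMDiffAt_extChartAt (n := ∞) (I := I) (x := z₀)).comp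
      (f := Prod.snd) (τ₀, z₀) contMDiffAt_snd)
  have h1 : ContMDiffAt (𝓘(ℝ, ℝ).prod I) 𝓘(ℝ, ℝ × E) ∞
      (fun p : ℝ × M ↦ h.symm (p.1, e' p.2)) (τ₀, z₀) :=
    (hsmooth.contMDiffAt).comp (f := fun p : ℝ × M ↦ (p.1, e' p.2)) (τ₀, z₀) hce
  have h2 : ContMDiffAt (𝓘(ℝ, ℝ).prod I) I ∞
      (fun p : ℝ × M ↦ e.symm (h.symm (p.1, e' p.2)).2) (τ₀, z₀) := by
    refine ContMDiffAt.comp (g := e.symm) (f := fun p : ℝ × M ↦ (h.symm (p.1, e' p.2)).2)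
      (τ₀, z₀) ?_ (contDiff_snd.contMDiff.contMDiffAt.comp (τ₀, z₀) h1)
    simp only [hsy]
    exact (contMDiffOn_extChartAt_symm (n := ∞) _).contMDiffAt
      (hto.mem_nhds (mem_extChartAt_target _))
  refine h2.congr_of_eventuallyEq ?_
  have h3 := h1.continuousAt.eventually (p := fun q ↦ q ∈ O) (by
    simp only [hsy]; exact hO.mem_nhds h0)
  have h4 := hce.continuousAt.eventually (p := fun q ↦ q ∈ h.target) (h.open_target.mem_nhds htgt)
  have h5 : ∀ᶠ p in 𝓝 (τ₀, z₀), p.2 ∈ e'.source :=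
    continuousAt_snd.eventually (extChartAt_source_mem_nhds (I := I) z₀)
  filter_upwards [h3, h4, h5] with p hp3 hp4 hp5
  have h6 : h (h.symm (p.1, e' p.2)) = (p.1, e' p.2) := h.right_inv hp4
  rw [hcoe] at h6
  have h7 : (h.symm (p.1, e' p.2)).1 = p.1 := congrArg Prod.fst h6
  have h8 : g (h.symm (p.1, e' p.2)) = e' p.2 := congrArg Prod.snd h6
  have h9 := e'.injOn hp3.2 hp5 h8
  simp only [h7] at h9
  rw [← hD] at h9
  exact (congrArg (D p.1).symm h9).symm.trans ((D p.1).symm_apply_apply _)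

end FoldedTime

theorem two_le_smooth : (2 : WithTop ℕ∞) ≤ ∞ :=
  (WithTop.coe_le_coe.2 le_top : ((2 : ℕ∞) : WithTop ℕ∞) ≤ ∞)

/-! ### Smooth families of alternating forms -/

section Alternating

variable {P E : Type*} [NormedAddCommGroup P] [NormedSpace ℝ P]
  [NormedAddCommGroup E] [NormedSpace ℝ E]

/-- A family of alternating forms on a finite-dimensional space is smooth when all its coefficients
are. -/
theorem contDiffWithinAt_continuousAlternatingMap [FiniteDimensional ℝ E] {k : ℕ}
    {A : P → E [⋀^Fin k]→L[ℝ] ℝ} {s : Set P} {p : P} {n : WithTop ℕ∞}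
    (h : ∀ v, ContDiffWithinAt ℝ n (fun p ↦ A p v) s p) : ContDiffWithinAt ℝ n A s p := by
  let b := Module.finBasis ℝ E
  let ev : (E [⋀^Fin k]→L[ℝ] ℝ) →ₗ[ℝ] ((Fin k → Fin (Module.finrank ℝ E)) → ℝ) :=
    { toFun := fun f i ↦ f (fun j ↦ b (i j))
      map_add' := fun f g ↦ rfl
      map_smul' := fun c f ↦ rfl }
  have hinj : Function.Injective ev := by
    intro f g hfg
    have h1 : f.toMultilinearMap = g.toMultilinearMap :=
      Module.Basis.ext_multilinear (fun _ ↦ b) fun i ↦ congrFun hfg i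
    exact ContinuousAlternatingMap.ext fun v ↦ DFunLike.congr_fun h1 v
  have hfin : FiniteDimensional ℝ (E [⋀^Fin k]→L[ℝ] ℝ) := Module.Finite.of_injective ev hinj
  obtain ⟨L, hL⟩ := ev.exists_leftInverse_of_injective (LinearMap.ker_eq_bot.2 hinj)
  have h2 : ContDiffWithinAt ℝ n (fun p ↦ ev (A p)) s p :=
    contDiffWithinAt_pi.2 fun i ↦ h _
  have h3 := (LinearMap.toContinuousLinearMap L).contDiff.comp_contDiffWithinAt h2
  refine h3.congr (fun q _ ↦ ?_) ?_ <;>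
  exact (LinearMap.congr_fun hL _).symm

theorem ContDiffWithinAt.compContinuousLinearMap_apply {k : ℕ} {F : Type*}
    [NormedAddCommGroup F] [NormedSpace ℝ F] {A : P → F [⋀^Fin k]→L[ℝ] ℝ} {g : P → E →L[ℝ] F}
    {s : Set P} {p : P} {n : WithTop ℕ∞} (hA : ContDiffWithinAt ℝ n A s p)
    (hg : ContDiffWithinAt ℝ n g s p) (v : Fin k → E) :
    ContDiffWithinAt ℝ n (fun p ↦ (A p).compContinuousLinearMap (g p) v) s p := by
  have h1 : ContDiffWithinAt ℝ n (fun p ↦ (ContinuousMultilinearMap.compContinuousLinearMapContinuousMultilinear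
      ℝ (fun _ : Fin k ↦ E) (fun _ : Fin k ↦ F) ℝ) (fun _ ↦ g p)) s p :=
    (ContinuousMultilinearMap.contDiff _).comp_contDiffWithinAt (contDiffWithinAt_pi.2 fun _ ↦ hg)
  have h2 : ContDiffWithinAt ℝ n (fun p ↦ (A p).toContinuousMultilinearMap) s p :=
    (ContinuousAlternatingMap.toContinuousMultilinearMapLI (𝕜 := ℝ) (E := F) (F := ℝ)
      (ι := Fin k)).toContinuousLinearMap.contDiff.comp_contDiffWithinAt hA
  have h3 := h1.clm_apply h2
  exact (ContinuousMultilinearMap.apply ℝ (fun _ : Fin k ↦ E) ℝ v).contDiff.comp_contDiffWithinAt h3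

end Alternating

/-! ### Forms, pullbacks and exterior derivatives in charts -/

namespace Presymplectic

open Filter Topology

variable {d : ℕ} {M : Type*} [TopologicalSpace M] [ChartedSpace (EuclideanSpace ℝ (Fin d)) M]
  [IsManifold (𝓡 d) ∞ M] {k : ℕ}

local notation "𝔼" => EuclideanSpace ℝ (Fin d)

theorem isManifold_one : IsManifold (𝓡 d) 1 M := IsManifold.of_le (n := ∞) (by exact_mod_cast le_top)

theorem mdifferentiableAt_chart_symm {x₀ : M} {y : 𝔼} (hy : y ∈ (extChartAt (𝓡 d) x₀).target) :
    MDifferentiableAt 𝓘(ℝ, 𝔼) (𝓡 d) (extChartAt (𝓡 d) x₀).symm y :=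
  have := isManifold_one (d := d) (M := M)
  (mdifferentiableOn_extChartAt_symm (I := 𝓡 d) _ hy).mdifferentiableAt
    ((isOpen_extChartAt_target x₀).mem_nhds hy)

theorem mdifferentiableAt_chart {x₀ x : M} (hx : x ∈ (extChartAt (𝓡 d) x₀).source) :
    MDifferentiableAt (𝓡 d) 𝓘(ℝ, 𝔼) (extChartAt (𝓡 d) x₀) x := by
  have := isManifold_one (d := d) (M := M)
  exact mdifferentiableAt_extChartAt (by rwa [extChartAt_source] at hx)

theorem mfderiv_chart_mfderiv_chart_symm {x₀ : M} {y : 𝔼} (hy : y ∈ (extChartAt (𝓡 d) x₀).target)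
    (v : 𝔼) : mfderiv (𝓡 d) 𝓘(ℝ, 𝔼) (extChartAt (𝓡 d) x₀) ((extChartAt (𝓡 d) x₀).symm y)
      (mfderiv 𝓘(ℝ, 𝔼) (𝓡 d) (extChartAt (𝓡 d) x₀).symm y v) = v := by
  have := isManifold_one (d := d) (M := M)
  have h := mfderiv_extChartAt_comp_mfderivWithin_extChartAt_symm (I := 𝓡 d) hy
  rw [(𝓡 d).range_eq_univ, mfderivWithin_univ] at h
  exact DFunLike.congr_fun h v

theorem mfderiv_chart_symm_mfderiv_chart {x₀ : M} {y : 𝔼} (hy : y ∈ (extChartAt (𝓡 d) x₀).target)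
    (v : TangentSpace (𝓡 d) ((extChartAt (𝓡 d) x₀).symm y)) :
    mfderiv 𝓘(ℝ, 𝔼) (𝓡 d) (extChartAt (𝓡 d) x₀).symm y
      (mfderiv (𝓡 d) 𝓘(ℝ, 𝔼) (extChartAt (𝓡 d) x₀) ((extChartAt (𝓡 d) x₀).symm y) v) = v := by
  have := isManifold_one (d := d) (M := M)
  have h := mfderivWithin_extChartAt_symm_comp_mfderiv_extChartAt (I := 𝓡 d) hy
  rw [(𝓡 d).range_eq_univ, mfderivWithin_univ] at h
  exact DFunLike.congr_fun h v

/-- Evaluation of a form through its coefficients in a chart. -/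
theorem Form.inChart_mfderiv_chart (α : Form d M k) {x₀ x : M}
    (hx : x ∈ (extChartAt (𝓡 d) x₀).source) (v : Fin k → TangentSpace (𝓡 d) x) :
    α.inChart x₀ (extChartAt (𝓡 d) x₀ x)
      (fun i ↦ mfderiv (𝓡 d) 𝓘(ℝ, 𝔼) (extChartAt (𝓡 d) x₀) x (v i)) = α x v := by
  obtain ⟨y, hy, rfl⟩ : ∃ y ∈ (extChartAt (𝓡 d) x₀).target, (extChartAt (𝓡 d) x₀).symm y = x :=
    ⟨_, (extChartAt (𝓡 d) x₀).map_source hx, (extChartAt (𝓡 d) x₀).left_inv hx⟩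
  have h := (extChartAt (𝓡 d) x₀).right_inv hy
  refine (congrArg (fun z ↦ α.inChart x₀ z (fun i ↦ (mfderiv (𝓡 d) 𝓘(ℝ, 𝔼) (extChartAt (𝓡 d) x₀)
    ((extChartAt (𝓡 d) x₀).symm y) (v i) : 𝔼))) h).trans ?_
  exact (Form.inChart_apply α x₀ y _).trans
    (congrArg _ (funext fun i ↦ mfderiv_chart_symm_mfderiv_chart hy (v i)))

theorem fderiv_chart_comp {x₀ z₀ : M} {f : M → M} {y : 𝔼}
    (hy : y ∈ (extChartAt (𝓡 d) x₀).target)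
    (hf : MDifferentiableAt (𝓡 d) (𝓡 d) f ((extChartAt (𝓡 d) x₀).symm y))
    (hz : f ((extChartAt (𝓡 d) x₀).symm y) ∈ (extChartAt (𝓡 d) z₀).source) (v : 𝔼) :
    fderiv ℝ (fun y ↦ extChartAt (𝓡 d) z₀ (f ((extChartAt (𝓡 d) x₀).symm y))) y v =
      mfderiv (𝓡 d) 𝓘(ℝ, 𝔼) (extChartAt (𝓡 d) z₀) (f ((extChartAt (𝓡 d) x₀).symm y))
        (mfderiv (𝓡 d) (𝓡 d) f ((extChartAt (𝓡 d) x₀).symm y)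
          (mfderiv 𝓘(ℝ, 𝔼) (𝓡 d) (extChartAt (𝓡 d) x₀).symm y v)) := by
  have h1 := mdifferentiableAt_chart_symm hy
  have h2 := ((mdifferentiableAt_chart hz).hasMFDerivAt.comp _ hf.hasMFDerivAt).comp y
    h1.hasMFDerivAt
  have h3 := h2.mfderiv
  rw [mfderiv_eq_fderiv] at h3
  exact DFunLike.congr_fun h3 v

/-- The coefficients of a pullback. -/
theorem Form.pullback_inChart (α : Form d M k) {x₀ z₀ : M} {f : M → M} {y : 𝔼}
    (hy : y ∈ (extChartAt (𝓡 d) x₀).target)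
    (hf : MDifferentiableAt (𝓡 d) (𝓡 d) f ((extChartAt (𝓡 d) x₀).symm y))
    (hz : f ((extChartAt (𝓡 d) x₀).symm y) ∈ (extChartAt (𝓡 d) z₀).source) :
    (α.pullback f).inChart x₀ y =
      (α.inChart z₀ (extChartAt (𝓡 d) z₀ (f ((extChartAt (𝓡 d) x₀).symm y)))).compContinuousLinearMap
        (fderiv ℝ (fun y ↦ extChartAt (𝓡 d) z₀ (f ((extChartAt (𝓡 d) x₀).symm y))) y) := by
  ext v
  rw [Form.inChart_apply, Form.pullback_apply, ← α.inChart_mfderiv_chart hz]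
  rw [ContinuousAlternatingMap.compContinuousLinearMap_apply]
  congr 1
  funext i
  exact (fderiv_chart_comp hy hf hz (v i)).symm

omit [IsManifold (𝓡 d) ∞ M] in
theorem Form.pullback_id (α : Form d M k) : α.pullback id = α := by
  funext x
  ext v
  rw [Form.pullback_apply, mfderiv_id]
  rfl

omit [IsManifold (𝓡 d) ∞ M] in
theorem Form.pullback_comp (α : Form d M k) {f g : M → M} (hf : MDifferentiable (𝓡 d) (𝓡 d) f)
    (hg : MDifferentiable (𝓡 d) (𝓡 d) g) : (α.pullback f).pullback g = α.pullback (f ∘ g) := by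
  funext x
  ext v
  rw [Form.pullback_apply, Form.pullback_apply, Form.pullback_apply,
    mfderiv_comp x (hf (g x)) (hg x)]
  rfl

theorem contDiffAt_chart_comp {x₀ z₀ : M} {Φ : ℝ → M → M} {τ : ℝ} {y : 𝔼}
    (hΦ : ContMDiffAt (𝓘(ℝ, ℝ).prod (𝓡 d)) (𝓡 d) ∞ (fun p : ℝ × M ↦ Φ p.1 p.2)
      (τ, (extChartAt (𝓡 d) x₀).symm y))
    (hy : y ∈ (extChartAt (𝓡 d) x₀).target)
    (hz : Φ τ ((extChartAt (𝓡 d) x₀).symm y) ∈ (extChartAt (𝓡 d) z₀).source) :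
    ContDiffAt ℝ ∞ (fun p : ℝ × 𝔼 ↦
      extChartAt (𝓡 d) z₀ (Φ p.1 ((extChartAt (𝓡 d) x₀).symm p.2))) (τ, y) := by
  rw [← contMDiffAt_iff_contDiffAt]
  have h1 : ContMDiffAt 𝓘(ℝ, 𝔼) (𝓡 d) ∞ (extChartAt (𝓡 d) x₀).symm y :=
    (contMDiffOn_extChartAt_symm x₀).contMDiffAt ((isOpen_extChartAt_target x₀).mem_nhds hy)
  have h2 : ContMDiffAt 𝓘(ℝ, ℝ × 𝔼) (𝓡 d) ∞
      (fun p : ℝ × 𝔼 ↦ (extChartAt (𝓡 d) x₀).symm p.2) (τ, y) :=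
    ContMDiffAt.comp (g := (extChartAt (𝓡 d) x₀).symm) (f := fun p : ℝ × 𝔼 ↦ p.2) (τ, y) h1
      contDiff_snd.contMDiff.contMDiffAt
  have h3 : ContMDiffAt 𝓘(ℝ, ℝ × 𝔼) (𝓡 d) ∞
      (fun p : ℝ × 𝔼 ↦ Φ p.1 ((extChartAt (𝓡 d) x₀).symm p.2)) (τ, y) :=
    ContMDiffAt.comp (g := fun p : ℝ × M ↦ Φ p.1 p.2)
      (f := fun p : ℝ × 𝔼 ↦ (p.1, (extChartAt (𝓡 d) x₀).symm p.2)) (τ, y) hΦ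
      (contDiff_fst.contMDiff.contMDiffAt.prodMk h2)
  have h4 : ContMDiffAt (𝓡 d) 𝓘(ℝ, 𝔼) ∞ (extChartAt (𝓡 d) z₀)
      (Φ τ ((extChartAt (𝓡 d) x₀).symm y)) :=
    contMDiffAt_extChartAt' (by rwa [extChartAt_source] at hz)
  exact ContMDiffAt.comp (g := extChartAt (𝓡 d) z₀)
    (f := fun p : ℝ × 𝔼 ↦ Φ p.1 ((extChartAt (𝓡 d) x₀).symm p.2)) (τ, y) h4 h3

/-- The exterior derivative can be computed in any chart. -/
theorem Form.extD_inChart {α : Form d M k} (hα : α.IsSmooth) {x₀ : M} {y : 𝔼}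
    (hy : y ∈ (extChartAt (𝓡 d) x₀).target) :
    α.extD.inChart x₀ y = extDeriv (α.inChart x₀) y := by
  set x := (extChartAt (𝓡 d) x₀).symm y with hx
  have hxs : x ∈ (extChartAt (𝓡 d) x).source := mem_extChartAt_source x
  -- The exterior derivative at `x` is defined in the chart centred at `x`. `T` is the change of
  -- coordinates from the chart at `x₀` to that one, and naturality of `d` under `T` gives
  -- independence of the chart.
  let T : 𝔼 → 𝔼 := fun z ↦ extChartAt (𝓡 d) x (id ((extChartAt (𝓡 d) x₀).symm z))
  have hT : ContDiffAt ℝ ∞ T y :=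
    (contDiffAt_chart_comp (Φ := fun _ ↦ id) (τ := 0) (z₀ := x) contMDiffAt_snd hy hxs).comp y
      (contDiffAt_const.prodMk contDiffAt_id)
  have hev : α.inChart x₀ =ᶠ[𝓝 y]
      fun z ↦ (α.inChart x (T z)).compContinuousLinearMap (fderiv ℝ T z) := by
    have h1 : ∀ᶠ z in 𝓝 y, (extChartAt (𝓡 d) x₀).symm z ∈ (extChartAt (𝓡 d) x).source :=
      ((continuousOn_extChartAt_symm x₀).continuousAt
        ((isOpen_extChartAt_target x₀).mem_nhds hy)).eventually
        ((isOpen_extChartAt_source x).mem_nhds hxs)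
    filter_upwards [h1, (isOpen_extChartAt_target x₀).mem_nhds hy] with z hz hz'
    have h2 := α.pullback_inChart (f := id) hz' mdifferentiableAt_id hz
    rwa [Form.pullback_id] at h2
  rw [hev.extDeriv_eq, extDeriv_pullback (r := ∞) (f := T) (x := y)
    (((hα x).contDiffAt ((isOpen_extChartAt_target x).mem_nhds
      ((extChartAt (𝓡 d) x).map_source hxs))).differentiableAt (by simp)) hT
    (by simpa using two_le_smooth)]
  ext v
  have h3 : ∀ v : 𝔼, fderiv ℝ T y v = _ := fderiv_chart_comp hy mdifferentiableAt_id hxs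
  refine (Form.inChart_apply _ _ _ _).trans ((Form.extD_apply _ _ _).trans ?_)
  refine congrArg (extDeriv (α.inChart x) (extChartAt (𝓡 d) x x)) (funext fun i ↦ ?_)
  refine Eq.trans ?_ (h3 (v i)).symm
  rw [mfderiv_id]
  rfl

/-- A family of forms parametrised by the real line whose coefficients are jointly smooth. -/
def IsSmoothFamily (α : ℝ → Form d M k) : Prop :=
  ∀ x₀ : M, ContDiffOn ℝ ∞ (fun p : ℝ × 𝔼 ↦ (α p.1).inChart x₀ p.2)
    (univ ×ˢ (extChartAt (𝓡 d) x₀).target)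

omit [IsManifold (𝓡 d) ∞ M] in
theorem IsSmoothFamily.contDiffAt {α : ℝ → Form d M k} (hα : IsSmoothFamily α) {x₀ : M} {τ : ℝ}
    {y : 𝔼} (hy : y ∈ (extChartAt (𝓡 d) x₀).target) :
    ContDiffAt ℝ ∞ (fun p : ℝ × 𝔼 ↦ (α p.1).inChart x₀ p.2) (τ, y) :=
  (hα x₀).contDiffAt ((isOpen_univ.prod (isOpen_extChartAt_target x₀)).mem_nhds ⟨mem_univ _, hy⟩)

theorem sin_sq_mem_Icc (τ : ℝ) : Real.sin τ ^ 2 ∈ Icc (0 : ℝ) 1 :=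
  ⟨sq_nonneg _, Real.sin_sq_le_one τ⟩

-- Since `sin²` maps the line into `[0,1]`, smoothness up to the endpoints is all that the chain
-- rule needs; values of the path outside `[0,1]` never enter.
omit [IsManifold (𝓡 d) ∞ M] in
theorem IsSmoothPath.comp_sin_sq {α : ℝ → Form d M k} (hα : IsSmoothPath α) :
    IsSmoothFamily (fun τ ↦ α (Real.sin τ ^ 2)) := by
  intro x₀
  exact (hα x₀).comp (g := fun p : ℝ × 𝔼 ↦ (α p.1).inChart x₀ p.2)
    (f := fun p : ℝ × 𝔼 ↦ (Real.sin p.1 ^ 2, p.2))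
    (((Real.contDiff_sin.comp contDiff_fst).pow 2).prodMk contDiff_snd).contDiffOn
    fun p hp ↦ ⟨sin_sq_mem_Icc _, hp.2⟩

omit [IsManifold (𝓡 d) ∞ M] in
theorem IsIsotopy.contMDiff_comp_sin_sq {φ : ℝ → M → M} (hφ : IsIsotopy d φ) :
    ContMDiff (𝓘(ℝ, ℝ).prod (𝓡 d)) (𝓡 d) ∞ (fun p : ℝ × M ↦ φ (Real.sin p.1 ^ 2) p.2) := by
  have h1 : ContMDiff (𝓘(ℝ, ℝ).prod (𝓡 d)) 𝓘(ℝ, ℝ) ∞ (fun p : ℝ × M ↦ Real.sin p.1 ^ 2) :=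
    ContMDiff.comp (g := fun τ : ℝ ↦ Real.sin τ ^ 2) (f := fun p : ℝ × M ↦ p.1)
      (Real.contDiff_sin.pow 2).contMDiff contMDiff_fst
  rw [← contMDiffOn_univ]
  exact hφ.smooth.comp (f := fun p : ℝ × M ↦ (Real.sin p.1 ^ 2, p.2))
    (h1.prodMk contMDiff_snd).contMDiffOn fun p _ ↦ ⟨sin_sq_mem_Icc _, mem_univ _⟩

omit [IsManifold (𝓡 d) ∞ M] in
theorem IsIsotopy.diffeomorph_comp_sin_sq {φ : ℝ → M → M} (hφ : IsIsotopy d φ) (τ : ℝ) :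
    ∃ Φ : M ≃ₘ^∞⟮𝓡 d, 𝓡 d⟯ M, ⇑Φ = φ (Real.sin τ ^ 2) :=
  hφ.diffeo _ (sin_sq_mem_Icc τ)

/-- In charts the pullback is built from the coefficients of `α_τ` along the chart expression `G` of
`Φ` and from the spatial derivative of `G`. Both depend smoothly on `(τ, y)` jointly. -/
theorem IsSmoothFamily.pullback {α : ℝ → Form d M k} (hα : IsSmoothFamily α) {Φ : ℝ → M → M}
    (hΦ : ContMDiff (𝓘(ℝ, ℝ).prod (𝓡 d)) (𝓡 d) ∞ (fun p : ℝ × M ↦ Φ p.1 p.2)) :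
    IsSmoothFamily (fun τ ↦ (α τ).pullback (Φ τ)) := by
  rintro x₀ ⟨τ, y⟩ ⟨-, hy⟩
  have hy : y ∈ (extChartAt (𝓡 d) x₀).target := hy
  set z₀ := Φ τ ((extChartAt (𝓡 d) x₀).symm y) with hz₀
  have hz : Φ τ ((extChartAt (𝓡 d) x₀).symm y) ∈ (extChartAt (𝓡 d) z₀).source :=
    mem_extChartAt_source z₀
  have hG := contDiffAt_chart_comp (z₀ := z₀) (hΦ (τ, (extChartAt (𝓡 d) x₀).symm y)) hy hz
  set G : ℝ × 𝔼 → 𝔼 :=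
    fun p ↦ extChartAt (𝓡 d) z₀ (Φ p.1 ((extChartAt (𝓡 d) x₀).symm p.2)) with hGdef
  have hDG : ContDiffAt ℝ ∞ (fun p : ℝ × 𝔼 ↦ fderiv ℝ (fun y ↦ G (p.1, y)) p.2) (τ, y) := by
    refine ContDiffAt.fderiv (n := ∞) (f := fun (p : ℝ × 𝔼) y ↦ G (p.1, y)) (g := fun p ↦ p.2) ?_
      contDiffAt_snd (by simp)
    exact ContDiffAt.comp (g := G) (f := fun q : (ℝ × 𝔼) × 𝔼 ↦ (q.1.1, q.2)) ((τ, y), y) hG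
      ((contDiff_fst.comp contDiff_fst).prodMk contDiff_snd).contDiffAt
  have hA : ContDiffAt ℝ ∞ (fun p : ℝ × 𝔼 ↦ (α p.1).inChart z₀ (G p)) (τ, y) :=
    ContDiffAt.comp (g := fun p : ℝ × 𝔼 ↦ (α p.1).inChart z₀ p.2)
      (f := fun p : ℝ × 𝔼 ↦ (p.1, G p)) (τ, y)
      (hα.contDiffAt ((extChartAt (𝓡 d) z₀).map_source hz)) (contDiffAt_fst.prodMk hG)
  have h : ContDiffAt ℝ ∞ (fun p : ℝ × 𝔼 ↦ ((α p.1).inChart z₀ (G p)).compContinuousLinearMap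
      (fderiv ℝ (fun y ↦ G (p.1, y)) p.2)) (τ, y) := by
    rw [← contDiffWithinAt_univ] at hA hDG ⊢
    exact contDiffWithinAt_continuousAlternatingMap fun v ↦ hA.compContinuousLinearMap_apply hDG v
  refine (h.congr_of_eventuallyEq ?_).contDiffWithinAt
  have hc : ContinuousAt (fun p : ℝ × 𝔼 ↦ Φ p.1 ((extChartAt (𝓡 d) x₀).symm p.2)) (τ, y) :=
    ContinuousAt.comp (g := fun p : ℝ × M ↦ Φ p.1 p.2)
      (f := fun p : ℝ × 𝔼 ↦ (p.1, (extChartAt (𝓡 d) x₀).symm p.2))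
      hΦ.continuous.continuousAt (continuousAt_fst.prodMk
        (((continuousOn_extChartAt_symm x₀).continuousAt
          ((isOpen_extChartAt_target x₀).mem_nhds hy)).comp
            (f := fun p : ℝ × 𝔼 ↦ p.2) (x := (τ, y)) continuousAt_snd))
  filter_upwards [hc.eventually ((isOpen_extChartAt_source z₀).mem_nhds hz),
    (continuousAt_snd (p := (τ, y))).eventually ((isOpen_extChartAt_target x₀).mem_nhds hy)]
    with p hp hp'
  have h5 : ContMDiff (𝓡 d) (𝓡 d) ∞ (Φ p.1) :=
    hΦ.comp (f := fun x : M ↦ (p.1, x)) (contMDiff_const.prodMk contMDiff_id)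
  exact (α p.1).pullback_inChart hp' (h5.mdifferentiable (by simp) _) hp

end Presymplectic

/-! ### Inverting the contraction of a degenerate 2-form -/

section LinearAlgebra

variable {E : Type*} [NormedAddCommGroup E] [NormedSpace ℝ E]

/-- The contraction `v ↦ ι_v a` of a 2-form, together with a rank one correction `ℓ ⊗ ℓ`. -/
def contractAdd (ℓ : E →L[ℝ] ℝ) (a : E [⋀^Fin 2]→L[ℝ] ℝ) : E →L[ℝ] E →L[ℝ] ℝ :=
  ((ContinuousAlternatingMap.ofSubsingletonLIE (𝕜 := ℝ) (E := E) (F := ℝ)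
    (0 : Fin 1)).symm.toContinuousLinearEquiv :
    (E [⋀^Fin 1]→L[ℝ] ℝ) →L[ℝ] E →L[ℝ] ℝ).comp a.curryLeft + ℓ.smulRight ℓ

theorem contractAdd_apply (ℓ : E →L[ℝ] ℝ) (a : E [⋀^Fin 2]→L[ℝ] ℝ) (v w : E) :
    contractAdd ℓ a v w = a ![v, w] + ℓ v * ℓ w := by
  have h : (Matrix.vecCons v fun _ : Fin 1 ↦ w) = ![v, w] := by
    funext i; fin_cases i <;> rfl
  change a (Matrix.vecCons v fun _ : Fin 1 ↦ w) + ℓ v • ℓ w = _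
  rw [h, smul_eq_mul]

theorem ContinuousAlternatingMap.apply_pair_self (a : E [⋀^Fin 2]→L[ℝ] ℝ) (v : E) :
    a ![v, v] = 0 :=
  a.map_eq_zero_of_eq _ (i := 0) (j := 1) rfl (by decide)

theorem ContinuousAlternatingMap.apply_pair_swap (a : E [⋀^Fin 2]→L[ℝ] ℝ) (v w : E) :
    a ![v, w] = -a ![w, v] := by
  have h : a (![v, w] ∘ Equiv.swap 0 1) = -a ![v, w] :=
    a.toAlternatingMap.map_swap ![v, w] (i := 0) (j := 1) (by decide)
  rw [← neg_eq_iff_eq_neg, ← h]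
  congr 1
  funext i; fin_cases i <;> rfl

/-- Evaluated on `v` itself, the alternating part vanishes and `ℓ(v)² = 0` remains. So the
correction term separates from the form, and injectivity fails only on vectors common to both
kernels. -/
theorem ker_eq_zero_of_contractAdd {ℓ : E →L[ℝ] ℝ} {a : E [⋀^Fin 2]→L[ℝ] ℝ} {v : E}
    (h : contractAdd ℓ a v = 0) : ℓ v = 0 ∧ ∀ w, a ![v, w] = 0 := by
  have h1 : ∀ w, a ![v, w] + ℓ v * ℓ w = 0 := fun w ↦ by rw [← contractAdd_apply, h]; rfl
  have h2 : ℓ v = 0 := by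
    have := h1 v
    rw [a.apply_pair_self, zero_add] at this
    exact mul_self_eq_zero.1 this
  exact ⟨h2, fun w ↦ by simpa [h2] using h1 w⟩

theorem isInvertible_contractAdd [FiniteDimensional ℝ E] {ℓ : E →L[ℝ] ℝ}
    {a : E [⋀^Fin 2]→L[ℝ] ℝ} (h : ∀ v, contractAdd ℓ a v = 0 → v = 0) :
    (contractAdd ℓ a).IsInvertible := by
  have hfin : FiniteDimensional ℝ (E →L[ℝ] ℝ) :=
    LinearMap.toContinuousLinearMap.finiteDimensional
  have hrank : Module.finrank ℝ E = Module.finrank ℝ (E →L[ℝ] ℝ) := by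
    exact Subspace.dual_finrank_eq.symm.trans
      (LinearMap.toContinuousLinearMap (𝕜 := ℝ) (E := E) (F' := ℝ)).finrank_eq
  exact ⟨(LinearMap.linearEquivOfInjective (contractAdd ℓ a).toLinearMap
    ((injective_iff_map_eq_zero _).2 h) hrank).toContinuousLinearEquiv,
    ContinuousLinearMap.ext fun v ↦ rfl⟩

/-- Along a family of 2-forms with a common kernel line field, the equation `ι_u a = c` can be
solved smoothly in a neighbourhood of every point for covectors `c` vanishing on the kernel. -/
theorem exists_smooth_solution_contract [FiniteDimensional ℝ E] {a : ℝ × E → E [⋀^Fin 2]→L[ℝ] ℝ}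
    {T : Set E} (hT : IsOpen T) (ha : ContDiffOn ℝ ∞ a (univ ×ˢ T))
    (hker : ∀ τ, ∀ y ∈ T, ∀ v, (∀ w, a (τ, y) ![v, w] = 0) → ∀ w, a (0, y) ![v, w] = 0)
    (hker' : ∀ τ, ∀ y ∈ T, ∀ v, (∀ w, a (0, y) ![v, w] = 0) → ∀ w, a (τ, y) ![v, w] = 0)
    (hdim : ∀ y ∈ T, ∃ e ≠ 0, (∀ w, a (0, y) ![e, w] = 0) ∧
      ∀ v, (∀ w, a (0, y) ![v, w] = 0) → ∃ c : ℝ, c • e = v) {y₀ : E} (hy₀ : y₀ ∈ T) :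
    ∃ (S : (E [⋀^Fin 2]→L[ℝ] ℝ) → (E →L[ℝ] ℝ) →L[ℝ] E) (U : Set E), IsOpen U ∧ y₀ ∈ U ∧ U ⊆ T ∧
      ContDiffOn ℝ ∞ (fun p ↦ S (a p)) (univ ×ˢ U) ∧
      ∀ τ, ∀ y ∈ U, ∀ c : E →L[ℝ] ℝ, (∀ v, (∀ w, a (0, y) ![v, w] = 0) → c v = 0) →
        ∀ w, a (τ, y) ![S (a (τ, y)) c, w] = c w := by
  have hcomp : CompleteSpace E := FiniteDimensional.complete ℝ E
  obtain ⟨e, he, he0, hespan⟩ := hdim y₀ hy₀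
  -- The kernel at `y₀` is spanned by `e`, so a functional with `ℓ e = 1` is exactly what makes `a +
  -- ℓ ⊗ ℓ` nondegenerate there.
  obtain ⟨ℓ, hℓ⟩ := SeparatingDual.exists_eq_one (R := ℝ) he
  have hA : ContDiffOn ℝ ∞ (fun p ↦ contractAdd ℓ (a p)) (univ ×ˢ T) := by
    refine contDiffOn_clm_apply.2 fun v ↦ contDiffOn_clm_apply.2 fun w ↦ ?_
    simp only [contractAdd_apply]
    refine ContDiffOn.add ?_ contDiffOn_const
    exact (ContinuousAlternatingMap.apply ℝ E ℝ ![v, w]).contDiff.comp_contDiffOn ha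
  have hA0 : ContinuousOn (fun y ↦ contractAdd ℓ (a (0, y))) T :=
    hA.continuousOn.comp (f := fun y : E ↦ ((0 : ℝ), y)) (by fun_prop)
      fun y hy ↦ ⟨mem_univ _, hy⟩
  have hinv0 : (contractAdd ℓ (a (0, y₀))).IsInvertible := by
    refine isInvertible_contractAdd fun v hv ↦ ?_
    obtain ⟨h1, h2⟩ := ker_eq_zero_of_contractAdd hv
    obtain ⟨c, rfl⟩ := hespan v h2
    have : c = 0 := by simpa [hℓ] using h1
    rw [this, zero_smul]
  obtain ⟨e0, he0'⟩ := hinv0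
  -- Invertibility is imposed at `τ = 0` only. As the kernel of `a` does not depend on `τ`, it
  -- follows for every `τ`, so a single neighbourhood serves all times.
  set U : Set E := T ∩ (fun y ↦ contractAdd ℓ (a (0, y))) ⁻¹'
    range ((↑) : (E ≃L[ℝ] (E →L[ℝ] ℝ)) → E →L[ℝ] E →L[ℝ] ℝ) with hU
  have hinv : ∀ τ, ∀ y ∈ U, (contractAdd ℓ (a (τ, y))).IsInvertible := by
    rintro τ y ⟨hyT, e', he'⟩
    refine isInvertible_contractAdd fun v hv ↦ ?_
    obtain ⟨h1, h2⟩ := ker_eq_zero_of_contractAdd hv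
    have h3 := hker τ y hyT v h2
    have h4 : e' v = 0 := by
      change (e' : E →L[ℝ] E →L[ℝ] ℝ) v = 0
      rw [he']
      ext w
      rw [contractAdd_apply, h3 w, h1]
      simp
    simpa using h4
  refine ⟨fun a ↦ (contractAdd ℓ a).inverse, U,
    hA0.isOpen_inter_preimage hT ContinuousLinearEquiv.isOpen, ⟨hy₀, e0, he0'⟩,
    inter_subset_left, ?_, ?_⟩
  · rintro ⟨τ, y⟩ ⟨-, hy⟩
    obtain ⟨e', he'⟩ := hinv τ y hy
    have h := contDiffAt_map_inverse (𝕜 := ℝ) (n := ∞) e'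
    rw [he'] at h
    exact ContDiffAt.comp_contDiffWithinAt (f := fun p ↦ contractAdd ℓ (a p)) (τ, y) h
      ((hA (τ, y) ⟨mem_univ _, hy.1⟩).mono (prod_mono_right inter_subset_left))
  · intro τ y hy c hc w
    set u := (contractAdd ℓ (a (τ, y))).inverse c with hu
    have h1 : contractAdd ℓ (a (τ, y)) u = c := by
      obtain ⟨e', he'⟩ := hinv τ y hy
      rw [hu, ← he', ContinuousLinearMap.inverse_equiv]
      simp
    have h2 : ∀ w, a (τ, y) ![u, w] + ℓ u * ℓ w = c w := fun w ↦ by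
      rw [← contractAdd_apply, h1]
    obtain ⟨e1, he1, he1', -⟩ := hdim y hy.1
    have h3 : ℓ e1 ≠ 0 := by
      intro h
      apply he1
      obtain ⟨e', he'⟩ := hy.2
      have h4 : e' e1 = 0 := by
        change (e' : E →L[ℝ] E →L[ℝ] ℝ) e1 = 0
        rw [he']
        ext w
        rw [contractAdd_apply, he1' w, h]
        simp
      simpa using h4
    -- On a kernel vector `e1` both `a` and `c` vanish, which leaves `ℓ(u) ℓ(e1) = 0`. Hence `ℓ(u) =
    -- 0`, and `u` solves the uncorrected equation.
    have h5 := h2 e1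
    rw [hc e1 he1', ContinuousAlternatingMap.apply_pair_swap, hker' τ y hy.1 e1 he1' u, neg_zero,
      zero_add] at h5
    have h6 : ℓ u = 0 := (mul_eq_zero.1 h5).resolve_right h3
    simpa [h6] using h2 w

end LinearAlgebra

/-! ### Solving the contraction equation on a compact manifold -/

namespace Presymplectic

open Filter Topology

variable {d : ℕ} {M : Type*} [TopologicalSpace M] [ChartedSpace (EuclideanSpace ℝ (Fin d)) M]
  [IsManifold (𝓡 d) ∞ M] {k : ℕ}

local notation "𝔼" => EuclideanSpace ℝ (Fin d)

/-- The tangent vector at `x` with coordinates `u` in the preferred chart around `x₀`. -/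
def chartVector (x₀ x : M) (u : 𝔼) : TangentSpace (𝓡 d) x :=
  (mfderiv 𝓘(ℝ, 𝔼) (𝓡 d) (extChartAt (𝓡 d) x₀).symm (extChartAt (𝓡 d) x₀ x) u : 𝔼)

omit [IsManifold (𝓡 d) ∞ M] in
theorem chartVector_neg (x₀ x : M) (u : 𝔼) : chartVector x₀ x (-u) = -chartVector x₀ x u :=
  (mfderiv 𝓘(ℝ, 𝔼) (𝓡 d) (extChartAt (𝓡 d) x₀).symm (extChartAt (𝓡 d) x₀ x)).map_neg u

theorem mfderiv_chart_chartVector {x₀ x : M} (hx : x ∈ (extChartAt (𝓡 d) x₀).source) (u : 𝔼) :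
    mfderiv (𝓡 d) 𝓘(ℝ, 𝔼) (extChartAt (𝓡 d) x₀) x (chartVector x₀ x u) = u := by
  obtain ⟨y, hy, rfl⟩ : ∃ y ∈ (extChartAt (𝓡 d) x₀).target, (extChartAt (𝓡 d) x₀).symm y = x :=
    ⟨_, (extChartAt (𝓡 d) x₀).map_source hx, (extChartAt (𝓡 d) x₀).left_inv hx⟩
  have h := (extChartAt (𝓡 d) x₀).right_inv hy
  refine (congrArg (fun z ↦ mfderiv (𝓡 d) 𝓘(ℝ, 𝔼) (extChartAt (𝓡 d) x₀)
    ((extChartAt (𝓡 d) x₀).symm y)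
    (mfderiv 𝓘(ℝ, 𝔼) (𝓡 d) (extChartAt (𝓡 d) x₀).symm z u : 𝔼)) h).trans ?_
  exact mfderiv_chart_mfderiv_chart_symm hy u

theorem chartVector_mfderiv_chart {x₀ x : M} (hx : x ∈ (extChartAt (𝓡 d) x₀).source)
    (v : TangentSpace (𝓡 d) x) :
    chartVector x₀ x (mfderiv (𝓡 d) 𝓘(ℝ, 𝔼) (extChartAt (𝓡 d) x₀) x v) = v := by
  obtain ⟨y, hy, rfl⟩ : ∃ y ∈ (extChartAt (𝓡 d) x₀).target, (extChartAt (𝓡 d) x₀).symm y = x :=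
    ⟨_, (extChartAt (𝓡 d) x₀).map_source hx, (extChartAt (𝓡 d) x₀).left_inv hx⟩
  have h := (extChartAt (𝓡 d) x₀).right_inv hy
  refine (congrArg (fun z ↦ (mfderiv 𝓘(ℝ, 𝔼) (𝓡 d) (extChartAt (𝓡 d) x₀).symm z
    (mfderiv (𝓡 d) 𝓘(ℝ, 𝔼) (extChartAt (𝓡 d) x₀) ((extChartAt (𝓡 d) x₀).symm y) v : 𝔼) : 𝔼))
    h).trans ?_
  exact mfderiv_chart_symm_mfderiv_chart hy v

theorem Form.apply_chartVector (α : Form d M k) {x₀ x : M}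
    (hx : x ∈ (extChartAt (𝓡 d) x₀).source) (u : Fin k → 𝔼) :
    α x (fun i ↦ chartVector x₀ x (u i)) = α.inChart x₀ (extChartAt (𝓡 d) x₀ x) u := by
  rw [← α.inChart_mfderiv_chart hx]
  exact congrArg _ (funext fun i ↦ mfderiv_chart_chartVector hx (u i))

theorem Form.apply_chartVector_pair (α : Form d M 2) {x₀ x : M}
    (hx : x ∈ (extChartAt (𝓡 d) x₀).source) (u v : 𝔼) :
    α x ![chartVector x₀ x u, chartVector x₀ x v] =
      α.inChart x₀ (extChartAt (𝓡 d) x₀ x) ![u, v] := by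
  rw [← α.apply_chartVector hx]
  congr 1
  funext i
  fin_cases i <;> rfl

theorem Form.chartVector_mem_ker_iff (α : Form d M 2) {x₀ x : M}
    (hx : x ∈ (extChartAt (𝓡 d) x₀).source) (u : 𝔼) :
    chartVector x₀ x u ∈ α.ker x ↔ ∀ w, α.inChart x₀ (extChartAt (𝓡 d) x₀ x) ![u, w] = 0 := by
  constructor
  · intro h w
    rw [← α.apply_chartVector_pair hx]
    exact h _
  · intro h w
    rw [← chartVector_mfderiv_chart hx w]
    exact (α.apply_chartVector_pair hx u _).trans (h _)

/-- The vector field along the projection `ℝ × M → M` given in a chart by a smooth function. -/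
theorem contMDiffAt_chartVector {x₀ x : M} {τ : ℝ} (hx : x ∈ (extChartAt (𝓡 d) x₀).source)
    {u : ℝ × 𝔼 → 𝔼} (hu : ContDiffAt ℝ ∞ u (τ, extChartAt (𝓡 d) x₀ x)) :
    ContMDiffAt (𝓘(ℝ, ℝ).prod (𝓡 d)) (𝓡 d).tangent ∞ (fun p : ℝ × M ↦
      (⟨p.2, chartVector x₀ p.2 (u (p.1, extChartAt (𝓡 d) x₀ p.2))⟩ : TangentBundle (𝓡 d) M))
      (τ, x) := by
  have hx' : x ∈ (chartAt 𝔼 x₀).source := by rwa [extChartAt_source] at hx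
  have := isManifold_one (d := d) (M := M)
  have he : (⟨x, chartVector x₀ x (u (τ, extChartAt (𝓡 d) x₀ x))⟩ : TangentBundle (𝓡 d) M) ∈
      (trivializationAt 𝔼 (TangentSpace (𝓡 d) : M → Type _) x₀).source := by
    rw [Bundle.Trivialization.mem_source]
    exact hx'
  refine (Bundle.Trivialization.contMDiffAt_iff
    (e := trivializationAt 𝔼 (TangentSpace (𝓡 d) : M → Type _) x₀) (x₀ := (τ, x))
    (f := fun p : ℝ × M ↦
      (⟨p.2, chartVector x₀ p.2 (u (p.1, extChartAt (𝓡 d) x₀ p.2))⟩ : TangentBundle (𝓡 d) M)) he).2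
    ⟨contMDiffAt_snd, ?_⟩
  have h1 : ContMDiffAt (𝓘(ℝ, ℝ).prod (𝓡 d)) 𝓘(ℝ, ℝ × 𝔼) ∞
      (fun p : ℝ × M ↦ (p.1, extChartAt (𝓡 d) x₀ p.2)) (τ, x) := by
    refine contMDiffAt_fst.prodMk_space ?_
    exact ContMDiffAt.comp (g := extChartAt (𝓡 d) x₀) (f := fun p : ℝ × M ↦ p.2) (τ, x)
      (contMDiffAt_extChartAt' hx') contMDiffAt_snd
  have h2 : ContMDiffAt (𝓘(ℝ, ℝ).prod (𝓡 d)) 𝓘(ℝ, 𝔼) ∞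
      (fun p : ℝ × M ↦ u (p.1, extChartAt (𝓡 d) x₀ p.2)) (τ, x) :=
    ContMDiffAt.comp (g := u) (f := fun p : ℝ × M ↦ (p.1, extChartAt (𝓡 d) x₀ p.2)) (τ, x)
      hu.contMDiffAt h1
  refine h2.congr_of_eventuallyEq ?_
  filter_upwards [(continuousAt_snd (p := (τ, x))).eventually
    ((isOpen_extChartAt_source x₀).mem_nhds hx)] with p hp
  have hp' : p.2 ∈ (chartAt 𝔼 x₀).source := by rwa [extChartAt_source] at hp
  exact (trivializationAt_tangentSpace_snd hp' _).trans (mfderiv_chart_chartVector hp _)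

/-- A vector field along the projection `ℝ × M → M`, as a vector field on `ℝ × M`. -/
theorem contMDiffAt_tangentBundle_prod {N : Type*} [TopologicalSpace N] [ChartedSpace 𝔼 N]
    [IsManifold (𝓡 d) ∞ N] {p : ℝ × N} {c : ℝ → ℝ}
    {X : ℝ → (x : N) → TangentSpace (𝓡 d) x} (hc : ContDiff ℝ ∞ c)
    (hX : ContMDiffAt (𝓘(ℝ, ℝ).prod (𝓡 d)) (𝓡 d).tangent ∞
      (fun p : ℝ × N ↦ (⟨p.2, X p.1 p.2⟩ : TangentBundle (𝓡 d) N)) p) :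
    ContMDiffAt (𝓘(ℝ, ℝ).prod (𝓡 d)) (𝓘(ℝ, ℝ).prod (𝓡 d)).tangent ∞
      (fun p : ℝ × N ↦ (⟨p, (c p.1, X p.1 p.2)⟩ :
        TangentBundle (𝓘(ℝ, ℝ).prod (𝓡 d)) (ℝ × N))) p := by
  have := isManifold_one (d := d) (M := N)
  have h1 : ContMDiff 𝓘(ℝ, ℝ) 𝓘(ℝ, ℝ).tangent ∞
      (fun t : ℝ ↦ (⟨t, c t⟩ : TangentBundle 𝓘(ℝ, ℝ) ℝ)) := by
    refine fun t ↦ (Bundle.contMDiffAt_section _).2 ?_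
    simpa using hc.contMDiff.contMDiffAt
  have h2 : ContMDiffAt (𝓘(ℝ, ℝ).prod (𝓡 d)) 𝓘(ℝ, ℝ).tangent ∞
      (fun p : ℝ × N ↦ (⟨p.1, c p.1⟩ : TangentBundle 𝓘(ℝ, ℝ) ℝ)) p :=
    ContMDiffAt.comp (g := fun t : ℝ ↦ (⟨t, c t⟩ : TangentBundle 𝓘(ℝ, ℝ) ℝ))
      (f := fun p : ℝ × N ↦ p.1) p (h1 _) contMDiffAt_fst
  exact ContMDiffAt.comp (g := (equivTangentBundleProd 𝓘(ℝ, ℝ) ℝ (𝓡 d) N).symm)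
    (f := fun p : ℝ × N ↦ ((⟨p.1, c p.1⟩ : TangentBundle 𝓘(ℝ, ℝ) ℝ),
      (⟨p.2, X p.1 p.2⟩ : TangentBundle (𝓡 d) N))) p
    (contMDiff_equivTangentBundleProd_symm _) (h2.prodMk hX)

/-- Local solution of `ι_X η = -γ`, depending only on the values of `η` and `γ`. -/
theorem exists_local_solution_contract {η : ℝ → Form d M 2} (hη : IsSmoothFamily η)
    {γ : ℝ → Form d M 1} (hγ : IsSmoothFamily γ)
    (hker : ∀ τ x, (η τ).ker x = (η 0).ker x)
    (hdim : ∀ x, Module.finrank ℝ ((η 0).ker x) = 1)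
    (hγker : ∀ τ x, ∀ v ∈ (η 0).ker x, γ τ x (fun _ ↦ v) = 0) (x₀ : M) :
    ∃ (R : Form d M 2 → Form d M 1 → (x : M) → TangentSpace (𝓡 d) x) (U : Set M),
      IsOpen U ∧ x₀ ∈ U ∧ (∀ a c x, R a (-c) x = -R a c x) ∧
      (∀ τ, ∀ x ∈ U, ContMDiffAt (𝓘(ℝ, ℝ).prod (𝓡 d)) (𝓡 d).tangent ∞ (fun p : ℝ × M ↦
        (⟨p.2, R (η p.1) (γ p.1) p.2⟩ : TangentBundle (𝓡 d) M)) (τ, x)) ∧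
      ∀ τ, ∀ x ∈ U, ∀ w, η τ x ![R (η τ) (γ τ) x, w] = -γ τ x (fun _ ↦ w) := by
  have hTo := isOpen_extChartAt_target (I := 𝓡 d) x₀
  have hmem : ∀ y ∈ (extChartAt (𝓡 d) x₀).target, ∀ τ v,
      chartVector x₀ ((extChartAt (𝓡 d) x₀).symm y) v ∈
        (η τ).ker ((extChartAt (𝓡 d) x₀).symm y) ↔ ∀ w, (η τ).inChart x₀ y ![v, w] = 0 := by
    intro y hy τ v
    rw [(η τ).chartVector_mem_ker_iff ((extChartAt (𝓡 d) x₀).map_target hy),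
      (extChartAt (𝓡 d) x₀).right_inv hy]
  obtain ⟨S, U, hU, hxU, hUT, hS, hS'⟩ := exists_smooth_solution_contract hTo (hη x₀)
    (fun τ y hy v h ↦ by
      rw [← hmem y hy] at h ⊢
      rwa [hker] at h)
    (fun τ y hy v h ↦ by
      rw [← hmem y hy] at h ⊢
      rwa [hker])
    (fun y hy ↦ by
      obtain ⟨⟨e, he⟩, he0, hspan⟩ := finrank_eq_one_iff'.1 (hdim ((extChartAt (𝓡 d) x₀).symm y))
      have hys := (extChartAt (𝓡 d) x₀).map_target hy
      refine ⟨mfderiv (𝓡 d) 𝓘(ℝ, 𝔼) (extChartAt (𝓡 d) x₀) ((extChartAt (𝓡 d) x₀).symm y) e,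
        ?_, ?_, ?_⟩
      · intro h0
        apply he0
        have h1 := chartVector_mfderiv_chart hys e
        rw [h0] at h1
        refine Subtype.ext (h1.symm.trans ?_)
        exact (mfderiv 𝓘(ℝ, 𝔼) (𝓡 d) (extChartAt (𝓡 d) x₀).symm _).map_zero
      · refine (hmem y hy 0 _).1 ?_
        rw [chartVector_mfderiv_chart hys]
        exact he
      · intro v hv
        obtain ⟨c, hc⟩ := hspan ⟨_, (hmem y hy 0 v).2 hv⟩
        refine ⟨c, ?_⟩
        have h1 : c • e = chartVector x₀ ((extChartAt (𝓡 d) x₀).symm y) v := congrArg Subtype.val hc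
        rw [← mfderiv_chart_chartVector hys v, ← h1]
        exact ((mfderiv (𝓡 d) 𝓘(ℝ, 𝔼) (extChartAt (𝓡 d) x₀) _).map_smul c e).symm)
    ((extChartAt (𝓡 d) x₀).map_source (mem_extChartAt_source x₀))
  let L := (ContinuousAlternatingMap.ofSubsingletonLIE (𝕜 := ℝ) (E := 𝔼) (F := ℝ)
    (0 : Fin 1)).symm
  have hL : ∀ f w, L f w = f (fun _ ↦ w) := fun f w ↦ rfl
  -- The solution operator takes the two forms as arguments and does not see `τ`; it is linear in
  -- the 1-form. A time reflection that fixes `η` and negates `γ` will therefore negate the vector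
  -- field.
  refine ⟨fun a c x ↦ chartVector x₀ x (S (a.inChart x₀ (extChartAt (𝓡 d) x₀ x))
    (-L (c.inChart x₀ (extChartAt (𝓡 d) x₀ x)))),
    (extChartAt (𝓡 d) x₀).source ∩ extChartAt (𝓡 d) x₀ ⁻¹' U,
    (continuousOn_extChartAt x₀).isOpen_inter_preimage (isOpen_extChartAt_source x₀) hU,
    ⟨mem_extChartAt_source x₀, hxU⟩, ?_, ?_, ?_⟩
  · intro a c x
    rw [← chartVector_neg, ← map_neg]
    congr 2
  · rintro τ x ⟨hx, hxU⟩
    refine contMDiffAt_chartVector (u := fun p : ℝ × 𝔼 ↦ S ((η p.1).inChart x₀ p.2)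
      (-L ((γ p.1).inChart x₀ p.2))) hx ?_
    refine (hS.contDiffAt (x := (τ, extChartAt (𝓡 d) x₀ x)) ((isOpen_univ.prod hU).mem_nhds ⟨mem_univ _, hxU⟩)).clm_apply ?_
    exact (L.toContinuousLinearEquiv.contDiff.contDiffAt.comp _ (hγ.contDiffAt (hUT hxU))).neg
  · rintro τ x ⟨hx, hxU⟩ w
    rw [← chartVector_mfderiv_chart hx w]
    refine ((η τ).apply_chartVector_pair hx _ _).trans ((hS' τ _ hxU _ ?_ _).trans ?_)
    · intro v hv
      have h1 : L ((γ τ).inChart x₀ (extChartAt (𝓡 d) x₀ x)) v = 0 := by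
        rw [hL, ← (γ τ).apply_chartVector hx]
        exact hγker τ x _ (((η 0).chartVector_mem_ker_iff hx v).2 hv)
      change -(L ((γ τ).inChart x₀ (extChartAt (𝓡 d) x₀ x)) v) = 0
      rw [h1, neg_zero]
    · exact congrArg Neg.neg ((γ τ).apply_chartVector hx _).symm

/-- On a compact manifold, the equation `ι_X η = -γ` has a smooth solution, which can be chosen to
depend on the parameter only through the values of `η` and `γ`. -/
theorem exists_solution_contract [CompactSpace M] [T2Space M] {η : ℝ → Form d M 2}
    (hη : IsSmoothFamily η) {γ : ℝ → Form d M 1} (hγ : IsSmoothFamily γ)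
    (hker : ∀ τ x, (η τ).ker x = (η 0).ker x)
    (hdim : ∀ x, Module.finrank ℝ ((η 0).ker x) = 1)
    (hγker : ∀ τ x, ∀ v ∈ (η 0).ker x, γ τ x (fun _ ↦ v) = 0) :
    ∃ X : ℝ → (x : M) → TangentSpace (𝓡 d) x,
      ContMDiff (𝓘(ℝ, ℝ).prod (𝓡 d)) (𝓘(ℝ, ℝ).prod (𝓡 d)).tangent ∞
        (fun p : ℝ × M ↦ (⟨p, ((0 : ℝ), X p.1 p.2)⟩ :
          TangentBundle (𝓘(ℝ, ℝ).prod (𝓡 d)) (ℝ × M))) ∧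
      (∀ τ x w, η τ x ![X τ x, w] = -γ τ x (fun _ ↦ w)) ∧
      ∀ τ₁ τ₂, η τ₁ = η τ₂ → γ τ₁ = -γ τ₂ → X τ₁ = -X τ₂ := by
  choose R U hU hxU hneg hsmooth hR using
    exists_local_solution_contract hη hγ hker hdim hγker
  obtain ⟨t, -, ht⟩ := isCompact_univ.elim_nhds_subcover U fun x _ ↦ (hU x).mem_nhds (hxU x)
  obtain ⟨ρ, hρ⟩ := SmoothPartitionOfUnity.exists_isSubordinate (𝓡 d) isClosed_univ
    (fun i : t ↦ U i) (fun i ↦ hU i) (by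
      intro x hx
      obtain ⟨i, hi, hxi⟩ := mem_iUnion₂.1 (ht hx)
      exact mem_iUnion.2 ⟨⟨i, hi⟩, hxi⟩)
  -- The equation is affine in `X`, so local solutions may be averaged with weights that sum to one.
  -- The weights do not depend on `τ`, which preserves the symmetry.
  refine ⟨fun τ x ↦ ∑ i : t, ρ i x • R i (η τ) (γ τ) x, ?_, ?_, ?_⟩
  · have h1 : ∀ i : t, ContMDiff (𝓘(ℝ, ℝ).prod (𝓡 d)) (𝓘(ℝ, ℝ).prod (𝓡 d)).tangent ∞
        (fun p : ℝ × M ↦ (⟨p, ρ i p.2 • ((0 : ℝ), R i (η p.1) (γ p.1) p.2)⟩ :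
          TangentBundle (𝓘(ℝ, ℝ).prod (𝓡 d)) (ℝ × M))) := by
      intro i
      have := isManifold_one (d := d) (M := M)
      refine ContMDiffOn.smul_section_of_tsupport (u := univ ×ˢ U i)
        (V := (TangentSpace (𝓘(ℝ, ℝ).prod (𝓡 d)) : ℝ × M → Type _))
        (ψ := fun p : ℝ × M ↦ ρ i p.2) ?_ (isOpen_univ.prod (hU i)) ?_ ?_
      · exact (ContMDiff.comp (g := ρ i) (f := fun p : ℝ × M ↦ p.2) (ρ i).contMDiff
          contMDiff_snd).contMDiffOn
      · have h2 := tsupport_comp_subset_preimage (ρ i) (f := fun p : ℝ × M ↦ p.2) continuous_snd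
        exact fun p hp ↦ ⟨mem_univ _, hρ i (h2 hp)⟩
      · rintro ⟨τ, x⟩ ⟨-, hx⟩
        exact (contMDiffAt_tangentBundle_prod (c := fun _ ↦ 0) (N := M) (p := (τ, x))
          (X := fun τ x ↦ R i (η τ) (γ τ) x) contDiff_const (hsmooth i τ x hx)).contMDiffWithinAt
    have h3 := ContMDiff.sum_section (s := Finset.univ)
      (V := (TangentSpace (𝓘(ℝ, ℝ).prod (𝓡 d)) : ℝ × M → Type _))
      (t := fun i p ↦ ρ i p.2 • ((0 : ℝ), R i (η p.1) (γ p.1) p.2)) fun i _ ↦ h1 i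
    refine h3.congr fun p ↦ ?_
    congr 1
    refine Prod.ext ?_ ?_
    · refine Eq.trans ?_ (map_sum (LinearMap.fst ℝ ℝ 𝔼)
        (fun i : t ↦ ρ i p.2 • ((0 : ℝ), (R i (η p.1) (γ p.1) p.2 : 𝔼))) Finset.univ).symm
      exact (Finset.sum_eq_zero fun i _ ↦ mul_zero _).symm
    · exact (map_sum (LinearMap.snd ℝ ℝ 𝔼)
        (fun i : t ↦ ρ i p.2 • ((0 : ℝ), (R i (η p.1) (γ p.1) p.2 : 𝔼))) Finset.univ).symm
  · intro τ x w
    let L : TangentSpace (𝓡 d) x →ₗ[ℝ] ℝ :=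
      { toFun := fun v ↦ η τ x ![v, w]
        map_add' := fun a b ↦ (η τ x).toMultilinearMap.cons_add ![w] a b
        map_smul' := fun c a ↦ (η τ x).toMultilinearMap.cons_smul ![w] c a }
    change L (∑ i : t, ρ i x • R i (η τ) (γ τ) x) = _
    rw [map_sum]
    have h1 : ∀ i : t, L (ρ i x • R i (η τ) (γ τ) x) = ρ i x * -γ τ x (fun _ ↦ w) := by
      intro i
      rw [map_smul, smul_eq_mul]
      by_cases hx : x ∈ U i
      · congr 1
        exact hR i τ x hx w
      · have : ρ i x = 0 := by
          by_contra h
          exact hx (hρ i (subset_tsupport _ h))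
        rw [this, zero_mul, zero_mul]
    rw [Finset.sum_congr rfl fun i _ ↦ h1 i, ← Finset.sum_mul, ← finsum_eq_sum_of_fintype,
      ρ.sum_eq_one (mem_univ x), one_mul]
  · intro τ₁ τ₂ h1 h2
    funext x
    rw [Pi.neg_apply, ← Finset.sum_neg_distrib]
    refine Finset.sum_congr rfl fun i _ ↦ ?_
    rw [h1, h2, hneg, smul_neg]

/-- The derivative of a smooth family of forms with respect to the parameter. -/
theorem IsSmoothFamily.exists_hasDerivAt {β : ℝ → Form d M k} (hβ : IsSmoothFamily β) :
    ∃ γ : ℝ → Form d M k, IsSmoothFamily γ ∧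
      ∀ τ x v, HasDerivAt (fun s ↦ β s x v) (γ τ x v) τ := by
  have hd : ∀ {x₀ : M} {y : 𝔼} (_ : y ∈ (extChartAt (𝓡 d) x₀).target) (τ : ℝ),
      HasDerivAt (fun s ↦ (β s).inChart x₀ y)
        (fderiv ℝ (fun p : ℝ × 𝔼 ↦ (β p.1).inChart x₀ p.2) (τ, y) (1, 0)) τ := by
    intro x₀ y hy τ
    have h := ((hβ.contDiffAt hy).differentiableAt (by simp) (x := (τ, y))).hasFDerivAt
    exact h.comp_hasDerivAt (f := fun s : ℝ ↦ (s, y)) τ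
      ((hasDerivAt_id τ).prodMk (hasDerivAt_const τ y))
  have hd' : ∀ {x₀ : M} {y : 𝔼} (_ : y ∈ (extChartAt (𝓡 d) x₀).target) (τ : ℝ) (v : Fin k → 𝔼),
      HasDerivAt (fun s ↦ (β s).inChart x₀ y v)
        (fderiv ℝ (fun p : ℝ × 𝔼 ↦ (β p.1).inChart x₀ p.2) (τ, y) (1, 0) v) τ :=
    fun hy τ v ↦ (ContinuousAlternatingMap.apply ℝ 𝔼 ℝ v).hasFDerivAt.comp_hasDerivAt τ (hd hy τ)
  let γ : ℝ → Form d M k := fun τ x ↦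
    (fderiv ℝ (fun p : ℝ × 𝔼 ↦ (β p.1).inChart x p.2) (τ, extChartAt (𝓡 d) x x)
      (1, 0)).compContinuousLinearMap
      (mfderiv (𝓡 d) 𝓘(ℝ, 𝔼) (extChartAt (𝓡 d) x) x : TangentSpace (𝓡 d) x →L[ℝ] 𝔼)
  have hγ : ∀ τ x v, HasDerivAt (fun s ↦ β s x v) (γ τ x v) τ := by
    intro τ x v
    have hx := mem_extChartAt_source (I := 𝓡 d) x
    refine (hd' ((extChartAt (𝓡 d) x).map_source hx) τ _).congr_of_eventuallyEq
      (Eventually.of_forall fun s ↦ ?_)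
    exact ((β s).inChart_mfderiv_chart hx v).symm
  refine ⟨γ, fun x₀ ↦ ?_, hγ⟩
  have h1 : ContDiffOn ℝ ∞ (fun p : ℝ × 𝔼 ↦
      fderiv ℝ (fun p : ℝ × 𝔼 ↦ (β p.1).inChart x₀ p.2) p (1, 0))
      (univ ×ˢ (extChartAt (𝓡 d) x₀).target) :=
    ((hβ x₀).fderiv_of_isOpen (isOpen_univ.prod (isOpen_extChartAt_target x₀))
      (by simp)).clm_apply contDiffOn_const
  refine h1.congr ?_
  rintro ⟨τ, y⟩ ⟨-, hy⟩
  ext v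
  -- Each value of `γ` was computed in the chart centred at its own point. In the chart at `x₀` both
  -- expressions are derivatives of the same real function, so uniqueness of derivatives replaces a
  -- transformation rule.
  exact (hγ τ _ _).unique (hd' hy τ v)

end Presymplectic

/-! ### Moser's computation in a vector space -/

section Euclidean

open Filter Topology

variable {V : Type*} [NormedAddCommGroup V] [NormedSpace ℝ V]

theorem extDeriv_one_form_apply {B : V → V [⋀^Fin 1]→L[ℝ] ℝ} {p : V} (hB : DifferentiableAt ℝ B p)
    (u v : V) : extDeriv B p ![u, v] = fderiv ℝ B p u (fun _ ↦ v) - fderiv ℝ B p v (fun _ ↦ u) := by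
  have h1 : ∀ w : Fin 1 → V, fderiv ℝ (fun x ↦ B x w) p =
      (ContinuousAlternatingMap.apply ℝ V ℝ w).comp (fderiv ℝ B p) := fun w ↦
    ((ContinuousAlternatingMap.apply ℝ V ℝ w).hasFDerivAt.comp p hB.hasFDerivAt).fderiv
  have h2 : (0 : Fin 2).removeNth ![u, v] = fun _ ↦ v := by
    funext i; fin_cases i; rfl
  have h3 : (1 : Fin 2).removeNth ![u, v] = fun _ ↦ u := by
    funext i; fin_cases i; rfl
  rw [extDeriv_apply hB, Fin.sum_univ_two, h2, h3, h1, h1]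
  simp [sub_eq_add_neg]

theorem ContDiffAt.extDeriv {k : ℕ} {B : V → V [⋀^Fin k]→L[ℝ] ℝ} {p : V}
    (hB : ContDiffAt ℝ ∞ B p) : ContDiffAt ℝ ∞ (extDeriv B) p :=
  (ContinuousAlternatingMap.alternatizeUncurryFinCLM ℝ V ℝ).contDiff.contDiffAt.comp p
    (hB.fderiv_right (by simp))

/-- Moser's computation in a vector space: the pullback of `A₀ + d B_τ` under maps `G_τ` whose
velocity contracts it to `-∂_τ B_τ` is constant in `τ`. -/
theorem hasDerivAt_pullback_zero {A₀ : V → V [⋀^Fin 2]→L[ℝ] ℝ} {B : ℝ × V → V [⋀^Fin 1]→L[ℝ] ℝ}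
    {G : ℝ × V → V} {τ₀ : ℝ} {y₀ : V} (hG : ContDiffAt ℝ ∞ G (τ₀, y₀))
    (hB : ContDiffAt ℝ ∞ B (τ₀, G (τ₀, y₀))) (hA : ContDiffAt ℝ ∞ A₀ (G (τ₀, y₀)))
    (hA0 : extDeriv A₀ (G (τ₀, y₀)) = 0)
    (h : ∀ᶠ p in 𝓝 (τ₀, y₀), ∀ w,
      (A₀ (G p) + extDeriv (fun z ↦ B (p.1, z)) (G p)) ![fderiv ℝ G p (1, 0), w] =
        -fderiv ℝ B (p.1, G p) (1, 0) (fun _ ↦ w)) (v w : V) :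
    HasDerivAt (fun τ ↦ (A₀ (G (τ, y₀)) + extDeriv (fun z ↦ B (τ, z)) (G (τ, y₀)))
      ![fderiv ℝ (fun y ↦ G (τ, y)) y₀ v, fderiv ℝ (fun y ↦ G (τ, y)) y₀ w]) 0 τ₀ := by
  let π₂ : ℝ × V →L[ℝ] V := ContinuousLinearMap.snd ℝ ℝ V
  let κ₁ : (V [⋀^Fin 1]→L[ℝ] ℝ) →L[ℝ] (ℝ × V) [⋀^Fin 1]→L[ℝ] ℝ :=
    ContinuousAlternatingMap.compContinuousLinearMapCLM π₂
  let κ₂ : (V [⋀^Fin 2]→L[ℝ] ℝ) →L[ℝ] (ℝ × V) [⋀^Fin 2]→L[ℝ] ℝ :=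
    ContinuousAlternatingMap.compContinuousLinearMapCLM π₂
  -- The family `B_τ` becomes a single 1-form `Bt` on `ℝ × V` without `dτ` component; its exterior
  -- derivative is the fibrewise one plus `dτ ∧ ∂_τ B`. The closed form `Ω = A₀ + d Bt` is pulled
  -- back to `P` by `F (τ, y) = (τ, G (τ, y))`, and the velocity hypothesis says that `P (∂_τ, w) =
  -- 0` for vertical `w`.
  let Bt : ℝ × V → (ℝ × V) [⋀^Fin 1]→L[ℝ] ℝ := fun p ↦ (B p).compContinuousLinearMap π₂
  let At : ℝ × V → (ℝ × V) [⋀^Fin 2]→L[ℝ] ℝ := fun p ↦ (A₀ p.2).compContinuousLinearMap π₂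
  let Ω : ℝ × V → (ℝ × V) [⋀^Fin 2]→L[ℝ] ℝ := At + extDeriv Bt
  let F : ℝ × V → ℝ × V := fun p ↦ (p.1, G p)
  let P : ℝ × V → (ℝ × V) [⋀^Fin 2]→L[ℝ] ℝ :=
    fun p ↦ (Ω (F p)).compContinuousLinearMap (fderiv ℝ F p)
  set p₀ : ℝ × V := (τ₀, y₀)
  have hF : ContDiffAt ℝ ∞ F p₀ := contDiffAt_fst.prodMk hG
  have hBt : ContDiffAt ℝ ∞ Bt (F p₀) :=
    κ₁.contDiff.contDiffAt.comp (F p₀) hB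
  have hAt : ContDiffAt ℝ ∞ At (F p₀) :=
    κ₂.contDiff.contDiffAt.comp (F p₀)
      (ContDiffAt.comp (F p₀) (g := A₀) (f := fun p : ℝ × V ↦ p.2) hA contDiffAt_snd)
  have hΩ : ContDiffAt ℝ ∞ Ω (F p₀) := hAt.add hBt.extDeriv
  have hΩd : DifferentiableAt ℝ Ω (F p₀) := hΩ.differentiableAt (by simp)
  -- `Ω` is closed
  have hΩ0 : extDeriv Ω (F p₀) = 0 := by
    have h1 : extDeriv At (F p₀) = 0 := by
      have h2 : At = fun p : ℝ × V ↦ (A₀ (π₂ p)).compContinuousLinearMap (fderiv ℝ π₂ p) := by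
        funext p
        rw [π₂.fderiv]
        rfl
      rw [h2, extDeriv_pullback (r := ∞) (f := π₂) (x := F p₀) (hA.differentiableAt (by simp))
        π₂.contDiff.contDiffAt (by simpa using two_le_smooth)]
      change (extDeriv A₀ (G p₀)).compContinuousLinearMap _ = 0
      rw [hA0]
      rfl
    rw [extDeriv_add (hAt.differentiableAt (by simp)) (hBt.extDeriv.differentiableAt (by simp)), h1,
      extDeriv_extDeriv_apply hBt (by simpa using two_le_smooth), add_zero]
  have hP0 : extDeriv P p₀ = 0 := by
    rw [extDeriv_pullback (r := ∞) hΩd hF (by simpa using two_le_smooth), hΩ0]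
    rfl
  -- the values of `Ω`
  have hBev : ∀ᶠ p in 𝓝 p₀, DifferentiableAt ℝ B (F p) := by
    refine hF.continuousAt.eventually (p := fun q ↦ DifferentiableAt ℝ B q) ?_
    filter_upwards [(hB.of_le (m := 1) (by simp)).eventually (by simp)] with q hq
    exact hq.differentiableAt (by simp)
  have hΩval : ∀ p, DifferentiableAt ℝ B (F p) → ∀ q r : ℝ × V, Ω (F p) ![q, r] =
      (A₀ (G p) + extDeriv (fun z ↦ B (p.1, z)) (G p)) ![q.2, r.2] +
        (q.1 * fderiv ℝ B (p.1, G p) (1, 0) (fun _ ↦ r.2) -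
          r.1 * fderiv ℝ B (p.1, G p) (1, 0) (fun _ ↦ q.2)) := by
    intro p hp q r
    have h1 : HasFDerivAt Bt (κ₁.comp (fderiv ℝ B (F p))) (F p) :=
      κ₁.hasFDerivAt.comp (F p) hp.hasFDerivAt
    have h2 : HasFDerivAt (fun z ↦ B (p.1, z)) ((fderiv ℝ B (F p)).comp
        (ContinuousLinearMap.inr ℝ ℝ V)) (G p) :=
      HasFDerivAt.comp (G p) (f := fun z ↦ (p.1, z)) (g := B) hp.hasFDerivAt
        (hasFDerivAt_prodMk_right p.1 (G p))
    have h3 : ∀ q : ℝ × V, fderiv ℝ B (F p) q =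
        q.1 • fderiv ℝ B (F p) (1, 0) + fderiv ℝ B (F p) (0, q.2) := by
      intro q
      rw [← map_smul, ← map_add]
      simp
    have h4 : At (F p) ![q, r] = A₀ (G p) ![q.2, r.2] := by
      change A₀ (G p) (fun i ↦ π₂ (![q, r] i)) = _
      congr 1
      funext i; fin_cases i <;> rfl
    have h5 : ∀ q r : ℝ × V, fderiv ℝ Bt (F p) q (fun _ ↦ r) =
        q.1 * fderiv ℝ B (F p) (1, 0) (fun _ ↦ r.2) + fderiv ℝ B (F p) (0, q.2) (fun _ ↦ r.2) := by
      intro q r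
      rw [h1.fderiv]
      change fderiv ℝ B (F p) q (fun _ ↦ r.2) = _
      rw [h3 q]
      rfl
    have h6 : ∀ a b : V, fderiv ℝ (fun z ↦ B (p.1, z)) (G p) a (fun _ ↦ b) =
        fderiv ℝ B (F p) (0, a) (fun _ ↦ b) := by
      intro a b
      rw [h2.fderiv]
      rfl
    change At (F p) ![q, r] + extDeriv Bt (F p) ![q, r] = (A₀ (G p) ![q.2, r.2] +
      extDeriv (fun z ↦ B (p.1, z)) (G p) ![q.2, r.2]) +
        (q.1 * fderiv ℝ B (F p) (1, 0) (fun _ ↦ r.2) -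
          r.1 * fderiv ℝ B (F p) (1, 0) (fun _ ↦ q.2))
    rw [extDeriv_one_form_apply h1.differentiableAt, extDeriv_one_form_apply h2.differentiableAt,
      h4, h5, h5, h6, h6]
    ring
  have hGev : ∀ᶠ p in 𝓝 p₀, DifferentiableAt ℝ G p := by
    filter_upwards [(hG.of_le (m := 1) (by simp)).eventually (by simp)] with q hq
    exact hq.differentiableAt (by simp)
  have hDF : ∀ p, DifferentiableAt ℝ G p → ∀ q, fderiv ℝ F p q = (q.1, fderiv ℝ G p q) := by
    intro p hp q
    rw [(hasFDerivAt_fst.prodMk hp.hasFDerivAt).fderiv]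
    rfl
  have hPval : ∀ p q r, P p ![q, r] = Ω (F p) ![fderiv ℝ F p q, fderiv ℝ F p r] := by
    intro p q r
    change Ω (F p) (fun i ↦ fderiv ℝ F p (![q, r] i)) = _
    congr 1
    funext i; fin_cases i <;> rfl
  -- contraction with the first coordinate vanishes
  have hPι : ∀ w : V, (fun p ↦ P p ![((1 : ℝ), (0 : V)), (0, w)]) =ᶠ[𝓝 p₀] fun _ ↦ 0 := by
    intro w
    filter_upwards [h, hBev, hGev] with p h1 h2 h3
    rw [hPval, hΩval p h2, hDF p h3, hDF p h3, h1]
    ring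
  -- values on vertical vectors
  have hPv : ∀ᶠ τ in 𝓝 τ₀, P (τ, y₀) ![((0 : ℝ), v), (0, w)] =
      (A₀ (G (τ, y₀)) + extDeriv (fun z ↦ B (τ, z)) (G (τ, y₀)))
      ![fderiv ℝ (fun y ↦ G (τ, y)) y₀ v, fderiv ℝ (fun y ↦ G (τ, y)) y₀ w] := by
    have hc : Tendsto (fun τ : ℝ ↦ (τ, y₀)) (𝓝 τ₀) (𝓝 p₀) :=
      (Continuous.prodMk_left y₀).tendsto τ₀
    filter_upwards [hc.eventually hBev, hc.eventually hGev] with τ h2 h3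
    have h4 : fderiv ℝ (fun y ↦ G (τ, y)) y₀ =
        (fderiv ℝ G (τ, y₀)).comp (ContinuousLinearMap.inr ℝ ℝ V) :=
      (HasFDerivAt.comp y₀ (f := fun z ↦ (τ, z)) (g := G) h3.hasFDerivAt
        (hasFDerivAt_prodMk_right τ y₀)).fderiv
    rw [hPval, hΩval _ h2, hDF _ h3, hDF _ h3, h4]
    simp
  have hPd : DifferentiableAt ℝ P p₀ := by
    have h1 : ContDiffAt ℝ ∞ (fun p ↦ Ω (F p)) p₀ := ContDiffAt.comp p₀ hΩ hF
    exact ((h1.differentiableAt (by simp)).hasFDerivAt.continuousAlternatingMapCompContinuousLinearMap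
      ((hF.fderiv_right (m := ∞) (by simp)).differentiableAt (by simp)).hasFDerivAt).differentiableAt
  have hfd : ∀ q r : ℝ × V, HasFDerivAt (fun p ↦ P p ![q, r])
      ((ContinuousAlternatingMap.apply ℝ (ℝ × V) ℝ ![q, r]).comp (fderiv ℝ P p₀)) p₀ := fun q r ↦
    (ContinuousAlternatingMap.apply ℝ (ℝ × V) ℝ ![q, r]).hasFDerivAt.comp p₀ hPd.hasFDerivAt
  -- Evaluate `dP = 0` on `(∂_τ, v, w)` with constant vectors. Two of the three terms differentiate
  -- `P (∂_τ, ·)`, which vanishes near `p₀`; the remaining one is `∂_τ P (v, w)`.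
  have h0 := extDeriv_apply hPd ![((1 : ℝ), (0 : V)), (0, v), (0, w)]
  have r0 : (0 : Fin 3).removeNth ![((1 : ℝ), (0 : V)), (0, v), (0, w)] = ![(0, v), (0, w)] := by
    funext i; fin_cases i <;> rfl
  have r1 : (1 : Fin 3).removeNth ![((1 : ℝ), (0 : V)), (0, v), (0, w)] = ![(1, 0), (0, w)] := by
    funext i; fin_cases i <;> rfl
  have r2 : (2 : Fin 3).removeNth ![((1 : ℝ), (0 : V)), (0, v), (0, w)] = ![(1, 0), (0, v)] := by
    funext i; fin_cases i <;> rfl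
  rw [hP0, Fin.sum_univ_three, r0, r1, r2, (hPι w).fderiv_eq, (hPι v).fderiv_eq] at h0
  have h1 : fderiv ℝ (fun p ↦ P p ![((0 : ℝ), v), (0, w)]) p₀ (1, 0) = 0 := by
    simpa using h0.symm
  have h2 : HasDerivAt (fun τ ↦ P (τ, y₀) ![((0 : ℝ), v), (0, w)]) 0 τ₀ := by
    have h3 := HasFDerivAt.comp_hasDerivAt (f := fun τ : ℝ ↦ (τ, y₀)) τ₀
      (hfd (0, v) (0, w)).differentiableAt.hasFDerivAt
      ((hasDerivAt_id τ₀).prodMk (hasDerivAt_const τ₀ y₀))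
    rwa [h1] at h3
  exact h2.congr_of_eventuallyEq (hPv.mono fun τ hτ ↦ hτ.symm)

end Euclidean

/-! ### Moser's computation on a manifold -/

namespace Presymplectic

open Filter Topology

variable {d : ℕ} {M : Type*} [TopologicalSpace M] [ChartedSpace (EuclideanSpace ℝ (Fin d)) M]
  [IsManifold (𝓡 d) ∞ M] {k : ℕ}

local notation "𝔼" => EuclideanSpace ℝ (Fin d)

omit [IsManifold (𝓡 d) ∞ M] in
theorem IsSmoothFamily.isSmooth {α : ℝ → Form d M k} (hα : IsSmoothFamily α) (τ : ℝ) :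
    (α τ).IsSmooth := fun x₀ ↦
  (hα x₀).comp (f := fun y : 𝔼 ↦ (τ, y)) (contDiff_const.prodMk contDiff_id).contDiffOn
    fun _ hy ↦ ⟨mem_univ _, hy⟩

theorem chart_velocity {Ψ : ℝ → M → M} {z₀ q : M} {τ : ℝ} {X : TangentSpace (𝓡 d) (Ψ τ q)}
    (hvel : HasMFDerivAt 𝓘(ℝ, ℝ) (𝓡 d) (fun t ↦ Ψ t q) τ ((1 : ℝ →L[ℝ] ℝ).smulRight X))
    (hq : Ψ τ q ∈ (extChartAt (𝓡 d) z₀).source) :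
    HasDerivAt (fun t ↦ extChartAt (𝓡 d) z₀ (Ψ t q))
      (mfderiv (𝓡 d) 𝓘(ℝ, 𝔼) (extChartAt (𝓡 d) z₀) (Ψ τ q) X : 𝔼) τ := by
  have h1 := HasMFDerivAt.comp (g := extChartAt (𝓡 d) z₀) (f := fun t ↦ Ψ t q) τ
    (mdifferentiableAt_chart hq).hasMFDerivAt hvel
  let D : 𝔼 →L[ℝ] 𝔼 := mfderiv (𝓡 d) 𝓘(ℝ, 𝔼) (extChartAt (𝓡 d) z₀) (Ψ τ q)
  let X' : 𝔼 := X
  have h2 : HasFDerivAt (fun t ↦ extChartAt (𝓡 d) z₀ (Ψ t q))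
      (D.comp ((1 : ℝ →L[ℝ] ℝ).smulRight X')) τ := hasMFDerivAt_iff_hasFDerivAt.1 h1
  refine h2.hasDerivAt.congr_deriv ?_
  change D ((1 : ℝ) • X') = D X'
  rw [one_smul]

/-- Moser's computation on a manifold. -/
theorem hasDerivAt_pullback_eq_zero {η : ℝ → Form d M 2} {β γ : ℝ → Form d M 1}
    (hη : (η 0).IsSmooth) (hβ : IsSmoothFamily β) (hcl : (η 0).extD = 0)
    (hηβ : ∀ τ, η τ - η 0 = (β τ).extD)
    (hγ : ∀ τ x v, HasDerivAt (fun s ↦ β s x v) (γ τ x v) τ)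
    {X : ℝ → (x : M) → TangentSpace (𝓡 d) x}
    (hX : ∀ τ x w, η τ x ![X τ x, w] = -γ τ x (fun _ ↦ w)) {Ψ : ℝ → M → M}
    (hΨ : ContMDiff (𝓘(ℝ, ℝ).prod (𝓡 d)) (𝓡 d) ∞ (fun p : ℝ × M ↦ Ψ p.1 p.2)) {J : Set ℝ}
    (hJ : IsOpen J) (hvel : ∀ τ ∈ J, ∀ x, HasMFDerivAt 𝓘(ℝ, ℝ) (𝓡 d) (fun t ↦ Ψ t x) τ
      ((1 : ℝ →L[ℝ] ℝ).smulRight (X τ (Ψ τ x)))) {τ₀ : ℝ} (hτ₀ : τ₀ ∈ J) (x : M)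
    (v w : TangentSpace (𝓡 d) x) :
    HasDerivAt (fun τ ↦ (η τ).pullback (Ψ τ) x ![v, w]) 0 τ₀ := by
  set z₀ := Ψ τ₀ x with hz₀
  set y₀ := extChartAt (𝓡 d) x x with hy₀
  have hxs := mem_extChartAt_source (I := 𝓡 d) x
  have hy₀t : y₀ ∈ (extChartAt (𝓡 d) x).target := (extChartAt (𝓡 d) x).map_source hxs
  have hsymm : (extChartAt (𝓡 d) x).symm y₀ = x := (extChartAt (𝓡 d) x).left_inv hxs
  have hz : Ψ τ₀ ((extChartAt (𝓡 d) x).symm y₀) ∈ (extChartAt (𝓡 d) z₀).source := by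
    rw [hsymm]
    exact mem_extChartAt_source z₀
  have hG := contDiffAt_chart_comp (z₀ := z₀) (hΨ (τ₀, (extChartAt (𝓡 d) x).symm y₀)) hy₀t hz
  set G : ℝ × 𝔼 → 𝔼 := fun p ↦ extChartAt (𝓡 d) z₀ (Ψ p.1 ((extChartAt (𝓡 d) x).symm p.2))
    with hGdef
  have hGt : G (τ₀, y₀) ∈ (extChartAt (𝓡 d) z₀).target := (extChartAt (𝓡 d) z₀).map_source hz
  have hsum : ∀ τ, ∀ z ∈ (extChartAt (𝓡 d) z₀).target, (η 0).inChart z₀ z +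
      extDeriv (fun z ↦ (β τ).inChart z₀ z) z = (η τ).inChart z₀ z := by
    intro τ z hz
    have h1 : extDeriv (fun z ↦ (β τ).inChart z₀ z) z = (β τ).extD.inChart z₀ z :=
      (Form.extD_inChart (hβ.isSmooth τ) hz).symm
    rw [h1, ← hηβ]
    ext u
    change η 0 _ _ + (η τ _ _ - η 0 _ _) = η τ _ _
    abel
  have hc : ContinuousAt (fun p : ℝ × 𝔼 ↦ Ψ p.1 ((extChartAt (𝓡 d) x).symm p.2)) (τ₀, y₀) :=
    ContinuousAt.comp (g := fun p : ℝ × M ↦ Ψ p.1 p.2)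
      (f := fun p : ℝ × 𝔼 ↦ (p.1, (extChartAt (𝓡 d) x).symm p.2))
      hΨ.continuous.continuousAt (continuousAt_fst.prodMk
        (((continuousOn_extChartAt_symm x).continuousAt
          ((isOpen_extChartAt_target x).mem_nhds hy₀t)).comp
            (f := fun p : ℝ × 𝔼 ↦ p.2) (x := (τ₀, y₀)) continuousAt_snd))
  have hsrc := hc.eventually ((isOpen_extChartAt_source z₀).mem_nhds hz)
  have hmain := hasDerivAt_pullback_zero (A₀ := (η 0).inChart z₀)
    (B := fun p ↦ (β p.1).inChart z₀ p.2) hG (hβ.contDiffAt hGt)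
    ((hη z₀).contDiffAt ((isOpen_extChartAt_target z₀).mem_nhds hGt))
    (by
      rw [← Form.extD_inChart hη hGt, hcl]
      rfl)
    (by
      filter_upwards [hsrc, (hG.of_le (m := 1) (by simp)).eventually (by simp),
        (continuousAt_fst (p := (τ₀, y₀))).eventually (hJ.mem_nhds hτ₀)] with p hp hGp hpJ w
      obtain ⟨τ, y⟩ := p
      set q := Ψ τ ((extChartAt (𝓡 d) x).symm y) with hq
      have hGpt : G (τ, y) ∈ (extChartAt (𝓡 d) z₀).target := (extChartAt (𝓡 d) z₀).map_source hp
      have h1 : fderiv ℝ G (τ, y) (1, 0) =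
          mfderiv (𝓡 d) 𝓘(ℝ, 𝔼) (extChartAt (𝓡 d) z₀) q (X τ q) := by
        have h2 := HasFDerivAt.comp_hasDerivAt (f := fun t : ℝ ↦ (t, y)) τ
          (hGp.differentiableAt (by simp)).hasFDerivAt
          ((hasDerivAt_id τ).prodMk (hasDerivAt_const τ y))
        exact h2.unique (chart_velocity (hvel τ hpJ _) hp)
      have h3 : fderiv ℝ (fun p : ℝ × 𝔼 ↦ (β p.1).inChart z₀ p.2) (τ, G (τ, y)) (1, 0)
          (fun _ ↦ w) = γ τ q (fun _ ↦ chartVector z₀ q w) := by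
        have h4 := HasFDerivAt.comp_hasDerivAt (f := fun t : ℝ ↦ (t, G (τ, y))) τ
          ((hβ.contDiffAt hGpt).differentiableAt (by simp)).hasFDerivAt
          ((hasDerivAt_id τ).prodMk (hasDerivAt_const τ (G (τ, y))))
        have h5 := (ContinuousAlternatingMap.apply ℝ 𝔼 ℝ
          (fun _ : Fin 1 ↦ w)).hasFDerivAt.comp_hasDerivAt τ h4
        refine h5.unique ((hγ τ q _).congr_of_eventuallyEq (Eventually.of_forall fun s ↦ ?_))
        exact ((β s).apply_chartVector hp _).symm
      rw [h3, hsum τ _ hGpt, h1, ← hX]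
      refine ((η τ).apply_chartVector_pair hp _ _).symm.trans ?_
      rw [chartVector_mfderiv_chart hp])
    (mfderiv (𝓡 d) 𝓘(ℝ, 𝔼) (extChartAt (𝓡 d) x) x v)
    (mfderiv (𝓡 d) 𝓘(ℝ, 𝔼) (extChartAt (𝓡 d) x) x w)
  refine hmain.congr_of_eventuallyEq ?_
  have hc' : Tendsto (fun τ : ℝ ↦ (τ, y₀)) (𝓝 τ₀) (𝓝 (τ₀, y₀)) :=
    (Continuous.prodMk_left y₀).tendsto τ₀
  filter_upwards [hc'.eventually hsrc] with τ hτ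
  have h5 : ContMDiff (𝓡 d) (𝓡 d) ∞ (Ψ τ) :=
    hΨ.comp (f := fun x : M ↦ (τ, x)) (contMDiff_const.prodMk contMDiff_id)
  rw [← Form.inChart_mfderiv_chart _ hxs, hsum τ _ ((extChartAt (𝓡 d) z₀).map_source hτ)]
  refine (congrFun (congrArg DFunLike.coe ((η τ).pullback_inChart hy₀t
    (h5.mdifferentiable (by simp) _) hτ)) _).trans ?_
  change (η τ).inChart z₀ _ (fun i ↦ _) = _
  congr 1
  funext i; fin_cases i <;> rfl

/-- Each evaluation of the pulled back form has zero derivative on the connected open set `J`, so it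
keeps its value at `τ = 0`, where `Ψ` is the identity. -/
theorem pullback_eq_of_velocity {η : ℝ → Form d M 2} {β γ : ℝ → Form d M 1}
    (hη : (η 0).IsSmooth) (hβ : IsSmoothFamily β) (hcl : (η 0).extD = 0)
    (hηβ : ∀ τ, η τ - η 0 = (β τ).extD)
    (hγ : ∀ τ x v, HasDerivAt (fun s ↦ β s x v) (γ τ x v) τ)
    {X : ℝ → (x : M) → TangentSpace (𝓡 d) x}
    (hX : ∀ τ x w, η τ x ![X τ x, w] = -γ τ x (fun _ ↦ w)) {Ψ : ℝ → M → M}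
    (hΨ : ContMDiff (𝓘(ℝ, ℝ).prod (𝓡 d)) (𝓡 d) ∞ (fun p : ℝ × M ↦ Ψ p.1 p.2)) {J : Set ℝ}
    (hJ : IsOpen J) (hJ' : IsPreconnected J)
    (hvel : ∀ τ ∈ J, ∀ x, HasMFDerivAt 𝓘(ℝ, ℝ) (𝓡 d) (fun t ↦ Ψ t x) τ
      ((1 : ℝ →L[ℝ] ℝ).smulRight (X τ (Ψ τ x)))) (h0 : 0 ∈ J) (hΨ0 : Ψ 0 = id)
    {τ : ℝ} (hτ : τ ∈ J) : (η τ).pullback (Ψ τ) = η 0 := by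
  funext x
  ext u
  have hu : u = ![u 0, u 1] := by
    funext i; fin_cases i <;> rfl
  have h := fun t (ht : t ∈ J) ↦
    hasDerivAt_pullback_eq_zero hη hβ hcl hηβ hγ hX hΨ hJ hvel ht x (u 0) (u 1)
  have h1 := hJ.is_const_of_deriv_eq_zero hJ'
    (fun t ht ↦ (h t ht).differentiableAt.differentiableWithinAt)
    (fun t ht ↦ (h t ht).deriv) hτ h0
  rw [hΨ0, Form.pullback_id] at h1
  rw [hu]
  exact h1

end Presymplectic

/-! ### Flows of time-dependent vector fields -/

namespace Presymplectic

open Filter Topology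

variable {d : ℕ} {M : Type*} [TopologicalSpace M] [ChartedSpace (EuclideanSpace ℝ (Fin d)) M]
  [IsManifold (𝓡 d) ∞ M] {k : ℕ}

local notation "𝔼" => EuclideanSpace ℝ (Fin d)

/-- The suspension of a time-dependent vector field, cut off in time. -/
def suspension (χ : ℝ → ℝ) (X : ℝ → (x : M) → TangentSpace (𝓡 d) x) (p : ℝ × M) :
    TangentSpace (𝓘(ℝ, ℝ).prod (𝓡 d)) p :=
  χ p.1 • ((1 : ℝ), X p.1 p.2)

theorem contMDiff_suspension {χ : ℝ → ℝ} (hχ : ContDiff ℝ ∞ χ)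
    {X : ℝ → (x : M) → TangentSpace (𝓡 d) x}
    (hX : ContMDiff (𝓘(ℝ, ℝ).prod (𝓡 d)) (𝓘(ℝ, ℝ).prod (𝓡 d)).tangent ∞
        (fun p : ℝ × M ↦ (⟨p, ((0 : ℝ), X p.1 p.2)⟩ :
          TangentBundle (𝓘(ℝ, ℝ).prod (𝓡 d)) (ℝ × M)))) :
    ContMDiff (𝓘(ℝ, ℝ).prod (𝓡 d)) (𝓘(ℝ, ℝ).prod (𝓡 d)).tangent ∞
      (fun p : ℝ × M ↦ (⟨p, suspension χ X p⟩ :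
          TangentBundle (𝓘(ℝ, ℝ).prod (𝓡 d)) (ℝ × M))) := by
  have := isManifold_one (d := d) (M := M)
  have h1 : ContMDiff (𝓘(ℝ, ℝ).prod (𝓡 d)) (𝓘(ℝ, ℝ).prod (𝓡 d)).tangent ∞
        (fun p : ℝ × M ↦ (⟨p, ((1 : ℝ), (0 : 𝔼))⟩ :
          TangentBundle (𝓘(ℝ, ℝ).prod (𝓡 d)) (ℝ × M))) := fun p ↦ by
    refine contMDiffAt_tangentBundle_prod (c := fun _ ↦ 1) (N := M) (p := p)
      (X := fun τ x ↦ 0) contDiff_const ?_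
    exact ContMDiffAt.comp (g := fun x : M ↦ (⟨x, 0⟩ : TangentBundle (𝓡 d) M))
      (f := fun p : ℝ × M ↦ p.2) p
      (Bundle.contMDiff_zeroSection ℝ (TangentSpace (𝓡 d) : M → Type _)).contMDiffAt contMDiffAt_snd
  have h2 : ContMDiff (𝓘(ℝ, ℝ).prod (𝓡 d)) 𝓘(ℝ, ℝ) ∞ (fun p : ℝ × M ↦ χ p.1) :=
    ContMDiff.comp (g := χ) (f := fun p : ℝ × M ↦ p.1) hχ.contMDiff contMDiff_fst
  have h3 := ContMDiff.smul_section h2 (ContMDiff.add_section h1 hX)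
  refine h3.congr fun p ↦ ?_
  congr 1
  let y : 𝔼 := X p.1 p.2
  change χ p.1 • ((1 : ℝ), y) = χ p.1 • (((1 : ℝ), (0 : 𝔼)) + ((0 : ℝ), y))
  simp

/-- Integral curves of a time-dependent vector field are unique. -/
theorem eqOn_of_velocity [T2Space M] {X : ℝ → (x : M) → TangentSpace (𝓡 d) x}
    (hX : ContMDiff (𝓘(ℝ, ℝ).prod (𝓡 d)) (𝓘(ℝ, ℝ).prod (𝓡 d)).tangent ∞
        (fun p : ℝ × M ↦ (⟨p, ((0 : ℝ), X p.1 p.2)⟩ :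
          TangentBundle (𝓘(ℝ, ℝ).prod (𝓡 d)) (ℝ × M))))
    {c₁ c₂ : ℝ → M} {a b t₀ : ℝ} (ht₀ : t₀ ∈ Ioo a b)
    (h₁ : ∀ t ∈ Ioo a b, HasMFDerivAt 𝓘(ℝ, ℝ) (𝓡 d) c₁ t
      ((1 : ℝ →L[ℝ] ℝ).smulRight (X t (c₁ t))))
    (h₂ : ∀ t ∈ Ioo a b, HasMFDerivAt 𝓘(ℝ, ℝ) (𝓡 d) c₂ t
      ((1 : ℝ →L[ℝ] ℝ).smulRight (X t (c₂ t))))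
    (h : c₁ t₀ = c₂ t₀) : EqOn c₁ c₂ (Ioo a b) := by
  have := isManifold_one (d := d) (M := M)
  have hV : ContMDiff (𝓘(ℝ, ℝ).prod (𝓡 d)) (𝓘(ℝ, ℝ).prod (𝓡 d)).tangent 1
      (fun p : ℝ × M ↦ (⟨p, suspension (fun _ ↦ 1) X p⟩ :
          TangentBundle (𝓘(ℝ, ℝ).prod (𝓡 d)) (ℝ × M))) :=
    (contMDiff_suspension contDiff_const hX).of_le (by simp)
  have hlift : ∀ c : ℝ → M, (∀ t ∈ Ioo a b, HasMFDerivAt 𝓘(ℝ, ℝ) (𝓡 d) c t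
      ((1 : ℝ →L[ℝ] ℝ).smulRight (X t (c t)))) →
      IsMIntegralCurveOn (fun t ↦ (t, c t)) (suspension (fun _ ↦ 1) X) (Ioo a b) := by
    intro c hc t ht
    have h3 := HasMFDerivAt.prodMk (f := fun t : ℝ ↦ t) (hasMFDerivAt_id (I := 𝓘(ℝ, ℝ)) t)
      (hc t ht)
    refine (h3.congr_mfderiv (DFunLike.ext _ _ fun s : ℝ ↦ ?_)).hasMFDerivWithinAt
    let x : 𝔼 := X t (c t)
    change (s, s • x) = s • ((1 : ℝ) • ((1 : ℝ), x))
    simp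
  intro t ht
  exact congrArg Prod.snd (isMIntegralCurveOn_Ioo_eqOn_of_contMDiff_boundaryless ht₀ hV
    (hlift c₁ h₁) (hlift c₂ h₂) (Prod.ext rfl h) ht)

/-- The flow of a time-dependent vector field on a compact manifold on a bounded time interval. -/
theorem exists_flow_of_time_dependent [CompactSpace M] [T2Space M]
    {X : ℝ → (x : M) → TangentSpace (𝓡 d) x}
    (hX : ContMDiff (𝓘(ℝ, ℝ).prod (𝓡 d)) (𝓘(ℝ, ℝ).prod (𝓡 d)).tangent ∞
        (fun p : ℝ × M ↦ (⟨p, ((0 : ℝ), X p.1 p.2)⟩ :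
          TangentBundle (𝓘(ℝ, ℝ).prod (𝓡 d)) (ℝ × M)))) {R : ℝ} (hR : 0 < R) :
    ∃ Ψ Θ : ℝ → M → M,
      ContMDiff (𝓘(ℝ, ℝ).prod (𝓡 d)) (𝓡 d) ∞ (fun p : ℝ × M ↦ Ψ p.1 p.2) ∧
      ContMDiff (𝓘(ℝ, ℝ).prod (𝓡 d)) (𝓡 d) ∞ (fun p : ℝ × M ↦ Θ p.1 p.2) ∧
      Ψ 0 = id ∧
      (∀ τ ∈ Ioo (-R) R, Function.LeftInverse (Θ τ) (Ψ τ) ∧ Function.RightInverse (Θ τ) (Ψ τ)) ∧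
      ∀ τ ∈ Ioo (-R) R, ∀ x, HasMFDerivAt 𝓘(ℝ, ℝ) (𝓡 d) (fun t ↦ Ψ t x) τ
        ((1 : ℝ →L[ℝ] ℝ).smulRight (X τ (Ψ τ x))) := by
  have := isManifold_one (d := d) (M := M)
  -- Cutting off in time gives the suspended field compact support on `ℝ × M`, hence a complete
  -- flow, while on `(-R, R)` time still runs at unit speed.
  let χ : ContDiffBump (0 : ℝ) := ⟨R, R + 1, hR, by linarith⟩
  have hχ1 : ∀ t ∈ Ioo (-R) R, χ t = 1 := fun t ht ↦ χ.one_of_mem_closedBall (by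
    rw [mem_closedBall_zero_iff, Real.norm_eq_abs, abs_le]
    exact ⟨ht.1.le, ht.2.le⟩)
  have hV := contMDiff_suspension χ.contDiff hX
  obtain ⟨φ, hφ, hφ'⟩ := exists_smooth_flow_of_compact_support hV
    (K := Metric.closedBall 0 (R + 1) ×ˢ univ) ((isCompact_closedBall 0 (R + 1)).prod isCompact_univ)
    (fun p hp ↦ by
      have h1 : χ p.1 = 0 := χ.zero_of_le_dist (by
        by_contra! h
        exact hp ⟨h.le, mem_univ _⟩)
      let y : 𝔼 := X p.1 p.2
      change χ p.1 • ((1 : ℝ), y) = 0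
      rw [h1, zero_smul])
  have hV1 : ContMDiff (𝓘(ℝ, ℝ).prod (𝓡 d)) (𝓘(ℝ, ℝ).prod (𝓡 d)).tangent 1
      (fun p : ℝ × M ↦ (⟨p, suspension χ X p⟩ :
          TangentBundle (𝓘(ℝ, ℝ).prod (𝓡 d)) (ℝ × M))) := hV.of_le (by simp)
  have hadd : ∀ s t p, φ (s + t) p = φ t (φ s p) := by
    intro s t p
    have h1 : IsMIntegralCurve (fun t ↦ φ (t + s) p) (suspension χ X) := (hφ' p).2.comp_add s
    have h2 := isMIntegralCurve_Ioo_eq_of_contMDiff_boundaryless (t₀ := 0) hV1 h1 (hφ' (φ s p)).2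
      (by simp [(hφ' _).1])
    rw [add_comm]
    exact congrFun h2 t
  -- The time coordinate of the flow solves the scalar equation `s' = χ s`. As long as `τ + t` stays
  -- in the window it solves the same equation, and uniqueness applies.
  have hfst : ∀ τ ∈ Ioo (-R) R, ∀ x t, τ + t ∈ Ioo (-R) R → (φ t (τ, x)).1 = τ + t := by
    intro τ hτ x t ht
    have hχV : ContMDiff 𝓘(ℝ, ℝ) 𝓘(ℝ, ℝ).tangent 1
        (fun t : ℝ ↦ (⟨t, χ t⟩ : TangentBundle 𝓘(ℝ, ℝ) ℝ)) := by
      refine fun t ↦ (Bundle.contMDiffAt_section _).2 ?_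
      simpa using (χ.contDiff (n := 1)).contMDiff.contMDiffAt
    refine isMIntegralCurveOn_Ioo_eqOn_of_contMDiff_boundaryless (I := 𝓘(ℝ, ℝ))
      (γ := fun t ↦ (φ t (τ, x)).1) (γ' := fun t ↦ τ + t) (v := fun t ↦ χ t) (t₀ := 0)
      (a := -R - τ) (b := R - τ) ⟨by linarith [hτ.1], by linarith [hτ.2]⟩ hχV ?_ ?_ ?_
      ⟨by linarith [ht.1], by linarith [ht.2]⟩
    · intro s hs
      have h1 := HasMFDerivAt.comp (g := Prod.fst) (f := fun t ↦ φ t (τ, x)) s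
        (hasMFDerivAt_fst (I := 𝓘(ℝ, ℝ)) (I' := 𝓡 d) (φ s (τ, x))) ((hφ' (τ, x)).2 s)
      refine (h1.congr_mfderiv (DFunLike.ext _ _ fun r : ℝ ↦ ?_)).hasMFDerivWithinAt
      let p := φ s (τ, x)
      let y : 𝔼 := X p.1 p.2
      change (r • (χ p.1 • ((1 : ℝ), y))).1 = r • χ p.1
      simp
    · intro s hs
      have h1 : HasDerivAt (fun t ↦ τ + t) 1 s := (hasDerivAt_id s).const_add τ
      have h2 : χ (τ + s) = 1 := hχ1 _ ⟨by linarith [hs.1], by linarith [hs.2]⟩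
      have h3 : HasMFDerivAt 𝓘(ℝ, ℝ) 𝓘(ℝ, ℝ) (fun t ↦ τ + t) s _ :=
        hasMFDerivAt_iff_hasFDerivAt.2 h1.hasFDerivAt
      refine (h3.congr_mfderiv (DFunLike.ext _ _ fun r : ℝ ↦ ?_)).hasMFDerivWithinAt
      change r • (1 : ℝ) = r • χ (τ + s)
      rw [h2]
    · simp [(hφ' _).1]
  have h0 : (0 : ℝ) ∈ Ioo (-R) R := ⟨by linarith, hR⟩
  -- `Ψ τ` flows from time `0` to time `τ`, and `Θ τ` flows back from `τ` to `0`. Written this way,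
  -- the inverse is smooth in `(τ, x)` for free.
  refine ⟨fun τ x ↦ (φ τ (0, x)).2, fun τ x ↦ (φ (-τ) (τ, x)).2, ?_, ?_, ?_, ?_, ?_⟩
  · exact contMDiff_snd.comp (hφ.comp (f := fun p : ℝ × M ↦ (p.1, ((0 : ℝ), p.2)))
      (contMDiff_fst.prodMk (contMDiff_const.prodMk contMDiff_snd)))
  · have h1 : ContMDiff (𝓘(ℝ, ℝ).prod (𝓡 d)) 𝓘(ℝ, ℝ) ∞ (fun p : ℝ × M ↦ -p.1) :=
      ContMDiff.comp (g := fun t : ℝ ↦ -t) (f := fun p : ℝ × M ↦ p.1) contDiff_neg.contMDiff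
        contMDiff_fst
    exact contMDiff_snd.comp (hφ.comp (f := fun p : ℝ × M ↦ (-p.1, (p.1, p.2)))
      (h1.prodMk (contMDiff_fst.prodMk contMDiff_snd)))
  · funext x
    simp [(hφ' _).1]
  · intro τ hτ
    constructor
    · intro x
      have h1 : φ τ (0, x) = (τ, (φ τ (0, x)).2) :=
        Prod.ext ((hfst 0 h0 x τ (by rwa [zero_add])).trans (zero_add τ)) rfl
      change (φ (-τ) (τ, (φ τ (0, x)).2)).2 = x
      rw [← h1, ← hadd, add_neg_cancel, (hφ' _).1]
    · intro x
      have h1 : φ (-τ) (τ, x) = (0, (φ (-τ) (τ, x)).2) :=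
        Prod.ext ((hfst τ hτ x (-τ) (by rwa [add_neg_cancel])).trans (add_neg_cancel τ)) rfl
      change (φ τ (0, (φ (-τ) (τ, x)).2)).2 = x
      rw [← h1, ← hadd, neg_add_cancel, (hφ' _).1]
  · intro τ hτ x
    have h1 := HasMFDerivAt.comp (g := Prod.snd) (f := fun t ↦ φ t (0, x)) τ
        (hasMFDerivAt_snd (I := 𝓘(ℝ, ℝ)) (I' := 𝓡 d) (φ τ (0, x))) ((hφ' (0, x)).2 τ)
    refine h1.congr_mfderiv (DFunLike.ext _ _ fun r : ℝ ↦ ?_)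
    have h2 : (φ τ (0, x)).1 = τ := (hfst 0 h0 x τ (by rwa [zero_add])).trans (zero_add τ)
    let y : ℝ → 𝔼 := fun s ↦ X s (φ τ (0, x)).2
    change (r • (χ (φ τ (0, x)).1 • ((1 : ℝ), y (φ τ (0, x)).1))).2 = r • y τ
    rw [h2, hχ1 τ hτ]
    simp

end Presymplectic

/-! ### Unfolding time: functions of `sin²` -/

theorem sin_arcsin_sqrt_sq {t : ℝ} (ht : t ∈ Icc (0 : ℝ) 1) :
    Real.sin (Real.arcsin (Real.sqrt t)) ^ 2 = t := by
  rw [Real.sin_arcsin (by linarith [Real.sqrt_nonneg t]) (Real.sqrt_le_one.2 ht.2),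
    Real.sq_sqrt ht.1]

theorem arcsin_sqrt_mem {R : ℝ} (hR : 2 ≤ R) (t : ℝ) :
    Real.arcsin (Real.sqrt t) ∈ Ioo (-R) R := by
  have h1 := Real.arcsin_nonneg.2 (Real.sqrt_nonneg t)
  have h2 := Real.arcsin_le_pi_div_two (Real.sqrt t)
  exact ⟨by linarith, by linarith [Real.pi_lt_four]⟩

/-- A function invariant under the reflections `t ↦ -t` and `t ↦ π - t` factors through `sin²`. -/
theorem eq_arcsin_sqrt_sin_sq {α : Type*} {f : ℝ → α} (h1 : ∀ t ∈ Ioo (-5 : ℝ) 5, f (-t) = f t)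
    (h2 : ∀ t ∈ Ioo (Real.pi - 5) 5, f (Real.pi - t) = f t) {τ : ℝ} (hτ : τ ∈ Ioo (-4 : ℝ) 4) :
    f τ = f (Real.arcsin (Real.sqrt (Real.sin τ ^ 2))) := by
  have hπ := Real.pi_gt_three
  have hπ' := Real.pi_lt_four
  rw [Real.sqrt_sq_eq_abs]
  -- On `[0, 4)` the number `arcsin |sin τ|` is `τ`, `π - τ` or `τ - π`, according to the position
  -- of `τ` relative to `π/2` and `π`; at most two reflections lead to it.
  have key : ∀ τ, 0 ≤ τ → τ < 4 → f τ = f (Real.arcsin |Real.sin τ|) := by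
    intro τ h0 h4
    rcases le_total τ (Real.pi / 2) with h | h
    · rw [abs_of_nonneg (Real.sin_nonneg_of_nonneg_of_le_pi h0 (by linarith)),
        Real.arcsin_sin (by linarith) h]
    · rw [← h2 τ ⟨by linarith, by linarith⟩]
      rcases le_total τ Real.pi with h' | h'
      · rw [abs_of_nonneg (Real.sin_nonneg_of_nonneg_of_le_pi h0 h'), ← Real.sin_pi_sub,
          Real.arcsin_sin (by linarith) (by linarith)]
      · have h3 : |Real.sin τ| = Real.sin (τ - Real.pi) := by
          rw [Real.sin_sub_pi, abs_of_nonpos]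
          have := Real.sin_nonneg_of_nonneg_of_le_pi (x := τ - Real.pi) (by linarith) (by linarith)
          rw [Real.sin_sub_pi] at this
          linarith
        rw [h3, Real.arcsin_sin (by linarith) (by linarith),
          ← h1 (τ - Real.pi) ⟨by linarith, by linarith⟩, neg_sub]
  rcases le_total 0 τ with h | h
  · exact key τ h hτ.2
  · rw [← h1 τ ⟨by linarith [hτ.1], by linarith⟩, key (-τ) (by linarith) (by linarith [hτ.1]),
      Real.sin_neg, abs_neg]

/-! ### The constant-kernel case and the conjugate case -/

namespace Presymplectic

open Filter Topology

variable {d : ℕ} {M : Type*} [TopologicalSpace M] [ChartedSpace (EuclideanSpace ℝ (Fin d)) M]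
  [IsManifold (𝓡 d) ∞ M] {k : ℕ}

-- Reversing time negates the velocity, and the field changes sign under the same reflection. The
-- signs cancel, so the reflected curve satisfies the original equation.
omit [IsManifold (𝓡 d) ∞ M] in
theorem velocity_reflect {X : ℝ → (x : M) → TangentSpace (𝓡 d) x} {Ψ : ℝ → M → M} {a t : ℝ} {x : M}
    (h : HasMFDerivAt 𝓘(ℝ, ℝ) (𝓡 d) (fun s ↦ Ψ s x) (a - t)
      ((1 : ℝ →L[ℝ] ℝ).smulRight (X (a - t) (Ψ (a - t) x)))) (hX : X (a - t) = -X t) :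
    HasMFDerivAt 𝓘(ℝ, ℝ) (𝓡 d) (fun s ↦ Ψ (a - s) x) t
      ((1 : ℝ →L[ℝ] ℝ).smulRight (X t (Ψ (a - t) x))) := by
  have h1 : HasMFDerivAt 𝓘(ℝ, ℝ) 𝓘(ℝ, ℝ) (fun s : ℝ ↦ a - s) t _ :=
    hasMFDerivAt_iff_hasFDerivAt.2 ((hasDerivAt_id t).const_sub a).hasFDerivAt
  have h2 := HasMFDerivAt.comp (g := fun s ↦ Ψ s x) (f := fun s : ℝ ↦ a - s) t h h1
  refine h2.congr_mfderiv (DFunLike.ext _ _ fun r : ℝ ↦ ?_)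
  rw [hX]
  let y : EuclideanSpace ℝ (Fin d) := X t (Ψ (a - t) x)
  change (r • (-1 : ℝ)) • (-y) = r • y
  simp

/-- A path of 2-forms with constant kernel line field and constant basic cohomology class is
generated by an isotopy, provided it starts at a closed form. -/
theorem exists_isotopy_of_constantBasicClass [CompactSpace M] [T2Space M] {η : ℝ → Form d M 2}
    (hη : IsSmoothFamily (fun τ ↦ η (Real.sin τ ^ 2))) (hcl : (η 0).extD = 0)
    (hker : ∀ t ∈ Icc (0 : ℝ) 1, ∀ x, (η t).ker x = (η 0).ker x)
    (hdim : ∀ x, Module.finrank ℝ ((η 0).ker x) = 1)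
    (hclass : HasConstantBasicClass (η 0).ker η) :
    ∃ θ : ℝ → M → M, IsIsotopy d θ ∧ ∀ t ∈ Icc (0 : ℝ) 1, η t = (η 0).pullback (θ t) := by
  obtain ⟨β, hβ, hβ'⟩ := hclass
  have hβs := hβ.comp_sin_sq
  obtain ⟨γ, hγs, hγ⟩ := hβs.exists_hasDerivAt
  have hs0 : Real.sin 0 ^ 2 = 0 := by simp
  set ηs : ℝ → Form d M 2 := fun τ ↦ η (Real.sin τ ^ 2) with hηs
  set βs : ℝ → Form d M 1 := fun τ ↦ β (Real.sin τ ^ 2) with hβs'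
  have hη0 : ηs 0 = η 0 := by rw [hηs]; simp only [hs0]
  -- Basic forms vanish on the kernel at every time, hence so does the time derivative. This is the
  -- solvability condition for the contraction equation.
  have hγker : ∀ τ x, ∀ v ∈ (ηs 0).ker x, γ τ x (fun _ ↦ v) = 0 := by
    intro τ x v hv
    rw [hη0] at hv
    refine (hγ τ x _).unique ((hasDerivAt_const τ (0 : ℝ)).congr_of_eventuallyEq
      (Eventually.of_forall fun s ↦ ?_))
    exact (hβ' _ (sin_sq_mem_Icc s)).1.contract x _ ⟨0, hv⟩
  obtain ⟨X, hXs, hX, hXsymm⟩ := exists_solution_contract hη hγs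
    (fun τ x ↦ by rw [hη0]; exact hker _ (sin_sq_mem_Icc τ) x)
    (fun x ↦ by rw [hη0]; exact hdim x) hγker
  obtain ⟨Ψ, Θ, hΨ, hΘ, hΨ0, hinv, hvel⟩ := exists_flow_of_time_dependent hXs (R := 5) (by norm_num)
  -- Used for `a = 0` and `a = π`. The reflection `t ↦ a - t` preserves `sin²`, so it fixes `η` and
  -- negates the derivative of `β`, hence negates `X`. The curves `Ψ (a - t) x` and `Ψ t x` then
  -- solve the same equation and meet at the fixed point `t = a / 2`.
  have hreflect : ∀ a : ℝ, 0 ≤ a → a < 5 → (∀ s, Real.sin (a - s) ^ 2 = Real.sin s ^ 2) →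
      ∀ t ∈ Ioo (a - 5) 5, Ψ (a - t) = Ψ t := by
    intro a ha ha5 hsin t ht
    have hXa : ∀ t, X (a - t) = -X t := by
      intro t
      refine hXsymm _ _ (by simp only [hηs, hsin]) ?_
      funext x
      ext v
      have h1 := (hγ (a - t) x v).comp_const_sub a t
      have h2 : HasDerivAt (fun s ↦ βs s x v) (-γ (a - t) x v) t :=
        h1.congr_of_eventuallyEq (Eventually.of_forall fun s ↦ by simp only [hβs', hsin])
      exact neg_eq_iff_eq_neg.1 (h2.unique (hγ t x v))
    funext x
    refine eqOn_of_velocity hXs (c₁ := fun t ↦ Ψ (a - t) x) (c₂ := fun t ↦ Ψ t x) (a := a - 5)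
      (b := 5) (t₀ := a / 2) ⟨by linarith, by linarith⟩ ?_ ?_ ?_ ht
    · intro s hs
      exact velocity_reflect (hvel _ ⟨by linarith [hs.2], by linarith [hs.1]⟩ x) (hXa s)
    · intro s hs
      exact hvel s ⟨by linarith [hs.1], hs.2⟩ x
    · simp only [sub_half]
  have hΨeq : ∀ τ ∈ Ioo (-4 : ℝ) 4, Ψ τ = Ψ (Real.arcsin (Real.sqrt (Real.sin τ ^ 2))) := by
    intro τ hτ
    refine eq_arcsin_sqrt_sin_sq (fun t ht ↦ ?_) (fun t ht ↦ ?_) hτ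
    · have := hreflect 0 le_rfl (by norm_num) (fun s ↦ by simp) t (by simpa using ht)
      rwa [zero_sub] at this
    · exact hreflect Real.pi Real.pi_pos.le (by linarith [Real.pi_lt_four])
        (fun s ↦ by rw [Real.sin_pi_sub]) t ht
  have hΘeq : ∀ τ ∈ Ioo (-4 : ℝ) 4, Θ τ = Θ (Real.arcsin (Real.sqrt (Real.sin τ ^ 2))) := by
    intro τ hτ
    have h1 := (hinv τ ⟨by linarith [hτ.1], by linarith [hτ.2]⟩).1
    have h2 := (hinv _ (arcsin_sqrt_mem (R := 5) (by norm_num) (Real.sin τ ^ 2))).2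
    rw [← hΨeq τ hτ] at h2
    exact h1.eq_rightInverse h2
  have hslice : ∀ {Φ : ℝ → M → M}, ContMDiff (𝓘(ℝ, ℝ).prod (𝓡 d)) (𝓡 d) ∞
      (fun p : ℝ × M ↦ Φ p.1 p.2) → ∀ τ, ContMDiff (𝓡 d) (𝓡 d) ∞ (Φ τ) := fun hΦ τ ↦
    hΦ.comp (f := fun x : M ↦ (τ, x)) (contMDiff_const.prodMk contMDiff_id)
  -- Moser's argument gives `Ψ^* η_t = η_0`, whereas the isotopy must pull `η_0` back to `η_t`;
  -- hence the inverse `Θ`, read at the folded time of `t`.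
  refine ⟨fun t ↦ Θ (Real.arcsin (Real.sqrt t)), ⟨?_, ?_, ?_⟩, ?_⟩
  · exact contMDiffOn_of_comp_sin_sq (φ := fun t ↦ Θ (Real.arcsin (Real.sqrt t)))
      hΘ.contMDiffOn fun τ hτ x ↦ congrFun (hΘeq τ hτ) x
  · intro t _
    set τ := Real.arcsin (Real.sqrt t)
    have h := hinv τ (arcsin_sqrt_mem (by norm_num) t)
    exact ⟨⟨⟨Θ τ, Ψ τ, h.2, h.1⟩, hslice hΘ τ, hslice hΨ τ⟩, rfl⟩
  · have h := (hinv 0 (by norm_num)).1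
    rw [hΨ0] at h
    funext x
    simpa using h x
  · intro t ht
    set τ := Real.arcsin (Real.sqrt t) with hτ
    have hτm : τ ∈ Ioo (-5 : ℝ) 5 := arcsin_sqrt_mem (by norm_num) t
    have h1 := pullback_eq_of_velocity (η := ηs) (J := Ioo (-5) 5) (τ := τ) (hη.isSmooth 0) hβs
      (by rw [hη0, hcl]) (fun τ ↦ by rw [hη0]; exact (hβ' _ (sin_sq_mem_Icc τ)).2) hγ hX hΨ
      isOpen_Ioo isPreconnected_Ioo hvel (by norm_num) hΨ0 hτm
    have h2 : ηs τ = η t := by simp only [hηs, hτ, sin_arcsin_sqrt_sq ht]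
    rw [h2, hη0] at h1
    rw [← h1, Form.pullback_comp _ ((hslice hΨ τ).mdifferentiable (by simp))
      ((hslice hΘ τ).mdifferentiable (by simp)), (hinv τ hτm).2.id, Form.pullback_id]

-- Surjectivity of the differential lets the contraction be tested on images of vectors at `x`, and
-- injectivity undoes the image of the kernel. This makes the kernel of `φ_t^* σ_t` independent of
-- `t`.
omit [IsManifold (𝓡 d) ∞ M] in
theorem Form.ker_pullback {σ σ' : Form d M 2} {f : M → M} {x : M}
    (hf : Function.Bijective (mfderiv (𝓡 d) (𝓡 d) f x))
    (h : (σ.ker x).map (mfderiv (𝓡 d) (𝓡 d) f x).toLinearMap = σ'.ker (f x)) :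
    (σ'.pullback f).ker x = σ.ker x := by
  have h1 : ∀ v, v ∈ (σ'.pullback f).ker x ↔ mfderiv (𝓡 d) (𝓡 d) f x v ∈ σ'.ker (f x) := by
    intro v
    have h2 : ∀ w, σ'.pullback f x ![v, w] =
        σ' (f x) ![mfderiv (𝓡 d) (𝓡 d) f x v, mfderiv (𝓡 d) (𝓡 d) f x w] := by
      intro w
      rw [Form.pullback_apply]
      congr 1
      funext i; fin_cases i <;> rfl
    constructor
    · intro hv w
      obtain ⟨w, rfl⟩ := hf.2 w
      rw [← h2]
      exact hv w
    · intro hv w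
      rw [h2]
      exact hv _
  ext v
  rw [h1, ← h]
  constructor
  · rintro ⟨w, hw, hwv⟩
    rwa [← hf.1 hwv]
  · intro hv
    exact ⟨v, hv, rfl⟩

theorem finrank_ker_eq_one {n : ℕ} {M : Type*} [TopologicalSpace M]
    [ChartedSpace (EuclideanSpace ℝ (Fin (2 * n + 1))) M] {σ : Form (2 * n + 1) M 2}
    (hσ : IsPresymplectic σ) (x : M) : Module.finrank ℝ (σ.ker x) = 1 := by
  have h1 : Module.finrank ℝ (TangentSpace (𝓡 (2 * n + 1)) x ⧸ σ.ker x) = 2 * n := hσ.rank_eq x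
  have hfin : Module.Finite ℝ (TangentSpace (𝓡 (2 * n + 1)) x) :=
    inferInstanceAs (Module.Finite ℝ (EuclideanSpace ℝ (Fin (2 * n + 1))))
  have h2 := Submodule.finrank_quotient_add_finrank (σ.ker x)
  have h3 : Module.finrank ℝ (TangentSpace (𝓡 (2 * n + 1)) x) = 2 * n + 1 :=
    finrank_euclideanSpace_fin (𝕜 := ℝ)
  omega

/-- Composition of an isotopy with the inverse of an isotopy. -/
theorem IsIsotopy.comp_symm [T2Space M] {θ φ : ℝ → M → M} (hθ : IsIsotopy d θ)
    (hφ : IsIsotopy d φ) :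
    ∃ ψ : ℝ → M → M, IsIsotopy d ψ ∧ ∀ t ∈ Icc (0 : ℝ) 1, ψ t ∘ φ t = θ t := by
  -- The inverses are taken in folded time, where the family lives over the whole line. `hDeq`
  -- records that they depend only on `sin² τ`, so the result descends to `[0,1]`.
  choose D hD using hφ.diffeomorph_comp_sin_sq
  have hinv := contMDiff_symm_of_family hφ.contMDiff_comp_sin_sq (D := D) hD
  have hDeq : ∀ τ, D (Real.arcsin (Real.sqrt (Real.sin τ ^ 2))) = D τ := by
    intro τ
    refine Diffeomorph.ext fun x ↦ ?_
    rw [hD, hD, sin_arcsin_sqrt_sq (sin_sq_mem_Icc τ)]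
  have hDt : ∀ t ∈ Icc (0 : ℝ) 1, ⇑(D (Real.arcsin (Real.sqrt t))) = φ t := by
    intro t ht
    rw [hD, sin_arcsin_sqrt_sq ht]
  refine ⟨fun t ↦ θ t ∘ (D (Real.arcsin (Real.sqrt t))).symm, ⟨?_, ?_, ?_⟩, ?_⟩
  · have h1 : ContMDiff (𝓘(ℝ, ℝ).prod (𝓡 d)) (𝓡 d) ∞
        (fun p : ℝ × M ↦ θ (Real.sin p.1 ^ 2) ((D p.1).symm p.2)) :=
      hθ.contMDiff_comp_sin_sq.comp (f := fun p : ℝ × M ↦ (p.1, (D p.1).symm p.2))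
        (contMDiff_fst.prodMk hinv)
    refine contMDiffOn_of_comp_sin_sq
      (φ := fun t ↦ θ t ∘ (D (Real.arcsin (Real.sqrt t))).symm) (Ψ := fun τ x ↦ θ (Real.sin τ ^ 2) ((D τ).symm x)) h1.contMDiffOn fun τ _ x ↦ ?_
    simp only [Function.comp_apply, hDeq]
  · intro t ht
    obtain ⟨Φ, hΦ⟩ := hθ.diffeo t ht
    exact ⟨(D (Real.arcsin (Real.sqrt t))).symm.trans Φ, by rw [← hΦ]; rfl⟩
  · have h1 : ⇑(D (Real.arcsin (Real.sqrt 0))) = id := by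
      rw [hDt 0 (by simp), hφ.zero]
    funext x
    have h2 := (D (Real.arcsin (Real.sqrt 0))).symm_apply_apply x
    rw [h1] at h2
    rw [hθ.zero]
    exact h2
  · intro t ht
    funext x
    simp only [Function.comp_apply]
    rw [← hDt t ht, Diffeomorph.symm_apply_apply]

/-- Stability of paths of presymplectic forms with conjugate Reeb foliations and constant basic
cohomology class. -/
theorem isGivenByIsotopy_of_conjugate {n : ℕ} {M : Type*} [TopologicalSpace M] [T2Space M]
    [CompactSpace M] [ChartedSpace (EuclideanSpace ℝ (Fin (2 * n + 1))) M]
    [IsManifold (𝓡 (2 * n + 1)) ∞ M] {σ : ℝ → Form (2 * n + 1) M 2} (hσ : IsPresymplecticPath σ)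
    {φ : ℝ → M → M} (hφ : IsIsotopy (2 * n + 1) φ)
    (hconj : ∀ t ∈ Icc (0 : ℝ) 1, ∀ x,
      ((σ 0).ker x).map (mfderiv (𝓡 (2 * n + 1)) (𝓡 (2 * n + 1)) (φ t) x).toLinearMap =
        (σ t).ker (φ t x))
    (hclass : HasConstantBasicClass (σ 0).ker (fun t ↦ (σ t).pullback (φ t))) :
    IsGivenByIsotopy σ := by
  have hσ0 := hσ.presymplectic 0 (by simp)
  have hσs := hσ.smooth.comp_sin_sq
  have h0 : (σ 0).pullback (φ 0) = σ 0 := by rw [hφ.zero, Form.pullback_id]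
  -- The path `φ_t^* σ_t` has the kernel of `σ_0` at all times, which reduces to the constant-kernel
  -- case.
  obtain ⟨θ, hθ, hθ'⟩ := exists_isotopy_of_constantBasicClass
    (η := fun t ↦ (σ t).pullback (φ t)) (hσs.pullback hφ.contMDiff_comp_sin_sq)
    (by simpa only [h0] using hσ0.closed)
    (by
      intro t ht x
      simp only [h0]
      obtain ⟨Φ, hΦ⟩ := hφ.diffeo t ht
      refine Form.ker_pullback ?_ (hconj t ht x)
      rw [← hΦ]
      exact (Φ.mfderivToContinuousLinearEquiv (by simp) x).bijective)
    (fun x ↦ by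
      have h1 := finrank_ker_eq_one hσ0 x
      rwa [← h0] at h1)
    (by simpa only [h0] using hclass)
  -- From `φ_t^* σ_t = θ_t^* σ_0` the required isotopy is `ψ_t = θ_t ∘ φ_t⁻¹`; the rest cancels
  -- `φ_t^*` by pulling back along `φ_t⁻¹`.
  obtain ⟨ψ, hψ, hψ'⟩ := hθ.comp_symm hφ
  refine ⟨ψ, hψ, fun t ht ↦ ?_⟩
  obtain ⟨Φ, hΦ⟩ := hφ.diffeo t ht
  obtain ⟨Q, hQ⟩ := hψ.diffeo t ht
  have hφd : MDifferentiable (𝓡 (2 * n + 1)) (𝓡 (2 * n + 1)) (φ t) := by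
    rw [← hΦ]; exact Φ.contMDiff.mdifferentiable (by simp)
  have hψd : MDifferentiable (𝓡 (2 * n + 1)) (𝓡 (2 * n + 1)) (ψ t) := by
    rw [← hQ]; exact Q.contMDiff.mdifferentiable (by simp)
  have hΦs : MDifferentiable (𝓡 (2 * n + 1)) (𝓡 (2 * n + 1)) Φ.symm :=
    Φ.symm.contMDiff.mdifferentiable (by simp)
  have h1 : (σ t).pullback (φ t) = ((σ 0).pullback (ψ t)).pullback (φ t) := by
    rw [Form.pullback_comp _ hψd hφd, hψ' t ht, ← h0]
    exact hθ' t ht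
  have h2 : φ t ∘ Φ.symm = id := by
    rw [← hΦ]
    exact funext Φ.apply_symm_apply
  have h3 := congrArg (Form.pullback Φ.symm) h1
  rwa [Form.pullback_comp _ hφd hΦs, Form.pullback_comp _ hφd hΦs, h2, Form.pullback_id,
    Form.pullback_id] at h3

end Presymplectic

end

/-! ### The two statements together -/

theorem mainTheorem2 (n : ℕ) (M : Type*) [TopologicalSpace M] [T2Space M] [CompactSpace M]
    [ChartedSpace (EuclideanSpace ℝ (Fin (2 * n + 1))) M] [IsManifold (𝓡 (2 * n + 1)) ∞ M]
    (σ : ℝ → Presymplectic.Form (2 * n + 1) M 2) (hσ : Presymplectic.IsPresymplecticPath σ) :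
    ((∀ t ∈ Set.Icc (0 : ℝ) 1, ∀ x, (σ t).ker x = (σ 0).ker x) →
      Presymplectic.HasConstantBasicClass (σ 0).ker σ →
      Presymplectic.IsGivenByIsotopy σ) ∧
    (∀ φ : ℝ → M → M, Presymplectic.IsIsotopy (2 * n + 1) φ →
      (∀ t ∈ Set.Icc (0 : ℝ) 1, ∀ x,
        ((σ 0).ker x).map
          (mfderiv (𝓡 (2 * n + 1)) (𝓡 (2 * n + 1)) (φ t) x).toLinearMap
            = (σ t).ker (φ t x)) →
      Presymplectic.HasConstantBasicClass (σ 0).ker (fun t ↦ (σ t).pullback (φ t)) →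
      Presymplectic.IsGivenByIsotopy σ) := by
  have hσ0 := hσ.presymplectic 0 (by simp)
  exact ⟨fun hker hclass ↦ Presymplectic.exists_isotopy_of_constantBasicClass
    hσ.smooth.comp_sin_sq hσ0.closed hker (Presymplectic.finrank_ker_eq_one hσ0) hclass,
    fun φ hφ hconj hclass ↦ Presymplectic.isGivenByIsotopy_of_conjugate hσ hφ hconj hclass⟩
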